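/- **Setting.** Let $T>0$, let $C_0[0,T]$ be the space of real continuous functions $x$ on $[0,T]$ with $x(0)=0$, with the (completed) Wiener measure $\mathfrak m$. A property holds *s-a.e.* (scale-invariant almost everywhere) if for every $\rho>0$ it holds at $\rho y$ for $\mathfrak m$-a.e. $y$; a functional $F$ is scale-invariant measurable if $F(\rho\,\cdot)$ is Wiener measurable for all $\rho>0$. Fix a complete orthonormal sequence $(\varphi_j)$ in $L_2[0,T]$ of functions of bounded variation. For $u\in L_2[0,T]$, $x\in C_0[0,T]$ let $\langle u,x\rangle=\int_0^T u\,\tilde dx=\lim_n\sum_{j<n}(u,\varphi_j)_2\int_0^T\varphi_j\,dx$ (Paley–Wiener–Zygmund integral) whenever the limit exists, and let $\mathcal Z_h(x,\cdot)$ be the continuous version of $t\mapsto\int_0^t h\,\tilde dx$. *Analytic integrals.* Let $\mathbb C_+=\{\operatorname{Re}\lambda>0\}$. If $\Psi$ is a functional and $Z$ a process (or pair of processes) such that $J(\lambda)=\int\Psi(\lambda^{-1/2}Z(x))\,d\mathfrak m(x)$ exists for all $\lambda>0$ and $J$ extends analytically to $\mathbb C_+$, the extension $J^*(\lambda)$ is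 denoted $\int^{\mathrm{anw}_\lambda}\Psi(Z(x))\,d\mathfrak m(x)$; for real $q\neq0$, $\int^{\mathrm{anf}_q}\Psi(Z(x))\,d\mathfrak m(x)=\lim_{\lambda\to-iq,\,\lambda\in\mathbb C_+}J^*(\lambda)$ if the limit exists. *Transform.* For scale-invariant measurable $F$ put $T_{\lambda,h}(F)(y)=\int^{\mathrm{anw}_\lambda}F(y+\mathcal Z_h(x,\cdot))\,d\mathfrak m(x)$ (required to exist for s-a.e. $y$). Then $T^{(1)}_{q,h}(F)(y)=\lim_{\lambda\to-iq,\,\lambda\in\mathbb C_+}T_{\lambda,h}(F)(y)$ for s-a.e. $y$, and for $1<p\le2$, $1/p+1/p'=1$, $T^{(p)}_{q,h}(F)$ is the scale-invariant measurable functional (unique up to s-a.e. equality) with $\int|T_{\lambda,h}(F)(\rho y)-T^{(p)}_{q,h}(F)(\rho y)|^{p'}d\mathfrak m(y)\to0$ as $\lambda\to-iq$, $\lambda\in\mathbb C_+$, for every $\rho>0$. *Convolution product.* $(F*G)_q^{(k_1,k_2)}(y)=\int^{\mathrm{anf}_q}F\big(\tfrac{y+\mathcal Z_{k_1}(x,\cdot)}{\sqrt2}\big)G\big(\tfrac{y-\mathcal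 Z_{k_2}(x,\cdot)}{\sqrt2}\big)d\mathfrak m(x)$. *The class.* $\mathcal S(L_2[0,T])$ consists of the functionals $F$ on $C_0[0,T]$ for which there is a complex Borel measure $f$ on $L_2[0,T]$ with $F(x)=\int_{L_2[0,T]}e^{i\langle u,x\rangle}\,df(u)$ at every $x$ for which $\langle u,x\rangle$ exists for $|f|$-a.e. $u$ (in particular for s-a.e. $x$); the values of $F$ at the other $x$ are arbitrary. **Theorem 3.6.** Let $F,G\in\mathcal S(L_2[0,T])$, and let $h,k_1,k_2$ be nonzero functions in $L_\infty[0,T]$ with $h^2=k_1k_2$ a.e. on $[0,T]$. For $j=1,2$ let $\mathbf s(h,k_j)\in L_2[0,T]$ be any function with $\mathbf s(h,k_j)^2=h^2+k_j^2$ a.e. Let $p\in[1,2]$ and let $q\ne0$ be real. Then the transforms $T^{(p)}_{q,\mathbf s(h,k_1)/\sqrt2}(F)$ and $T^{(p)}_{q,\mathbf s(h,k_2)/\sqrt2}(G)$ exist and have versions in $\mathcal S(L_2[0,T])$, the transform $T^{(p)}_{q,h}\big(F(\tfrac{\cdot}{\sqrt2})G(\tfrac{\cdot}{\sqrt2})\big)$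 exists, and, for all versions of the first two transforms that lie in $\mathcal S(L_2[0,T])$ and every version of the third, $$\Big(T^{(p)}_{q,\mathbf s(h,k_1)/\sqrt2}(F)*T^{(p)}_{q,\mathbf s(h,k_2)/\sqrt2}(G)\Big)_{-q}^{(k_1,k_2)}(y)=T^{(p)}_{q,h}\Big(F\big(\tfrac{\cdot}{\sqrt2}\big)G\big(\tfrac{\cdot}{\sqrt2}\big)\Big)(y)$$ for s-a.e. $y\in C_0[0,T]$, the convolution product on the left existing for s-a.e. $y$. -/

import Mathlib

open MeasureTheory ProbabilityTheory Filter Topology Set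

noncomputable section

namespace FresnelGFFT

/-! ### Wiener space -/

/-- `C₀[0,T]`: the continuous real functions on `[0,T]` that vanish at `0`, as a subspace of the
Banach space of continuous functions with the uniform norm. -/
abbrev C0 (T : ℝ) : Submodule ℝ C(Icc (0 : ℝ) T, ℝ) where
  carrier := {x | ∀ t : Icc (0 : ℝ) T, (t : ℝ) = 0 → x t = 0}
  add_mem' := by
    intro a b ha hb t ht
    simp [ha t ht, hb t ht]
  zero_mem' := by
    intro t _
    simp
  smul_mem' := by
    intro c a ha t ht
    simp [ha t ht]

/-- The Borel σ-algebra of `C₀[0,T]` (the same as the σ-algebra of the coordinate maps). -/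
instance instMeasurableSpaceC0 (T : ℝ) : MeasurableSpace (C0 T) := borel (C0 T)

instance instBorelSpaceC0 (T : ℝ) : BorelSpace (C0 T) := ⟨rfl⟩

/-- The value `x(t)` of a path, for a real number `t` (zero outside `[0,T]`). -/
def pathEval {T : ℝ} (x : C0 T) (t : ℝ) : ℝ :=
  if ht : t ∈ Icc (0 : ℝ) T then (x : C(Icc (0 : ℝ) T, ℝ)) ⟨t, ht⟩ else 0

/-- `m` is Wiener measure on (the Borel sets of) `C₀[0,T]`: the law under which the coordinate
process is a centred Gaussian process with covariance `min(s,t)`. This determines `m` uniquely.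
Its completion is the complete Wiener measure; "Wiener measurable" functionals are the
`AEMeasurable` ones. -/
structure IsWienerMeasure (T : ℝ) (m : Measure (C0 T)) : Prop where
  isProbabilityMeasure : IsProbabilityMeasure m
  isGaussianProcess :
    IsGaussianProcess (fun (t : Icc (0 : ℝ) T) (x : C0 T) => pathEval x t) m
  mean_zero : ∀ t : Icc (0 : ℝ) T, ∫ x, pathEval x t ∂m = 0
  covariance : ∀ s t : Icc (0 : ℝ) T,
    ∫ x, pathEval x s * pathEval x t ∂m = min (s : ℝ) (t : ℝ)

/-- `P` holds scale-invariant almost everywhere: the set `N` where `P` fails satisfies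
`m(ρN) = 0` for every `ρ > 0`. -/
def SAE {T : ℝ} (m : Measure (C0 T)) (P : C0 T → Prop) : Prop :=
  ∀ ρ : ℝ, 0 < ρ → ∀ᵐ y ∂m, P (ρ • y)

/-- `F` is scale-invariant measurable: `F(ρ ·)` is Wiener measurable for every `ρ > 0`. -/
def ScaleInvMeasurable {T : ℝ} (m : Measure (C0 T)) (F : C0 T → ℂ) : Prop :=
  ∀ ρ : ℝ, 0 < ρ → AEMeasurable (fun y => F (ρ • y)) m

/-! ### The Paley–Wiener–Zygmund integral and the Gaussian processes -/

/-- Lebesgue measure on `[0,T]`. -/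
def leb (T : ℝ) : Measure ℝ := volume.restrict (Icc 0 T)

/-- `φ` is a complete orthonormal sequence of `L₂[0,T]` that consists of functions of bounded
variation, as used in the Paley–Wiener–Zygmund integral. -/
structure IsPWZBasis (T : ℝ) (φ : ℕ → ℝ → ℝ) : Prop where
  boundedVariation : ∀ j, BoundedVariationOn (φ j) (Icc 0 T)
  orthonormal : ∀ i j, ∫ t, φ i t * φ j t ∂(leb T) = if i = j then 1 else 0
  complete : ∀ u : ℝ → ℝ, MemLp u 2 (leb T) →
    (∀ j, ∫ t, u t * φ j t ∂(leb T) = 0) → u =ᵐ[leb T] 0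

/-- The Riemann–Stieltjes integral `∫₀ᵀ g(t) dx(t)` of a function `g` of bounded variation against
a continuous path `x`, as the limit of the sums over the uniform partitions. -/
def rsIntegral {T : ℝ} (g : ℝ → ℝ) (x : C0 T) : ℝ :=
  limUnder atTop fun n : ℕ => ∑ k ∈ Finset.range n,
    g (k * T / n) * (pathEval x ((k + 1 : ℕ) * T / n) - pathEval x (k * T / n))

/-- The `n`-th approximation `∫₀ᵀ ∑_{j<n} (u,φ_j)₂ φ_j(t) dx(t)` to the
Paley–Wiener–Zygmund integral. -/
def pwzApprox {T : ℝ} (φ : ℕ → ℝ → ℝ) (u : ℝ → ℝ) (x : C0 T) (n : ℕ) : ℝ :=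
  ∑ j ∈ Finset.range n, (∫ t, u t * φ j t ∂(leb T)) * rsIntegral (φ j) x

/-- The Paley–Wiener–Zygmund integral `⟨u,x⟩ = ∫₀ᵀ u(t) d~x(t)` exists and equals `c`. -/
def HasPWZ {T : ℝ} (φ : ℕ → ℝ → ℝ) (u : ℝ → ℝ) (x : C0 T) (c : ℝ) : Prop :=
  Tendsto (pwzApprox φ u x) atTop (𝓝 c)

/-- The value of the Paley–Wiener–Zygmund integral `⟨u,x⟩` (used only where it exists). -/
def pwz {T : ℝ} (φ : ℕ → ℝ → ℝ) (u : ℝ → ℝ) (x : C0 T) : ℝ :=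
  limUnder atTop (pwzApprox φ u x)

/-- `z` is the continuous path `t ↦ ∫₀ᵗ h(s) d~x(s)`: equality is required for `t` in the dense
set of rational multiples of `T`, which determines the continuous path `z`. -/
def IsGaussPath {T : ℝ} (φ : ℕ → ℝ → ℝ) (h : ℝ → ℝ) (x z : C0 T) : Prop :=
  ∀ r : ℚ, 0 ≤ r → r ≤ 1 → HasPWZ φ ((Icc 0 (r * T)).indicator h) x (pathEval z (r * T))

open Classical in
/-- The path `𝒵_h(x,·)` of the Gaussian process `𝒵_h(x,t) = ∫₀ᵗ h(s) d~x(s)`; for the (Wiener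
null set of) `x` for which there is no such continuous path the value is `0`. -/
def gaussProc {T : ℝ} (φ : ℕ → ℝ → ℝ) (h : ℝ → ℝ) (x : C0 T) : C0 T :=
  if H : ∃ z : C0 T, IsGaussPath φ h x z then H.choose else 0

/-! ### Generalized analytic Wiener integral, transform and convolution product -/

/-- The open right half-plane `ℂ₊`. -/
def rightHalfPlane : Set ℂ := {z | 0 < z.re}

/-- `J` is, on `ℂ₊`, the generalized analytic Wiener integral
`λ ↦ ∫^{anw_λ} Ψ(Z(x)) dm(x)`: for all `λ > 0` the integral of `Ψ(λ^{-1/2} Z(x))` exists and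
equals `J(λ)`, and `J` is analytic on `ℂ₊`. Here `Z` is one process with paths in `C₀[0,T]`, or a
pair of such processes. -/
def IsAnalyticWienerIntegral {T : ℝ} {E : Type*} [AddCommGroup E] [Module ℝ E]
    (m : Measure (C0 T)) (Ψ : E → ℂ) (Z : C0 T → E) (J : ℂ → ℂ) : Prop :=
  (∀ l : ℝ, 0 < l → Integrable (fun x => Ψ ((Real.sqrt l)⁻¹ • Z x)) m ∧
    ∫ x, Ψ ((Real.sqrt l)⁻¹ • Z x) ∂m = J l) ∧
  DifferentiableOn ℂ J rightHalfPlane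

/-- The filter `λ → -iq`, `λ ∈ ℂ₊`. -/
def feynmanFilter (q : ℝ) : Filter ℂ := 𝓝[rightHalfPlane] (-Complex.I * q)

/-- `c` is the generalized analytic Feynman integral `∫^{anf_q} Ψ(Z(x)) dm(x)`. -/
def IsAnalyticFeynmanIntegral {T : ℝ} {E : Type*} [AddCommGroup E] [Module ℝ E]
    (m : Measure (C0 T)) (Ψ : E → ℂ) (Z : C0 T → E) (q : ℝ) (c : ℂ) : Prop :=
  ∃ J : ℂ → ℂ, IsAnalyticWienerIntegral m Ψ Z J ∧ Tendsto J (feynmanFilter q) (𝓝 c)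

/-- `H` is (a version of) the `L_p` analytic generalized Fourier–Feynman transform
`T_{q,h}^{(p)}(F)`, for `1 ≤ p ≤ 2`. Here `J y l` is `T_{l,h}(F)(y)`. For `p = 1` the limit is taken
pointwise for s-a.e. `y`; for `p > 1` it is the limit in the mean of order `p' = p/(p-1)` at every
scale `ρ > 0`. -/
def IsGFFT {T : ℝ} (m : Measure (C0 T)) (φ : ℕ → ℝ → ℝ) (p q : ℝ) (h : ℝ → ℝ)
    (F H : C0 T → ℂ) : Prop :=
  ScaleInvMeasurable m F ∧
  ∃ J : C0 T → ℂ → ℂ,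
    SAE m (fun y => IsAnalyticWienerIntegral m (fun z : C0 T => F (y + z)) (gaussProc φ h) (J y)) ∧
    (p = 1 → SAE m fun y => Tendsto (J y) (feynmanFilter q) (𝓝 (H y))) ∧
    (1 < p → ScaleInvMeasurable m H ∧
      (∀ l ∈ rightHalfPlane, ScaleInvMeasurable m fun y => J y l) ∧
      ∀ ρ : ℝ, 0 < ρ → Tendsto
        (fun l => ∫⁻ y, ‖J (ρ • y) l - H (ρ • y)‖ₑ ^ (p / (p - 1)) ∂m) (feynmanFilter q) (𝓝 0))

/-- The generalized convolution product `(F * G)_q^{(h₁,h₂)}` exists at `y` and has the value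
`c`. -/
def HasGCP {T : ℝ} (m : Measure (C0 T)) (φ : ℕ → ℝ → ℝ) (q : ℝ) (h₁ h₂ : ℝ → ℝ)
    (F G : C0 T → ℂ) (y : C0 T) (c : ℂ) : Prop :=
  IsAnalyticFeynmanIntegral m
    (fun z : C0 T × C0 T => F ((Real.sqrt 2)⁻¹ • (y + z.1)) * G ((Real.sqrt 2)⁻¹ • (y - z.2)))
    (fun x => (gaussProc φ h₁ x, gaussProc φ h₂ x)) q c

/-! ### The Fresnel-type class `𝒮(L₂[0,T])` -/

/-- The Hilbert space `L₂[0,T]`. -/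
abbrev L2 (T : ℝ) : Type := Lp ℝ 2 (leb T)

/-- The Borel σ-algebra of `L₂[0,T]`. -/
instance instMeasurableSpaceL2 (T : ℝ) : MeasurableSpace (L2 T) := borel (L2 T)

instance instBorelSpaceL2 (T : ℝ) : BorelSpace (L2 T) := ⟨rfl⟩

/-- The integral `∫ exp{i⟨u,x⟩} df(u)` over `L₂[0,T]` makes sense at `x`: `⟨u,x⟩` exists for
almost every `u` with respect to the total variation of the complex measure `f`. -/
def FresnelDefinedAt {T : ℝ} (φ : ℕ → ℝ → ℝ) (f : ComplexMeasure (L2 T)) (x : C0 T) : Prop :=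
  ∀ᵐ (u : L2 T) ∂f.variation, ∃ c : ℝ, HasPWZ φ (u : ℝ → ℝ) x c

/-- `∫ exp{i⟨u,x⟩} df(u)`. -/
def fresnelIntegral {T : ℝ} (φ : ℕ → ℝ → ℝ) (f : ComplexMeasure (L2 T)) (x : C0 T) : ℂ :=
  VectorMeasure.integral f (fun u : L2 T => Complex.exp (Complex.I * ((pwz φ (u : ℝ → ℝ) x : ℝ) : ℂ)))
    (ContinuousLinearMap.mul ℝ ℂ)

/-- `F` belongs to `𝒮(L₂[0,T])`: for some complex Borel measure `f` on `L₂[0,T]` one has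
`F(x) = ∫ exp{i⟨u,x⟩} df(u)` at every `x` at which the integral makes sense, hence for s-a.e. `x`.
At the other `x` the functional is arbitrary. -/
def MemS {T : ℝ} (φ : ℕ → ℝ → ℝ) (F : C0 T → ℂ) : Prop :=
  ∃ f : ComplexMeasure (L2 T), ∀ x : C0 T, FresnelDefinedAt φ f x → F x = fresnelIntegral φ f x

end FresnelGFFT

end

noncomputable section

namespace FresnelGFFT

variable {T : ℝ}

/-! ### Riemann–Stieltjes integrals against continuous paths -/

/-! Polar decomposition writes F(x) = ∫ w₁(u) e^{i⟨u,x⟩} dν₁(u) with ν₁ finite and |w₁| = 1, and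
likewise G with ν₂, w₂. Two facts reduce the theorem to a computation with exponents: along the
Gaussian process ⟨u, 𝒵_h(x)⟩ = ⟨hu, x⟩ for almost every x (`ae_hasPWZ_gaussProc`), and ⟨hu, ·⟩ is
centred Gaussian with variance ‖hu‖² (`integral_cexp_pwz`). By Fubini, T_{λ,h}(F)(y) = ∫ w₁(u)
e^{i⟨u,y⟩} e^{-‖hu‖²/(2λ)} dν₁(u). This is analytic and bounded for λ in the half-plane, so
dominated convergence gives the limit λ → -iq for every p. The limiting factor is unimodular, so the
transform is again of Fresnel type over the same ν₁.

On the left of the theorem the transforms contribute ‖s₁u‖²/2 and ‖s₂v‖²/2, and the convolution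
product, taken at -q, contributes ‖k₁u - k₂v‖²/2 with the opposite sign. On the right stands ‖hu +
hv‖²/2. Since s_j² = h² + k_j² and the cross term is ∫ k₁k₂uv = ∫ h²uv, the exponents agree
(`norm_sq_add_norm_sq_sub`).

Two points need real work. The identity ⟨u, 𝒵_h(x)⟩ = ⟨hu, x⟩ concerns partial sums along φ whose
terms on 𝒵_h are correlated; their almost sure convergence is deduced from the independent case
through an auxiliary independent path (`ae_exists_tendsto_sum_mul_pwz`). Moreover a transform is
determined only s-a.e., whereas the convolution evaluates it at (y ± 𝒵_k)/√2, whose law need not be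
absolutely continuous with respect to any rescaled Wiener measure. The remedy is that every version
in the class has the same representing measure (`MemS.eq_integral_of_ae_eq`): if ∫ w(u) e^{i⟨u,y⟩}
dν(u) vanishes for almost every y, averaging against e^{-i⟨v,y⟩} gives ∫ w(u) e^{-‖u-v‖²/2} dν(u) =
0 for all v, and uniqueness of Laplace transforms gives w = 0. -/

lemma pathEval_add (x y : C0 T) (t : ℝ) : pathEval (x + y) t = pathEval x t + pathEval y t := by
  unfold pathEval; split_ifs <;> simp

lemma pathEval_smul (c : ℝ) (x : C0 T) (t : ℝ) : pathEval (c • x) t = c * pathEval x t := by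
  unfold pathEval; split_ifs <;> simp

lemma pathEval_zero (x : C0 T) : pathEval x 0 = 0 := by
  unfold pathEval
  split_ifs with h
  · exact x.2 ⟨0, h⟩ rfl
  · rfl

lemma pathEval_of_mem (x : C0 T) {t : ℝ} (ht : t ∈ Icc (0 : ℝ) T) :
    pathEval x t = (x : C(Icc (0 : ℝ) T, ℝ)) ⟨t, ht⟩ := by
  unfold pathEval; rw [dif_pos ht]

lemma continuous_pathEval_left (t : ℝ) : Continuous fun x : C0 T => pathEval x t := by
  by_cases ht : t ∈ Icc (0 : ℝ) T
  · simp only [pathEval_of_mem _ ht]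
    exact (continuous_eval_const (F := C(Icc (0 : ℝ) T, ℝ)) _).comp continuous_subtype_val
  · simp only [pathEval, dif_neg ht]
    exact continuous_const

lemma measurable_pathEval (t : ℝ) : Measurable fun x : C0 T => pathEval x t :=
  (continuous_pathEval_left t).measurable

lemma exists_modulus (x : C0 T) {ε : ℝ} (hε : 0 < ε) :
    ∃ δ > 0, ∀ s ∈ Icc (0 : ℝ) T, ∀ t ∈ Icc (0 : ℝ) T, |s - t| < δ →
      |pathEval x s - pathEval x t| < ε := by
  have h := CompactSpace.uniformContinuous_of_continuous
    (x : C(Icc (0 : ℝ) T, ℝ)).continuous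
  obtain ⟨δ, hδ, H⟩ := Metric.uniformContinuous_iff.1 h ε hε
  refine ⟨δ, hδ, fun s hs t ht hst => ?_⟩
  rw [pathEval_of_mem x hs, pathEval_of_mem x ht, ← Real.dist_eq]
  exact H (by rwa [Subtype.dist_eq, Real.dist_eq])

/-- The left-endpoint Riemann–Stieltjes sum over the uniform partition into `n` pieces. -/
def rsSum (g : ℝ → ℝ) (x : C0 T) (n : ℕ) : ℝ :=
  ∑ k ∈ Finset.range n,
    g (k * T / n) * (pathEval x ((k + 1 : ℕ) * T / n) - pathEval x (k * T / n))

/-- The sum obtained from `rsSum` by summation by parts. -/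
def rsSumParts (g : ℝ → ℝ) (x : C0 T) (n : ℕ) : ℝ :=
  ∑ k ∈ Finset.range n,
    pathEval x ((k + 1 : ℕ) * T / n) * (g ((k + 1 : ℕ) * T / n) - g (k * T / n))

/-- Summation by parts moves the increments onto g, where bounded variation controls them. The
boundary term at 0 vanishes because paths start at 0, and n ≠ 0 puts the last node at T. -/
lemma rsSum_eq_sub_rsSumParts (g : ℝ → ℝ) (x : C0 T) {n : ℕ} (hn : n ≠ 0) :
    rsSum g x n = g T * pathEval x T - rsSumParts g x n := by
  have h := Finset.sum_range_sub (fun k : ℕ => g (k * T / n) * pathEval x (k * T / n)) n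
  have hn' : (n : ℝ) ≠ 0 := by exact_mod_cast hn
  have e1 : (n : ℝ) * T / n = T := by field_simp
  simp only [e1, Nat.cast_zero, zero_mul, zero_div, pathEval_zero, mul_zero, sub_zero] at h
  rw [← h, rsSum, rsSumParts, ← Finset.sum_sub_distrib]
  refine Finset.sum_congr rfl fun k _ => ?_
  ring

lemma sum_range_mul_eq (f : ℕ → ℝ) (n m : ℕ) :
    ∑ i ∈ Finset.range (n * m), f i =
      ∑ k ∈ Finset.range n, ∑ j ∈ Finset.range m, f (k * m + j) := by
  induction n with
  | zero => simp
  | succ n ih => rw [Nat.succ_mul, Finset.sum_range_add, ih, Finset.sum_range_succ]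

lemma partition_mem (hT : 0 < T) {n k : ℕ} (hk : k ≤ n) : (k : ℝ) * T / n ∈ Icc (0 : ℝ) T := by
  constructor
  · positivity
  · rcases Nat.eq_zero_or_pos n with rfl | hn
    · simp [hT.le]
    · rw [div_le_iff₀ (by exact_mod_cast hn), mul_comm]
      gcongr

lemma sum_abs_sub_le_variation (hT : 0 < T) {g : ℝ → ℝ} (hg : BoundedVariationOn g (Icc 0 T))
    (n : ℕ) :
    ∑ k ∈ Finset.range n, |g ((k + 1 : ℕ) * T / n) - g (k * T / n)| ≤
      (eVariationOn g (Icc 0 T)).toReal := by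
  have hm : MonotoneOn (fun k : ℕ => (k : ℝ) * T / n) (Iic n) := by
    intro a _ b _ hab
    have : (a : ℝ) ≤ b := by exact_mod_cast hab
    simp only
    gcongr
  have h := eVariationOn.sum_le_of_monotoneOn_Iic (f := g) (s := Icc 0 T) hm
    (fun i hi => partition_mem hT hi)
  rw [← ENNReal.ofReal_le_iff_le_toReal hg,
    ENNReal.ofReal_sum_of_nonneg fun _ _ => abs_nonneg _]
  simpa [edist_dist, Real.dist_eq] using h

/-- Written over the fine partition, both sums carry the same increments of g. Only the point at
which x is evaluated changes, by at most T/n, and the total variation bounds what remains. -/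
lemma abs_rsSumParts_sub_le (hT : 0 < T) {g : ℝ → ℝ} (hg : BoundedVariationOn g (Icc 0 T))
    (x : C0 T) {n m : ℕ} (hn : 0 < n) (hm : 0 < m) {ε : ℝ}
    (hx : ∀ s ∈ Icc (0 : ℝ) T, ∀ t ∈ Icc (0 : ℝ) T, |s - t| ≤ T / n →
      |pathEval x s - pathEval x t| ≤ ε) (hε : 0 ≤ ε) :
    |rsSumParts g x (n * m) - rsSumParts g x n| ≤ ε * (eVariationOn g (Icc 0 T)).toReal := by
  have hn' : (0 : ℝ) < n := by exact_mod_cast hn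
  have hm' : (0 : ℝ) < m := by exact_mod_cast hm
  set t : ℕ → ℝ := fun i => (i : ℝ) * T / ((n * m : ℕ) : ℝ) with ht
  have key : ∀ k : ℕ, (k : ℝ) * T / n = t (k * m) := by
    intro k; simp only [ht]; push_cast; field_simp
  have hcoarse : rsSumParts g x n = ∑ k ∈ Finset.range n, ∑ j ∈ Finset.range m,
      pathEval x (t ((k + 1) * m)) * (g (t (k * m + j + 1)) - g (t (k * m + j))) := by
    unfold rsSumParts
    refine Finset.sum_congr rfl fun k _ => ?_
    rw [← Finset.mul_sum, key, key]
    congr 1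
    have := Finset.sum_range_sub (fun j => g (t (k * m + j))) m
    simp only [add_zero] at this
    rw [show (k + 1) * m = k * m + m by ring, ← this]
    rfl
  have hfine : rsSumParts g x (n * m) = ∑ k ∈ Finset.range n, ∑ j ∈ Finset.range m,
      pathEval x (t (k * m + j + 1)) * (g (t (k * m + j + 1)) - g (t (k * m + j))) := by
    unfold rsSumParts
    rw [sum_range_mul_eq]
  have hbd : ∑ k ∈ Finset.range n, ∑ j ∈ Finset.range m,
      |g (t (k * m + j + 1)) - g (t (k * m + j))| ≤ (eVariationOn g (Icc 0 T)).toReal := by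
    have := sum_abs_sub_le_variation hT hg (n * m)
    rwa [sum_range_mul_eq] at this
  rw [hcoarse, hfine, ← Finset.sum_sub_distrib]
  calc _ ≤ ∑ k ∈ Finset.range n, ∑ j ∈ Finset.range m,
        ε * |g (t (k * m + j + 1)) - g (t (k * m + j))| := by
        refine (Finset.abs_sum_le_sum_abs _ _).trans (Finset.sum_le_sum fun k hk => ?_)
        rw [← Finset.sum_sub_distrib]
        refine (Finset.abs_sum_le_sum_abs _ _).trans (Finset.sum_le_sum fun j hj => ?_)
        rw [← sub_mul, abs_mul]
        rw [Finset.mem_range] at hk hj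
        have h1 : k * m + j + 1 ≤ n * m := by nlinarith
        have h2 : (k + 1) * m ≤ n * m := Nat.mul_le_mul_right _ hk
        refine mul_le_mul_of_nonneg_right
          (hx _ (partition_mem hT h1) _ (partition_mem hT h2) ?_) (abs_nonneg _)
        have e : t (k * m + j + 1) - t ((k + 1) * m) = ((j : ℝ) + 1 - m) / m * (T / n) := by
          simp only [ht]; push_cast; field_simp; ring
        have hj' : (j : ℝ) + 1 ≤ m := by exact_mod_cast hj
        rw [show (k * m + j + 1 : ℕ) = k * m + j + 1 from rfl, e, abs_mul,
          abs_of_nonneg (by positivity : 0 ≤ T / n)]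
        refine mul_le_of_le_one_left (by positivity) ?_
        rw [abs_le, le_div_iff₀ hm', div_le_iff₀ hm']
        have : (0 : ℝ) ≤ j := Nat.cast_nonneg j
        constructor <;> linarith
    _ ≤ _ := by
        simp only [← Finset.mul_sum]
        gcongr

/-- Uniform partitions are not nested, so the partitions into a and b pieces are both compared with
their common refinement into ab pieces. -/
lemma exists_tendsto_rsSum (hT : 0 < T) {g : ℝ → ℝ} (hg : BoundedVariationOn g (Icc 0 T))
    (x : C0 T) : ∃ c, Tendsto (rsSum g x) atTop (𝓝 c) := by
  have hc : CauchySeq (rsSumParts g x) := by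
    rw [Metric.cauchySeq_iff]
    intro ε hε
    set V := (eVariationOn g (Icc 0 T)).toReal with hV
    have hV0 : 0 ≤ V := ENNReal.toReal_nonneg
    -- The denominator 2V + 1 makes the two comparison errors add up to less than ε, also when V =
    -- 0.
    obtain ⟨δ, hδ, H⟩ := exists_modulus x (ε := ε / (2 * V + 1)) (by positivity)
    obtain ⟨N, hN⟩ := exists_nat_gt (T / δ)
    have hNpos : 0 < N := by
      have : (0 : ℝ) < N := lt_trans (by positivity) hN
      exact_mod_cast this
    have main : ∀ n ≥ N, ∀ s ∈ Icc (0 : ℝ) T, ∀ t ∈ Icc (0 : ℝ) T, |s - t| ≤ T / n →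
        |pathEval x s - pathEval x t| ≤ ε / (2 * V + 1) := by
      intro n hn s hs t ht hst
      refine (H s hs t ht (hst.trans_lt ?_)).le
      have h1 : (N : ℝ) ≤ n := by exact_mod_cast hn
      have h2 : T / δ < n := hN.trans_le h1
      have : (0 : ℝ) < n := lt_trans (by positivity) h2
      rw [div_lt_iff₀ hδ] at h2
      rw [div_lt_iff₀ this]
      linarith
    refine ⟨N, fun a ha b hb => ?_⟩
    have ha0 : 0 < a := hNpos.trans_le ha
    have hb0 : 0 < b := hNpos.trans_le hb
    have hε' : 0 ≤ ε / (2 * V + 1) := by positivity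
    have h1 := abs_rsSumParts_sub_le hT hg x ha0 hb0 (main a ha) hε'
    have h2 := abs_rsSumParts_sub_le hT hg x hb0 ha0 (main b hb) hε'
    rw [mul_comm b a] at h2
    rw [Real.dist_eq]
    have h3 : ε / (2 * V + 1) * V + ε / (2 * V + 1) * V < ε := by
      rw [← two_mul, ← mul_assoc, mul_comm 2, mul_assoc, div_mul_eq_mul_div, div_lt_iff₀ (by positivity)]
      nlinarith
    rw [abs_le] at h1 h2
    rw [abs_lt]
    constructor <;> linarith [h1.1, h1.2, h2.1, h2.2]
  obtain ⟨c, hc⟩ := cauchySeq_tendsto_of_complete hc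
  refine ⟨g T * pathEval x T - c, (tendsto_const_nhds.sub hc).congr' ?_⟩
  filter_upwards [eventually_ne_atTop 0] with n hn
  rw [rsSum_eq_sub_rsSumParts g x hn]

lemma tendsto_rsSum (hT : 0 < T) {g : ℝ → ℝ} (hg : BoundedVariationOn g (Icc 0 T)) (x : C0 T) :
    Tendsto (rsSum g x) atTop (𝓝 (rsIntegral g x)) :=
  tendsto_nhds_limUnder (exists_tendsto_rsSum hT hg x)

lemma rsIntegral_add (hT : 0 < T) {g : ℝ → ℝ} (hg : BoundedVariationOn g (Icc 0 T))
    (x y : C0 T) : rsIntegral g (x + y) = rsIntegral g x + rsIntegral g y := by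
  refine tendsto_nhds_unique (tendsto_rsSum hT hg (x + y))
    (((tendsto_rsSum hT hg x).add (tendsto_rsSum hT hg y)).congr fun n => ?_)
  simp only [rsSum, ← Finset.sum_add_distrib, pathEval_add]
  exact Finset.sum_congr rfl fun k _ => by ring

lemma rsIntegral_smul (hT : 0 < T) {g : ℝ → ℝ} (hg : BoundedVariationOn g (Icc 0 T))
    (c : ℝ) (x : C0 T) : rsIntegral g (c • x) = c * rsIntegral g x := by
  refine tendsto_nhds_unique (tendsto_rsSum hT hg (c • x))
    (((tendsto_rsSum hT hg x).const_mul c).congr fun n => ?_)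
  simp only [rsSum, Finset.mul_sum, pathEval_smul]
  exact Finset.sum_congr rfl fun k _ => by ring

lemma rsSum_sum {ι : Type*} (s : Finset ι) (c : ι → ℝ) (g : ι → ℝ → ℝ) (x : C0 T) (n : ℕ) :
    rsSum (fun t => ∑ j ∈ s, c j * g j t) x n = ∑ j ∈ s, c j * rsSum (g j) x n := by
  simp only [rsSum, Finset.mul_sum, Finset.sum_mul]
  rw [Finset.sum_comm]
  exact Finset.sum_congr rfl fun j _ => Finset.sum_congr rfl fun k _ => by ring

lemma measurable_rsSum (g : ℝ → ℝ) (n : ℕ) : Measurable fun x : C0 T => rsSum g x n := by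
  unfold rsSum
  exact Finset.measurable_sum _ fun k _ =>
    ((measurable_pathEval _).sub (measurable_pathEval _)).const_mul _

lemma measurable_rsIntegral (hT : 0 < T) {g : ℝ → ℝ} (hg : BoundedVariationOn g (Icc 0 T)) :
    Measurable fun x : C0 T => rsIntegral g x :=
  measurable_of_tendsto_metrizable (measurable_rsSum g)
    (tendsto_pi_nhds.2 fun x => tendsto_rsSum hT hg x)

/-! ### Step functions -/

/-- The left-endpoint step function of `g` for the uniform partition into `n` pieces. -/
def stepFn (T : ℝ) (g : ℝ → ℝ) (n : ℕ) (t : ℝ) : ℝ :=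
  ∑ k ∈ Finset.range n,
    g (k * T / n) * (Ioc ((k : ℝ) * T / n) ((k + 1 : ℕ) * T / n)).indicator 1 t

lemma measurable_stepFn (g : ℝ → ℝ) (n : ℕ) : Measurable (stepFn T g n) := by
  unfold stepFn
  exact Finset.measurable_sum _ fun k _ =>
    (measurable_one.indicator measurableSet_Ioc).const_mul _

/-- The index of the partition interval containing `t`. -/
lemma exists_stepFn_eq (hT : 0 < T) (g : ℝ → ℝ) {n : ℕ} (hn : 0 < n) {t : ℝ}
    (ht : t ∈ Ioc (0 : ℝ) T) :
    ∃ k < n, stepFn T g n t = g (k * T / n) ∧ |(k : ℝ) * T / n - t| ≤ T / n := by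
  have hn' : (0 : ℝ) < n := by exact_mod_cast hn
  set z : ℝ := t * n / T with hz
  have hz0 : 0 < z := by have := ht.1; positivity
  have hzn : z ≤ n := by
    rw [hz, div_le_iff₀ hT, mul_comm]
    exact mul_le_mul_of_nonneg_left ht.2 hn'.le
  have hc0 : 0 < ⌈z⌉₊ := Nat.ceil_pos.2 hz0
  -- The cells are open on the left, so the index is a ceiling minus one and not a floor.
  obtain ⟨k, hk⟩ : ∃ k, ⌈z⌉₊ = k + 1 := ⟨⌈z⌉₊ - 1, by omega⟩
  have hkn : k < n := by
    have : ⌈z⌉₊ ≤ n := Nat.ceil_le.2 hzn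
    omega
  have hzk1 : z ≤ k + 1 := by have := Nat.le_ceil z; rw [hk] at this; exact_mod_cast this
  have hzk : (k : ℝ) < z := by
    have : k < ⌈z⌉₊ := by omega
    exact Nat.lt_ceil.1 this
  have htz : t = z * T / n := by rw [hz]; field_simp
  have hmem : ∀ i : ℕ, t ∈ Ioc ((i : ℝ) * T / n) ((i + 1 : ℕ) * T / n) ↔ i = k := by
    intro i
    rw [htz, mem_Ioc, div_lt_div_iff_of_pos_right hn', div_le_div_iff_of_pos_right hn',
      mul_lt_mul_iff_left₀ hT, mul_le_mul_iff_left₀ hT]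
    constructor
    · rintro ⟨h1, h2⟩
      have a1 : (i : ℝ) < k + 1 := h1.trans_le hzk1
      have a2 : (k : ℝ) < (i + 1 : ℕ) := hzk.trans_le h2
      have b1 : i < k + 1 := by exact_mod_cast a1
      have b2 : k < i + 1 := by exact_mod_cast a2
      omega
    · rintro rfl
      exact ⟨hzk, by push_cast; exact hzk1⟩
  refine ⟨k, hkn, ?_, ?_⟩
  · unfold stepFn
    rw [Finset.sum_eq_single k]
    · rw [indicator_of_mem ((hmem k).2 rfl)]; simp
    · intro i _ hik
      rw [indicator_of_notMem (fun h => hik ((hmem i).1 h))]; simp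
    · intro h; exact absurd (Finset.mem_range.2 hkn) h
  · have := (hmem k).2 rfl
    rw [mem_Ioc] at this
    have e : ((k + 1 : ℕ) : ℝ) * T / n = k * T / n + T / n := by push_cast; ring
    rw [abs_le]
    constructor <;> linarith [this.1, this.2]

lemma bv_bounded (hT : 0 < T) {g : ℝ → ℝ} (hg : BoundedVariationOn g (Icc 0 T)) :
    ∃ C, 0 ≤ C ∧ ∀ t ∈ Icc (0 : ℝ) T, |g t| ≤ C := by
  refine ⟨|g 0| + (eVariationOn g (Icc 0 T)).toReal, by positivity, fun t ht => ?_⟩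
  have := hg.dist_le ht (left_mem_Icc.2 hT.le)
  rw [Real.dist_eq] at this
  have h2 := abs_sub_abs_le_abs_sub (g t) (g 0)
  linarith

lemma ae_leb_mem_Ioo (T : ℝ) : ∀ᵐ t ∂(leb T), t ∈ Ioo (0 : ℝ) T := by
  rw [leb, ← restrict_Ioo_eq_restrict_Icc]
  exact ae_restrict_mem measurableSet_Ioo

/-- A function of bounded variation is differentiable, hence continuous, almost everywhere. At a
continuity point t the left endpoints of the cells containing t converge to t. -/
lemma tendsto_stepFn_ae (hT : 0 < T) {g : ℝ → ℝ} (hg : BoundedVariationOn g (Icc 0 T)) :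
    ∀ᵐ t ∂(leb T), Tendsto (fun n => stepFn T g n t) atTop (𝓝 (g t)) := by
  have hd := BoundedVariationOn.ae_differentiableAt_of_mem_uIcc
    (f := g) (a := 0) (b := T) (by rwa [uIcc_of_le hT.le])
  rw [uIcc_of_le hT.le] at hd
  filter_upwards [ae_leb_mem_Ioo T, ae_restrict_of_ae hd] with t ht hdt
  have hct : ContinuousAt g t := (hdt ⟨ht.1.le, ht.2.le⟩).continuousAt
  choose! k _ hk2 hk3 using fun (n : ℕ) (hn : 0 < n) =>
    exists_stepFn_eq hT g hn (t := t) ⟨ht.1, ht.2.le⟩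
  have h1 : Tendsto (fun n : ℕ => (k n : ℝ) * T / n) atTop (𝓝 t) := by
    rw [tendsto_iff_dist_tendsto_zero]
    refine squeeze_zero' (Eventually.of_forall fun _ => dist_nonneg) ?_
      (tendsto_const_div_atTop_nhds_zero_nat T)
    filter_upwards [eventually_gt_atTop 0] with n hn
    exact hk3 n hn
  refine (hct.tendsto.comp h1).congr' ?_
  filter_upwards [eventually_gt_atTop 0] with n hn
  exact (hk2 n hn).symm

lemma abs_stepFn_le (hT : 0 < T) {g : ℝ → ℝ} {C : ℝ} (hC : 0 ≤ C)
    (hg : ∀ t ∈ Icc (0 : ℝ) T, |g t| ≤ C) (n : ℕ) {t : ℝ} (ht : t ∈ Ioc (0 : ℝ) T) :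
    |stepFn T g n t| ≤ C := by
  rcases Nat.eq_zero_or_pos n with rfl | hn
  · simpa [stepFn] using hC
  · obtain ⟨k, hk, e, -⟩ := exists_stepFn_eq hT g hn ht
    rw [e]
    exact hg _ (partition_mem hT hk.le)

instance isFiniteMeasure_leb (T : ℝ) : IsFiniteMeasure (leb T) := by
  unfold leb; infer_instance

lemma bv_aestronglyMeasurable (hT : 0 < T) {g : ℝ → ℝ} (hg : BoundedVariationOn g (Icc 0 T)) :
    AEStronglyMeasurable g (leb T) :=
  aestronglyMeasurable_of_tendsto_ae atTop
    (fun n => (measurable_stepFn g n).aestronglyMeasurable) (tendsto_stepFn_ae hT hg)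

lemma bv_memLp_top (hT : 0 < T) {g : ℝ → ℝ} (hg : BoundedVariationOn g (Icc 0 T)) :
    MemLp g ⊤ (leb T) := by
  obtain ⟨C, _, hC⟩ := bv_bounded hT hg
  refine memLp_top_of_bound (bv_aestronglyMeasurable hT hg) C ?_
  filter_upwards [ae_leb_mem_Ioo T] with t ht
  exact hC t ⟨ht.1.le, ht.2.le⟩

lemma bv_memLp_two (hT : 0 < T) {g : ℝ → ℝ} (hg : BoundedVariationOn g (Icc 0 T)) :
    MemLp g 2 (leb T) :=
  (bv_memLp_top hT hg).mono_exponent le_top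

lemma integral_stepFn_sq (hT : 0 < T) (g : ℝ → ℝ) {n : ℕ} (hn : 0 < n) :
    ∫ t, stepFn T g n t ^ 2 ∂(leb T) = ∑ k ∈ Finset.range n, g (k * T / n) ^ 2 * (T / n) := by
  have hn' : (0 : ℝ) < n := by exact_mod_cast hn
  have h1 : ∀ᵐ t ∂(leb T), stepFn T g n t ^ 2 = ∑ k ∈ Finset.range n, g (k * T / n) ^ 2 *
      (Ioc ((k : ℝ) * T / n) ((k + 1 : ℕ) * T / n)).indicator 1 t := by
    filter_upwards [ae_leb_mem_Ioo T] with t ht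
    obtain ⟨k, hk, e, -⟩ := exists_stepFn_eq hT g hn (t := t) ⟨ht.1, ht.2.le⟩
    have hinj : ∀ i ∈ Finset.range n, ∀ j ∈ Finset.range n, i ≠ j →
        (Ioc ((i : ℝ) * T / n) ((i + 1 : ℕ) * T / n)).indicator (1 : ℝ → ℝ) t *
        (Ioc ((j : ℝ) * T / n) ((j + 1 : ℕ) * T / n)).indicator (1 : ℝ → ℝ) t = 0 := by
      intro i _ j _ hij
      by_contra hne
      have hi := mem_of_indicator_ne_zero (left_ne_zero_of_mul hne)
      have hj := mem_of_indicator_ne_zero (right_ne_zero_of_mul hne)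
      rw [mem_Ioc, div_lt_iff₀ hn', le_div_iff₀ hn'] at hi hj
      have a1 := lt_of_mul_lt_mul_right (hi.1.trans_le hj.2) hT.le
      have a2 := lt_of_mul_lt_mul_right (hj.1.trans_le hi.2) hT.le
      have b1 : i < j + 1 := by exact_mod_cast a1
      have b2 : j < i + 1 := by exact_mod_cast a2
      omega
    rw [sq]
    simp only [stepFn]
    rw [Finset.sum_mul_sum]
    refine Finset.sum_congr rfl fun i hi => ?_
    rw [Finset.sum_eq_single i]
    · have : ∀ S : Set ℝ, S.indicator (1 : ℝ → ℝ) t * S.indicator (1 : ℝ → ℝ) t =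
          S.indicator (1 : ℝ → ℝ) t := by
        intro S; by_cases h : t ∈ S <;> simp [h]
      linear_combination (g (i * T / n)) ^ 2 * this (Ioc ((i : ℝ) * T / n) ((i + 1 : ℕ) * T / n))
    · intro j hj hji
      linear_combination (g (i * T / n)) * g (j * T / n) * hinj i hi j hj (Ne.symm hji)
    · intro h; exact absurd hi h
  rw [integral_congr_ae h1, integral_finsetSum]
  · refine Finset.sum_congr rfl fun k hk => ?_
    rw [Finset.mem_range] at hk
    rw [integral_const_mul, integral_indicator_one measurableSet_Ioc, leb,
      measureReal_restrict_apply measurableSet_Ioc]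
    have hsub : Ioc ((k : ℝ) * T / n) ((k + 1 : ℕ) * T / n) ⊆ Icc 0 T := fun t ht =>
      ⟨(partition_mem hT hk.le).1.trans ht.1.le, ht.2.trans (partition_mem hT hk).2⟩
    rw [inter_eq_self_of_subset_left hsub, Real.volume_real_Ioc_of_le]
    · push_cast; ring
    · push_cast; gcongr; linarith
  · intro k _
    exact ((integrable_const (1 : ℝ)).indicator measurableSet_Ioc).const_mul _

/-- The factor h is the one that the Gaussian process introduces: Riemann sums along 𝒵_h are Wiener
integrals of `stepFn` times h. -/
lemma tendsto_integral_stepFn_sub_sq (hT : 0 < T) {g : ℝ → ℝ}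
    (hg : BoundedVariationOn g (Icc 0 T)) {h : ℝ → ℝ} (hh : MemLp h 2 (leb T)) :
    Tendsto (fun n => ∫ t, ((stepFn T g n t - g t) * h t) ^ 2 ∂(leb T)) atTop (𝓝 0) := by
  obtain ⟨C, hC0, hC⟩ := bv_bounded hT hg
  have := tendsto_integral_of_dominated_convergence (μ := leb T)
    (F := fun n t => ((stepFn T g n t - g t) * h t) ^ 2) (f := fun _ => 0)
    (fun t => (2 * C) ^ 2 * h t ^ 2)
    (fun n => ((((measurable_stepFn g n).aestronglyMeasurable.sub
      (bv_aestronglyMeasurable hT hg)).mul hh.1).pow 2))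
    (hh.integrable_sq.const_mul _) ?_ ?_
  · simpa using this
  · intro n
    filter_upwards [ae_leb_mem_Ioo T] with t ht
    have h1 := abs_stepFn_le hT hC0 hC n (t := t) ⟨ht.1, ht.2.le⟩
    have h2 := hC t ⟨ht.1.le, ht.2.le⟩
    have h3 : |stepFn T g n t - g t| ≤ 2 * C := (abs_sub _ _).trans (by linarith)
    rw [Real.norm_eq_abs, abs_of_nonneg (sq_nonneg _), mul_pow]
    exact mul_le_mul_of_nonneg_right (sq_le_sq' (by linarith [(abs_le.1 h3).1])
      (abs_le.1 h3).2) (sq_nonneg _)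
  · filter_upwards [tendsto_stepFn_ae hT hg] with t ht
    have := (((ht.sub_const (g t)).mul_const (h t)).pow 2)
    simpa using this

lemma tendsto_integral_stepFn_sq (hT : 0 < T) {g : ℝ → ℝ}
    (hg : BoundedVariationOn g (Icc 0 T)) :
    Tendsto (fun n => ∫ t, stepFn T g n t ^ 2 ∂(leb T)) atTop (𝓝 (∫ t, g t ^ 2 ∂(leb T))) := by
  obtain ⟨C, hC0, hC⟩ := bv_bounded hT hg
  refine tendsto_integral_of_dominated_convergence (fun _ => C ^ 2)
    (fun n => (measurable_stepFn g n).aestronglyMeasurable.pow 2) (integrable_const _) ?_ ?_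
  · intro n
    filter_upwards [ae_leb_mem_Ioo T] with t ht
    have h1 := abs_stepFn_le hT hC0 hC n (t := t) ⟨ht.1, ht.2.le⟩
    rw [Real.norm_eq_abs, abs_of_nonneg (sq_nonneg _)]
    exact sq_le_sq' (by linarith [(abs_le.1 h1).1]) (abs_le.1 h1).2
  · filter_upwards [tendsto_stepFn_ae hT hg] with t ht
    exact ht.pow 2

end FresnelGFFT
end


noncomputable section

namespace FresnelGFFT

variable {T : ℝ}

/-! ### Laws of countable families and characteristic functions -/

lemma norm_cexp_I_mul (r : ℝ) : ‖Complex.exp (Complex.I * r)‖ = 1 := by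
  rw [mul_comm]; exact Complex.norm_exp_ofReal_mul_I r

/-- Linear combinations determine the finite-dimensional characteristic functions, hence the
finite-dimensional laws, and a projective limit is unique. This serves to carry almost sure
properties from a model process to the process of interest. -/
lemma map_eq_of_integral_cexp_eq {ι Ω Ω' : Type*} [Countable ι] {mΩ : MeasurableSpace Ω}
    {mΩ' : MeasurableSpace Ω'} {P : Measure Ω} {P' : Measure Ω'} [IsProbabilityMeasure P]
    [IsProbabilityMeasure P'] {X : ι → Ω → ℝ} {Y : ι → Ω' → ℝ}
    (hX : ∀ i, AEMeasurable (X i) P) (hY : ∀ i, AEMeasurable (Y i) P')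
    (h : ∀ (s : Finset ι) (c : ι → ℝ),
      ∫ ω, Complex.exp (Complex.I * ((∑ i ∈ s, c i * X i ω : ℝ) : ℂ)) ∂P =
      ∫ ω, Complex.exp (Complex.I * ((∑ i ∈ s, c i * Y i ω : ℝ) : ℂ)) ∂P') :
    P.map (fun ω i => X i ω) = P'.map (fun ω i => Y i ω) := by
  classical
  have hX' : AEMeasurable (fun ω i => X i ω) P := aemeasurable_pi_iff.2 hX
  have hY' : AEMeasurable (fun ω i => Y i ω) P' := aemeasurable_pi_iff.2 hY
  have : IsProbabilityMeasure (P.map (fun ω i => X i ω)) := Measure.isProbabilityMeasure_map hX'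
  have : IsProbabilityMeasure (P'.map (fun ω i => Y i ω)) := Measure.isProbabilityMeasure_map hY'
  have hfin : ∀ I : Finset ι, P.map (fun ω => I.restrict (X · ω)) =
      P'.map (fun ω => I.restrict (Y · ω)) := by
    intro I
    have hXI : AEMeasurable (fun ω => I.restrict (X · ω)) P :=
      aemeasurable_pi_iff.2 fun i => hX i
    have hYI : AEMeasurable (fun ω => I.restrict (Y · ω)) P' :=
      aemeasurable_pi_iff.2 fun i => hY i
    have : IsProbabilityMeasure (P.map (fun ω => I.restrict (X · ω))) :=
      Measure.isProbabilityMeasure_map hXI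
    have : IsProbabilityMeasure (P'.map (fun ω => I.restrict (Y · ω))) :=
      Measure.isProbabilityMeasure_map hYI
    refine Measure.ext_of_charFunDual (funext fun L => ?_)
    -- The coefficients of the functional L in the coordinate basis, extended by zero outside I.
    set c : ι → ℝ := fun i => if hi : i ∈ I then L (Pi.single ⟨i, hi⟩ 1) else 0 with hc
    have hL : ∀ v : ι → ℝ, L (I.restrict v) = ∑ i ∈ I, c i * v i := by
      intro v
      have e : I.restrict v = ∑ i : I, v i • (Pi.single i (1 : ℝ) : I → ℝ) := by
        ext j
        simp [Finset.sum_apply, Pi.single_apply]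
      rw [e, map_sum, ← Finset.sum_coe_sort I]
      refine Finset.sum_congr rfl fun i _ => ?_
      rw [map_smul, smul_eq_mul, mul_comm, hc]
      simp only [Finset.coe_mem, dif_pos, Subtype.coe_eta]
    rw [charFunDual_apply, charFunDual_apply, integral_map hXI (by fun_prop),
      integral_map hYI (by fun_prop)]
    simpa only [hL, mul_comm Complex.I] using h I c
  exact ((isProjectiveLimit_map hX').unique
    (P := fun I : Finset ι => P.map (fun ω => I.restrict (X · ω))) (by
      intro I
      exact (isProjectiveLimit_map hY' I).trans (hfin I).symm))

lemma integral_cexp_of_hasGaussianLaw {Ω : Type*} {mΩ : MeasurableSpace Ω} {P : Measure Ω}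
    {X : Ω → ℝ} (hX : HasGaussianLaw X P) (h0 : ∫ ω, X ω ∂P = 0) :
    ∫ ω, Complex.exp (Complex.I * (X ω : ℂ)) ∂P =
      Complex.exp ((-(∫ ω, X ω ^ 2 ∂P) / 2 : ℝ) : ℂ) := by
  have := hX.isProbabilityMeasure
  have h1 := charFun_gaussianReal (μ := P[X]) (v := Var[X; P].toNNReal) 1
  rw [← hX.map_eq_gaussianReal, charFun_apply_real, integral_map hX.aemeasurable (by fun_prop),
    variance_of_integral_eq_zero hX.aemeasurable h0, h0] at h1
  rw [Real.coe_toNNReal _ (integral_nonneg fun _ => sq_nonneg _)] at h1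
  simp only [Complex.ofReal_one, one_mul] at h1
  simp only [mul_comm Complex.I]
  rw [h1]
  congr 1
  push_cast
  simp [neg_div]

/-- If the characteristic functions of `X n` tend to `1` and `X n → Y` a.e., then `Y = 0` a.e. -/
lemma ae_eq_zero_of_tendsto {Ω : Type*} {mΩ : MeasurableSpace Ω} {P : Measure Ω}
    [IsProbabilityMeasure P] {X : ℕ → Ω → ℝ} {Y : Ω → ℝ} (hX : ∀ n, AEMeasurable (X n) P)
    (hXY : ∀ᵐ ω ∂P, Tendsto (fun n => X n ω) atTop (𝓝 (Y ω)))
    (h : ∀ θ : ℝ, Tendsto (fun n => ∫ ω, Complex.exp (Complex.I * ((θ * X n ω : ℝ) : ℂ)) ∂P)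
      atTop (𝓝 1)) : Y =ᵐ[P] 0 := by
  have hY : AEMeasurable Y P := aemeasurable_of_tendsto_metrizable_ae atTop hX hXY
  have hlim : ∀ θ : ℝ, ∫ ω, Complex.exp (Complex.I * ((θ * Y ω : ℝ) : ℂ)) ∂P = 1 := by
    intro θ
    refine tendsto_nhds_unique (tendsto_integral_of_dominated_convergence (fun _ => (1 : ℝ))
      (fun n => ?_) (integrable_const _) (fun n => ?_) ?_) (h θ)
    · have := hX n
      exact (by fun_prop : AEMeasurable _ P).aestronglyMeasurable
    · exact Eventually.of_forall fun ω => (norm_cexp_I_mul _).le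
    · filter_upwards [hXY] with ω hω
      have hc : Continuous fun r : ℝ => Complex.exp (Complex.I * ((θ * r : ℝ) : ℂ)) := by fun_prop
      exact (hc.tendsto _).comp hω
  have : IsProbabilityMeasure (P.map Y) := Measure.isProbabilityMeasure_map hY
  have hdirac : P.map Y = Measure.dirac 0 := by
    refine Measure.ext_of_charFun (funext fun θ => ?_)
    rw [charFun_dirac, charFun_apply_real, integral_map hY (by fun_prop)]
    simp only [inner_zero_left, Complex.ofReal_zero, zero_mul, Complex.exp_zero]
    rw [← hlim θ]
    refine integral_congr_ae (Eventually.of_forall fun ω => ?_)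
    simp only
    congr 1; push_cast; ring
  have : ∀ᵐ y ∂(P.map Y), y = 0 := by
    rw [hdirac]
    exact (ae_dirac_iff (p := fun y => y = 0) (measurableSet_singleton 0)).2 rfl
  exact ae_of_ae_map hY this

/-! ### Independent standard Gaussian sequences -/

/-- `ξ` is a sequence of independent standard Gaussian variables, expressed by its
characteristic functions. -/
structure IsStdGaussSeq {Ω : Type*} {mΩ : MeasurableSpace Ω} (P : Measure Ω)
    (ξ : ℕ → Ω → ℝ) : Prop where
  aemeasurable : ∀ j, AEMeasurable (ξ j) P
  charFun : ∀ (n : ℕ) (c : ℕ → ℝ),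
    ∫ ω, Complex.exp (Complex.I * ((∑ j ∈ Finset.range n, c j * ξ j ω : ℝ) : ℂ)) ∂P =
      Complex.exp ((-(∑ j ∈ Finset.range n, c j ^ 2) / 2 : ℝ) : ℂ)

/-- The coordinate space of independent standard Gaussian variables. -/
def gaussSeqMeasure : Measure (ℕ → ℝ) := Measure.infinitePi fun _ => gaussianReal 0 1

instance : IsProbabilityMeasure gaussSeqMeasure := by unfold gaussSeqMeasure; infer_instance

lemma iIndepFun_gaussSeq : iIndepFun (fun (j : ℕ) (ω : ℕ → ℝ) => ω j) gaussSeqMeasure :=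
  iIndepFun_infinitePi (P := fun _ : ℕ => gaussianReal 0 1) (X := fun _ => id)
    fun _ => measurable_id

lemma map_eval_gaussSeq (j : ℕ) :
    gaussSeqMeasure.map (fun ω => ω j) = gaussianReal 0 1 :=
  (measurePreserving_eval_infinitePi (fun _ : ℕ => gaussianReal 0 1) j).map_eq

lemma isStdGaussSeq_gaussSeq : IsStdGaussSeq gaussSeqMeasure fun j ω => ω j where
  aemeasurable j := (measurable_pi_apply j).aemeasurable
  charFun n c := by
    have hI : iIndepFun (fun (j : Fin n) (ω : ℕ → ℝ) =>
        Complex.exp (Complex.I * ((c j * ω j : ℝ) : ℂ))) gaussSeqMeasure :=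
      (iIndepFun_gaussSeq.precomp Fin.val_injective).comp
        (fun (j : Fin n) r => Complex.exp (Complex.I * ((c j * r : ℝ) : ℂ)))
        fun j => by fun_prop
    have h1 := hI.integral_fun_prod_eq_prod_integral
      (fun j => (by fun_prop : Measurable _).aestronglyMeasurable)
    have h2 : ∀ j : ℕ, ∫ ω, Complex.exp (Complex.I * ((c j * ω j : ℝ) : ℂ)) ∂gaussSeqMeasure =
        Complex.exp ((-(c j ^ 2) / 2 : ℝ) : ℂ) := by
      intro j
      have := charFun_gaussianReal (μ := 0) (v := 1) (c j)
      rw [← map_eval_gaussSeq j, charFun_apply_real,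
        integral_map (measurable_pi_apply j).aemeasurable (by fun_prop)] at this
      simp only [mul_comm Complex.I, Complex.ofReal_mul]
      rw [this]
      congr 1; push_cast; simp [neg_div]
    simp only [h2, ← Complex.exp_sum, ← Finset.mul_sum] at h1
    rw [Finset.sum_range fun j => c j ^ 2]
    simp only [Finset.sum_range]
    push_cast at h1 ⊢
    rw [h1]
    simp [neg_div, Finset.sum_div]

/-- The partial sums form a martingale whose second moments are bounded by ∑ c_j², so martingale
convergence applies. -/
lemma ae_exists_tendsto_gaussSeq {c : ℕ → ℝ} (hc : Summable fun j => c j ^ 2) :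
    ∀ᵐ ω ∂gaussSeqMeasure, ∃ l, Tendsto (fun n => ∑ j ∈ Finset.range n, c j * ω j)
      atTop (𝓝 l) := by
  have hm : ∀ j : ℕ, StronglyMeasurable fun ω : ℕ → ℝ => ω j :=
    fun j => (measurable_pi_apply j).stronglyMeasurable
  have hL2 : ∀ j : ℕ, MemLp (fun ω : ℕ → ℝ => ω j) 2 gaussSeqMeasure := by
    intro j
    have := memLp_id_gaussianReal (μ := 0) (v := 1) 2
    rw [← map_eval_gaussSeq j] at this
    exact this.comp_of_map (measurable_pi_apply j).aemeasurable
  have hmean : ∀ j : ℕ, ∫ ω, ω j ∂gaussSeqMeasure = 0 := by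
    intro j
    have := integral_id_gaussianReal (μ := 0) (v := 1)
    rw [← map_eval_gaussSeq j, integral_map (measurable_pi_apply j).aemeasurable
      (by fun_prop)] at this
    exact this
  have hvar : ∀ j : ℕ, Var[fun ω => ω j; gaussSeqMeasure] = 1 := by
    intro j
    have := variance_id_gaussianReal (μ := 0) (v := 1)
    rw [← map_eval_gaussSeq j, variance_map aemeasurable_id
      (measurable_pi_apply j).aemeasurable] at this
    exact this
  -- Summing up to index n inclusive makes S adapted to the natural filtration; the shift is undone
  -- at the end.
  set S : ℕ → (ℕ → ℝ) → ℝ := fun n ω => ∑ j ∈ Finset.range (n + 1), c j * ω j with hS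
  set ℱ := Filtration.natural (fun (j : ℕ) (ω : ℕ → ℝ) => ω j) hm
  have hSL2 : ∀ n, MemLp (S n) 2 gaussSeqMeasure := fun n =>
    memLp_finsetSum _ fun j _ => (hL2 j).const_mul _
  have hmart : Martingale S ℱ gaussSeqMeasure := by
    refine martingale_nat (fun n => ?_) (fun n => (hSL2 n).integrable one_le_two) fun n => ?_
    · refine Finset.stronglyMeasurable_fun_sum _ fun j hj => StronglyMeasurable.const_mul ?_ _
      exact (Filtration.stronglyAdapted_natural hm j).mono
        (ℱ.mono (Nat.lt_succ_iff.1 (Finset.mem_range.1 hj)))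
    · have hsm : StronglyMeasurable[ℱ n] (S n) := by
        refine Finset.stronglyMeasurable_fun_sum _ fun j hj => StronglyMeasurable.const_mul ?_ _
        exact (Filtration.stronglyAdapted_natural hm j).mono
          (ℱ.mono (Nat.lt_succ_iff.1 (Finset.mem_range.1 hj)))
      have e : S (n + 1) = S n + c (n + 1) • fun ω : ℕ → ℝ => ω (n + 1) := by
        ext ω; simp [hS, Finset.sum_range_succ]
      have h1 := condExp_add (m := ℱ n) ((hSL2 n).integrable one_le_two)
        (((hL2 (n + 1)).integrable one_le_two).smul (c (n + 1)))
      have h2 := condExp_smul (μ := gaussSeqMeasure) (c (n + 1))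
        (fun ω : ℕ → ℝ => ω (n + 1)) (ℱ n)
      have h3 := iIndepFun_gaussSeq.condExp_natural_ae_eq_of_lt hm (Nat.lt_succ_self n)
      rw [e]
      filter_upwards [h1, h2, h3] with ω h1 h2 h3
      rw [h1, Pi.add_apply, h2, Pi.smul_apply, h3,
        condExp_of_stronglyMeasurable (ℱ.le n) hsm ((hSL2 n).integrable one_le_two)]
      simp [hmean]
  have hsq : ∀ n, ∫ ω, S n ω ^ 2 ∂gaussSeqMeasure ≤ ∑' j, c j ^ 2 := by
    intro n
    have h0 : ∫ ω, S n ω ∂gaussSeqMeasure = 0 := by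
      rw [integral_finsetSum _ fun j _ => ((hL2 j).integrable one_le_two).const_mul _]
      simp [integral_const_mul, hmean]
    rw [← variance_of_integral_eq_zero (hSL2 n).1.aemeasurable h0]
    have hv := IndepFun.variance_sum (μ := gaussSeqMeasure)
      (X := fun (j : ℕ) (ω : ℕ → ℝ) => c j * ω j) (s := Finset.range (n + 1))
      (fun j _ => (hL2 j).const_mul _) fun i _ j _ hij =>
        (iIndepFun_gaussSeq.indepFun hij).comp (measurable_const_mul (c i))
          (measurable_const_mul (c j))
    have e : S n = ∑ j ∈ Finset.range (n + 1), fun ω : ℕ → ℝ => c j * ω j := by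
      ext ω; simp [hS]
    rw [e, hv]
    simp only [variance_const_mul, hvar, mul_one]
    exact hc.sum_le_tsum _ fun _ _ => sq_nonneg _
  -- The inequality |s| ≤ 1 + s² turns the second-moment bound into the L¹ bound that the
  -- convergence theorem asks for.
  set R : NNReal := (1 + ∑' j, c j ^ 2).toNNReal
  have hbdd : ∀ n, eLpNorm (S n) 1 gaussSeqMeasure ≤ R := by
    intro n
    rw [eLpNorm_one_eq_lintegral_enorm, ← ofReal_integral_norm_eq_lintegral_enorm
      ((hSL2 n).integrable one_le_two)]
    refine ENNReal.ofReal_le_ofReal ?_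
    calc ∫ ω, ‖S n ω‖ ∂gaussSeqMeasure ≤ ∫ ω, (1 + S n ω ^ 2) ∂gaussSeqMeasure := by
          refine integral_mono ((hSL2 n).integrable one_le_two).norm
            ((integrable_const _).add (hSL2 n).integrable_sq) fun ω => ?_
          simp only [Real.norm_eq_abs]
          nlinarith [sq_nonneg (|S n ω| - 1), sq_abs (S n ω), abs_nonneg (S n ω)]
      _ ≤ _ := by
          rw [integral_add (integrable_const _) (hSL2 n).integrable_sq]
          simpa using hsq n
  filter_upwards [hmart.submartingale.exists_ae_tendsto_of_bdd hbdd] with ω ⟨l, hl⟩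
  exact ⟨l, (tendsto_add_atTop_iff_nat 1).1 hl⟩

/-- Convergence of the series is a measurable event for the law of the sequence, and that law is the
product Gaussian law. -/
lemma IsStdGaussSeq.ae_exists_tendsto {Ω : Type*} {mΩ : MeasurableSpace Ω} {P : Measure Ω}
    [IsProbabilityMeasure P] {ξ : ℕ → Ω → ℝ} (h : IsStdGaussSeq P ξ) {c : ℕ → ℝ}
    (hc : Summable fun j => c j ^ 2) :
    ∀ᵐ ω ∂P, ∃ l, Tendsto (fun n => ∑ j ∈ Finset.range n, c j * ξ j ω) atTop (𝓝 l) := by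
  have hlaw : P.map (fun ω j => ξ j ω) = gaussSeqMeasure.map (fun ω j => ω j) := by
    refine map_eq_of_integral_cexp_eq h.aemeasurable isStdGaussSeq_gaussSeq.aemeasurable
      fun s d => ?_
    obtain ⟨n, hn⟩ := s.exists_nat_subset_range
    -- A combination over a finite set is padded with zero coefficients to one over an initial
    -- segment.
    have e : ∀ v : ℕ → ℝ, ∑ i ∈ s, d i * v i =
        ∑ j ∈ Finset.range n, (if j ∈ s then d j else 0) * v j := by
      intro v
      simp only [ite_mul, zero_mul]
      rw [← Finset.sum_filter, Finset.filter_mem_eq_inter, Finset.inter_eq_right.2 hn]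
    simp only [e, h.charFun]
    rw [isStdGaussSeq_gaussSeq.charFun n fun j => if j ∈ s then d j else 0]
  have hmeas : MeasurableSet {ω : ℕ → ℝ | ∃ l, Tendsto
      (fun n => ∑ j ∈ Finset.range n, c j * ω j) atTop (𝓝 l)} :=
    measurableSet_exists_tendsto fun n => by fun_prop
  have h1 := ae_exists_tendsto_gaussSeq hc
  have h2 : gaussSeqMeasure.map (fun ω j => ω j) = gaussSeqMeasure := Measure.map_id
  rw [← h2, ← hlaw] at h1
  exact ae_of_ae_map (aemeasurable_pi_iff.2 h.aemeasurable) h1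

end FresnelGFFT
end


noncomputable section

namespace FresnelGFFT

variable {T : ℝ}

/-! ### Gaussian functionals of Wiener paths -/

section Wiener

variable {m : Measure (C0 T)} (hm : IsWienerMeasure T m)
include hm

lemma IsWienerMeasure.memLp_pathEval {t : ℝ} (ht : t ∈ Icc (0 : ℝ) T) :
    MemLp (fun x : C0 T => pathEval x t) 2 m :=
  (hm.isGaussianProcess.hasGaussianLaw_eval ⟨t, ht⟩).memLp_two

lemma IsWienerMeasure.integral_cexp_sum {ι : Type*} (s : Finset ι) (c t : ι → ℝ)
    (ht : ∀ i, t i ∈ Icc (0 : ℝ) T) :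
    ∫ x, Complex.exp (Complex.I * ((∑ i ∈ s, c i * pathEval x (t i) : ℝ) : ℂ)) ∂m =
      Complex.exp ((-(∑ i ∈ s, ∑ j ∈ s, c i * c j * min (t i) (t j)) / 2 : ℝ) : ℂ) := by
  have := hm.isProbabilityMeasure
  have hG : HasGaussianLaw (fun x : C0 T => ∑ i ∈ s, c i * pathEval x (t i)) m :=
    ((hm.isGaussianProcess.comp_right fun i : ι => (⟨t i, ht i⟩ : Icc (0 : ℝ) T)).smul
      c).hasGaussianLaw_fun_sum (I := s)
  have hL2 := fun i => hm.memLp_pathEval (ht i)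
  have h0 : ∫ x, ∑ i ∈ s, c i * pathEval x (t i) ∂m = 0 := by
    rw [integral_finsetSum _ fun i _ => ((hL2 i).integrable one_le_two).const_mul _]
    refine Finset.sum_eq_zero fun i _ => ?_
    rw [integral_const_mul, hm.mean_zero ⟨t i, ht i⟩, mul_zero]
  rw [integral_cexp_of_hasGaussianLaw hG h0]
  congr 4
  have e : ∀ x : C0 T, (∑ i ∈ s, c i * pathEval x (t i)) ^ 2 =
      ∑ i ∈ s, ∑ j ∈ s, c i * c j * (pathEval x (t i) * pathEval x (t j)) := by
    intro x
    rw [sq, Finset.sum_mul_sum]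
    exact Finset.sum_congr rfl fun i _ => Finset.sum_congr rfl fun j _ => by ring
  have hint : ∀ i j, Integrable
      (fun x : C0 T => c i * c j * (pathEval x (t i) * pathEval x (t j))) m :=
    fun i j => ((hL2 i).integrable_mul (hL2 j)).const_mul _
  simp only [e]
  rw [integral_finsetSum _ fun i _ => integrable_finsetSum _ fun j _ => hint i j]
  refine Finset.sum_congr rfl fun i _ => ?_
  rw [integral_finsetSum _ fun j _ => hint i j]
  refine Finset.sum_congr rfl fun j _ => ?_
  rw [integral_const_mul, hm.covariance ⟨t i, ht i⟩ ⟨t j, ht j⟩]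

/-- Increments over distinct cells are uncorrelated with variance T/n, so the sum has variance ∑ g²
T/n, which is the integral of the squared step function. -/
lemma IsWienerMeasure.integral_cexp_rsSum (hT : 0 < T) (g : ℝ → ℝ) {n : ℕ} (hn : 0 < n) :
    ∫ x, Complex.exp (Complex.I * (rsSum g x n : ℂ)) ∂m =
      Complex.exp ((-(∫ t, stepFn T g n t ^ 2 ∂(leb T)) / 2 : ℝ) : ℂ) := by
  have hn' : (0 : ℝ) < n := by exact_mod_cast hn
  set R := Finset.range n
  -- Indices above n are sent to the time 0, so that every time lies in [0,T] as the Gaussian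
  -- formula requires.
  set p : ℕ → ℝ := fun k => if k ≤ n then (k : ℝ) * T / n else 0 with hp
  have hpm : ∀ k, p k ∈ Icc (0 : ℝ) T := by
    intro k; simp only [hp]; split_ifs with h
    · exact partition_mem hT h
    · exact left_mem_Icc.2 hT.le
  have hpk : ∀ k ≤ n, p k = (k : ℝ) * T / n := fun k hk => by simp only [hp, if_pos hk]
  set gk : ℕ → ℝ := fun k => g (k * T / n) with hgk
  -- Each increment is split into its right and left evaluations, hence the doubled index set.
  have h1 := hm.integral_cexp_sum (R.disjSum R) (Sum.elim gk (fun k => -gk k))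
    (Sum.elim (fun k => p (k + 1)) p)
    (by rintro (k | k); exacts [hpm _, hpm _])
  have e1 : ∀ x : C0 T, ∑ i ∈ R.disjSum R, Sum.elim gk (fun k => -gk k) i *
      pathEval x (Sum.elim (fun k => p (k + 1)) p i) = rsSum g x n := by
    intro x
    rw [Finset.sum_disjSum, ← Finset.sum_add_distrib]
    refine Finset.sum_congr rfl fun k hk => ?_
    have hk' := Finset.mem_range.1 hk
    simp only [Sum.elim_inl, Sum.elim_inr]
    rw [hpk _ hk'.le, hpk _ hk']
    simp only [hgk]; ring
  simp only [e1] at h1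
  rw [h1, integral_stepFn_sq hT g hn]
  congr 4
  -- The covariance of two increments is the mixed second difference of min.
  have e2 : ∀ k ∈ R, ∀ l ∈ R, min (p (k + 1)) (p (l + 1)) - min (p (k + 1)) (p l) -
      min (p k) (p (l + 1)) + min (p k) (p l) = if k = l then T / n else 0 := by
    intro k hk l hl
    have hk' := Finset.mem_range.1 hk
    have hl' := Finset.mem_range.1 hl
    have hmono : ∀ a b : ℕ, a ≤ b → b ≤ n → p a ≤ p b := by
      intro a b hab hb
      rw [hpk _ hb, hpk _ (hab.trans hb)]
      have : (a : ℝ) ≤ b := by exact_mod_cast hab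
      gcongr
    rcases lt_trichotomy k l with h | h | h
    · rw [if_neg h.ne, min_eq_left (hmono _ _ (by omega) (by omega)),
        min_eq_left (hmono _ _ (by omega) (by omega)),
        min_eq_left (hmono _ _ (by omega) (by omega)),
        min_eq_left (hmono _ _ (by omega) (by omega))]
      ring
    · subst h
      rw [if_pos rfl, min_self, min_self, min_eq_right (hmono k (k + 1) (by omega) (by omega)),
        min_eq_left (hmono k (k + 1) (by omega) (by omega)), hpk _ hk'.le, hpk _ hk']
      push_cast; ring
    · rw [if_neg h.ne', min_eq_right (hmono _ _ (by omega) (by omega)),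
        min_eq_right (hmono _ _ (by omega) (by omega)),
        min_eq_right (hmono _ _ (by omega) (by omega)),
        min_eq_right (hmono _ _ (by omega) (by omega))]
      ring
  simp only [Finset.sum_disjSum, Sum.elim_inl, Sum.elim_inr]
  rw [← Finset.sum_add_distrib]
  refine Finset.sum_congr rfl fun k hk => ?_
  rw [← Finset.sum_add_distrib, ← Finset.sum_add_distrib, ← Finset.sum_add_distrib]
  trans ∑ l ∈ R, gk k * gk l * (if k = l then T / n else 0)
  · refine Finset.sum_congr rfl fun l hl => ?_
    rw [← e2 k hk l hl]; ring
  · have hkR : k ∈ R := hk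
    simp only [mul_ite, mul_zero, Finset.sum_ite_eq, if_pos hkR, hgk]
    ring

lemma IsWienerMeasure.integral_cexp_rsIntegral (hT : 0 < T) {g : ℝ → ℝ}
    (hg : BoundedVariationOn g (Icc 0 T)) :
    ∫ x, Complex.exp (Complex.I * (rsIntegral g x : ℂ)) ∂m =
      Complex.exp ((-(∫ t, g t ^ 2 ∂(leb T)) / 2 : ℝ) : ℂ) := by
  have := hm.isProbabilityMeasure
  have h1 : Tendsto (fun n => ∫ x, Complex.exp (Complex.I * (rsSum g x n : ℂ)) ∂m) atTop
      (𝓝 (∫ x, Complex.exp (Complex.I * (rsIntegral g x : ℂ)) ∂m)) := by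
    refine tendsto_integral_of_dominated_convergence (fun _ => (1 : ℝ)) (fun n => ?_)
      (integrable_const _) (fun n => Eventually.of_forall fun x => (norm_cexp_I_mul _).le)
      (Eventually.of_forall fun x => ?_)
    · have := measurable_rsSum (T := T) g n
      exact (by fun_prop : Measurable _).aestronglyMeasurable
    · have hc : Continuous fun r : ℝ => Complex.exp (Complex.I * (r : ℂ)) := by fun_prop
      exact (hc.tendsto _).comp (tendsto_rsSum hT hg x)
  refine tendsto_nhds_unique h1 ?_
  have hc : Continuous fun r : ℝ => Complex.exp ((-r / 2 : ℝ) : ℂ) := by fun_prop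
  refine ((hc.tendsto _).comp (tendsto_integral_stepFn_sq hT hg)).congr' ?_
  filter_upwards [eventually_gt_atTop 0] with n hn
  exact (hm.integral_cexp_rsSum hT g hn).symm

end Wiener

lemma boundedVariationOn_add {f g : ℝ → ℝ} {s : Set ℝ} (hf : BoundedVariationOn f s)
    (hg : BoundedVariationOn g s) : BoundedVariationOn (fun t => f t + g t) s := by
  refine ne_top_of_le_ne_top (ENNReal.add_ne_top.2 ⟨hf, hg⟩)
    (iSup_le fun ⟨n, u, hu, us⟩ => ?_ : _ ≤ eVariationOn f s + eVariationOn g s)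
  calc ∑ i ∈ Finset.range n, edist (f (u (i + 1)) + g (u (i + 1))) (f (u i) + g (u i))
      ≤ ∑ i ∈ Finset.range n, (edist (f (u (i + 1))) (f (u i)) +
          edist (g (u (i + 1))) (g (u i))) := Finset.sum_le_sum fun i _ => edist_add_add_le _ _ _ _
    _ ≤ _ := by
        rw [Finset.sum_add_distrib]
        exact add_le_add (eVariationOn.sum_le hu us) (eVariationOn.sum_le hu us)

lemma boundedVariationOn_sum {s : Finset ℕ} (c : ℕ → ℝ) {g : ℕ → ℝ → ℝ}
    (hg : ∀ j, BoundedVariationOn (g j) (Icc 0 T)) :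
    BoundedVariationOn (fun t => ∑ j ∈ s, c j * g j t) (Icc 0 T) := by
  classical
  have hconst : ∀ a : ℝ, BoundedVariationOn (fun _ : ℝ => a) (Icc 0 T) := fun a => by
    have : eVariationOn (fun _ : ℝ => a) (Icc 0 T) = 0 :=
      eVariationOn.constant_on (by rintro _ ⟨_, _, rfl⟩ _ ⟨_, _, rfl⟩; rfl)
    simp [BoundedVariationOn, this]
  induction s using Finset.induction_on with
  | empty => simpa using hconst 0
  | insert a s ha ih =>
    simp only [Finset.sum_insert ha]
    exact boundedVariationOn_add ((hconst _).mul (hg a)) ih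

lemma rsIntegral_sum (hT : 0 < T) (s : Finset ℕ) (c : ℕ → ℝ) {g : ℕ → ℝ → ℝ}
    (hg : ∀ j, BoundedVariationOn (g j) (Icc 0 T)) (x : C0 T) :
    rsIntegral (fun t => ∑ j ∈ s, c j * g j t) x = ∑ j ∈ s, c j * rsIntegral (g j) x := by
  refine tendsto_nhds_unique (tendsto_rsSum hT (boundedVariationOn_sum c hg) x) ?_
  refine (tendsto_finsetSum s fun j _ => (tendsto_rsSum hT (hg j) x).const_mul (c j)).congr
    fun n => ?_
  rw [rsSum_sum]

/-! ### The Hilbert basis -/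

section Basis

variable {φ : ℕ → ℝ → ℝ} (hT : 0 < T) (hφ : IsPWZBasis T φ)

lemma IsPWZBasis.memLp (hT : 0 < T) (hφ : IsPWZBasis T φ) (j : ℕ) : MemLp (φ j) 2 (leb T) :=
  bv_memLp_two hT (hφ.boundedVariation j)

lemma inner_L2_eq (u v : L2 T) : inner ℝ u v = ∫ t, v t * u t ∂(leb T) := by
  rw [L2.inner_def]; rfl

lemma norm_sq_L2_eq (u : L2 T) : ‖u‖ ^ 2 = ∫ t, u t ^ 2 ∂(leb T) := by
  rw [← real_inner_self_eq_norm_sq, inner_L2_eq]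
  simp only [sq]

/-- The basis functions as elements of `L₂[0,T]`. -/
def basisVec (hT : 0 < T) (hφ : IsPWZBasis T φ) (j : ℕ) : L2 T := (hφ.memLp hT j).toLp (φ j)

lemma coeFn_basisVec (j : ℕ) : basisVec hT hφ j =ᵐ[leb T] φ j :=
  MemLp.coeFn_toLp _

lemma inner_basisVec (u : L2 T) (j : ℕ) :
    inner ℝ (basisVec hT hφ j) u = ∫ t, u t * φ j t ∂(leb T) := by
  rw [inner_L2_eq]
  refine integral_congr_ae ?_
  filter_upwards [coeFn_basisVec hT hφ j] with t ht
  rw [ht]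

lemma orthonormal_basisVec : Orthonormal ℝ (basisVec hT hφ) := by
  rw [orthonormal_iff_ite]
  intro i j
  rw [inner_basisVec, ← hφ.orthonormal i j]
  refine integral_congr_ae ?_
  filter_upwards [coeFn_basisVec hT hφ j] with t ht
  rw [ht, mul_comm]

/-- The Hilbert basis of `L₂[0,T]` given by the sequence `φ`. -/
def hilbertBasisOf (hT : 0 < T) (hφ : IsPWZBasis T φ) : HilbertBasis ℕ ℝ (L2 T) :=
  HilbertBasis.mkOfOrthogonalEqBot (orthonormal_basisVec hT hφ) (by
    rw [Submodule.eq_bot_iff]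
    intro u hu
    rw [Submodule.mem_orthogonal] at hu
    have h := hφ.complete u (Lp.memLp u) fun j => by
      rw [← inner_basisVec hT hφ u j]
      exact hu _ (Submodule.subset_span (mem_range_self j))
    exact Lp.eq_zero_iff_ae_eq_zero.2 h)

lemma hilbertBasisOf_apply (j : ℕ) : hilbertBasisOf hT hφ j = basisVec hT hφ j := by
  simp [hilbertBasisOf]

lemma hasSum_inner_sq (u : L2 T) :
    HasSum (fun j => inner ℝ (basisVec hT hφ j) u ^ 2) (‖u‖ ^ 2) := by
  have h := (hilbertBasisOf hT hφ).hasSum_inner_mul_inner u u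
  rw [real_inner_self_eq_norm_sq] at h
  refine h.congr_fun fun j => ?_
  rw [hilbertBasisOf_apply, real_inner_comm u, sq]

lemma tendsto_partialSum (u : L2 T) :
    Tendsto (fun n => ∑ j ∈ Finset.range n, inner ℝ (basisVec hT hφ j) u • basisVec hT hφ j)
      atTop (𝓝 u) := by
  have h := ((hilbertBasisOf hT hφ).hasSum_repr u).tendsto_sum_nat
  simpa only [HilbertBasis.repr_apply_apply, hilbertBasisOf_apply] using h

end Basis

/-! ### The Paley–Wiener–Zygmund integral on `L₂[0,T]` -/

lemma pwzApprox_congr (φ : ℕ → ℝ → ℝ) {u v : ℝ → ℝ} (h : u =ᵐ[leb T] v) (x : C0 T) :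
    pwzApprox φ u x = pwzApprox φ v x := by
  ext n
  refine Finset.sum_congr rfl fun j _ => ?_
  congr 1
  refine integral_congr_ae ?_
  filter_upwards [h] with t ht
  rw [ht]

lemma hasPWZ_congr (φ : ℕ → ℝ → ℝ) {u v : ℝ → ℝ} (h : u =ᵐ[leb T] v) (x : C0 T) (c : ℝ) :
    HasPWZ φ u x c ↔ HasPWZ φ v x c := by
  rw [HasPWZ, HasPWZ, pwzApprox_congr φ h]

lemma HasPWZ.pwz_eq {φ : ℕ → ℝ → ℝ} {u : ℝ → ℝ} {x : C0 T} {c : ℝ} (h : HasPWZ φ u x c) :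
    pwz φ u x = c := h.limUnder_eq

lemma HasPWZ.hasPWZ_pwz {φ : ℕ → ℝ → ℝ} {u : ℝ → ℝ} {x : C0 T} {c : ℝ} (h : HasPWZ φ u x c) :
    HasPWZ φ u x (pwz φ u x) := by rwa [h.pwz_eq]

section PWZ

variable {φ : ℕ → ℝ → ℝ} (hT : 0 < T) (hφ : IsPWZBasis T φ)
include hT hφ

lemma pwzApprox_eq (u : L2 T) (x : C0 T) (n : ℕ) :
    pwzApprox φ u x n = ∑ j ∈ Finset.range n,
      inner ℝ (basisVec hT hφ j) u * rsIntegral (φ j) x := by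
  simp only [pwzApprox, inner_basisVec]

lemma HasPWZ.add_path {u : ℝ → ℝ} {x y : C0 T} {a b : ℝ} (hx : HasPWZ φ u x a)
    (hy : HasPWZ φ u y b) : HasPWZ φ u (x + y) (a + b) := by
  refine (Tendsto.add hx hy).congr fun n => ?_
  simp only [pwzApprox, rsIntegral_add hT (hφ.boundedVariation _), mul_add,
    Finset.sum_add_distrib]

lemma HasPWZ.smul_path {u : ℝ → ℝ} {x : C0 T} {a : ℝ} (c : ℝ) (hx : HasPWZ φ u x a) :
    HasPWZ φ u (c • x) (c * a) := by
  refine (Tendsto.const_mul c hx).congr fun n => ?_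
  simp only [pwzApprox, rsIntegral_smul hT (hφ.boundedVariation _), Finset.mul_sum]
  exact Finset.sum_congr rfl fun j _ => by ring

lemma HasPWZ.add {u v : L2 T} {x : C0 T} {a b : ℝ} (hu : HasPWZ φ u x a)
    (hv : HasPWZ φ v x b) : HasPWZ φ (u + v : L2 T) x (a + b) := by
  refine (Tendsto.add hu hv).congr fun n => ?_
  simp only [pwzApprox_eq hT hφ, inner_add_right, add_mul, Finset.sum_add_distrib]

lemma HasPWZ.smul {u : L2 T} {x : C0 T} {a : ℝ} (c : ℝ) (hu : HasPWZ φ u x a) :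
    HasPWZ φ (c • u : L2 T) x (c * a) := by
  refine (Tendsto.const_mul c hu).congr fun n => ?_
  simp only [pwzApprox_eq hT hφ, inner_smul_right, Finset.mul_sum, mul_assoc]

lemma HasPWZ.sub {u v : L2 T} {x : C0 T} {a b : ℝ} (hu : HasPWZ φ u x a)
    (hv : HasPWZ φ v x b) : HasPWZ φ (u - v : L2 T) x (a - b) := by
  have := HasPWZ.add hT hφ hu (HasPWZ.smul hT hφ (-1) hv)
  simpa [sub_eq_add_neg] using this

lemma hasPWZ_zero (x : C0 T) : HasPWZ φ (0 : L2 T) x 0 := by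
  refine tendsto_const_nhds.congr fun n => ?_
  rw [pwzApprox_eq hT hφ]
  simp only [inner_zero_right, zero_mul, Finset.sum_const_zero]

lemma HasPWZ.sum {ι : Type*} (s : Finset ι) (c : ι → ℝ) {u : ι → L2 T} {x : C0 T} {a : ι → ℝ}
    (h : ∀ i ∈ s, HasPWZ φ (u i) x (a i)) :
    HasPWZ φ (∑ i ∈ s, c i • u i : L2 T) x (∑ i ∈ s, c i * a i) := by
  classical
  induction s using Finset.induction_on with
  | empty => simpa using hasPWZ_zero hT hφ x
  | insert i s hi ih =>
    rw [Finset.sum_insert hi, Finset.sum_insert hi]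
    exact HasPWZ.add hT hφ (HasPWZ.smul hT hφ _ (h i (Finset.mem_insert_self _ _)))
      (ih fun j hj => h j (Finset.mem_insert_of_mem hj))

lemma measurable_pwzApprox (n : ℕ) :
    Measurable fun p : L2 T × C0 T => pwzApprox φ (p.1 : ℝ → ℝ) p.2 n := by
  simp only [pwzApprox_eq hT hφ]
  refine Finset.measurable_sum _ fun j _ => Measurable.mul ?_ ?_
  · have : Continuous fun u : L2 T => inner ℝ (basisVec hT hφ j) u := by fun_prop
    exact this.measurable.comp measurable_fst
  · exact (measurable_rsIntegral hT (hφ.boundedVariation j)).comp measurable_snd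

/-- Joint measurability in u and x is what later permits Fubini between the representing measure and
Wiener measure. -/
lemma measurable_pwz : Measurable fun p : L2 T × C0 T => pwz φ (p.1 : ℝ → ℝ) p.2 :=
  (StronglyMeasurable.limUnder (l := atTop)
    fun n => (measurable_pwzApprox hT hφ n).stronglyMeasurable).measurable

lemma measurable_pwz_left (x : C0 T) : Measurable fun u : L2 T => pwz φ (u : ℝ → ℝ) x := by
  have h := (measurable_pwz hT hφ).comp (measurable_prodMk_right (y := x))
  exact h

lemma measurable_pwz_right (u : L2 T) : Measurable fun x : C0 T => pwz φ (u : ℝ → ℝ) x := by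
  have h := (measurable_pwz hT hφ).comp (measurable_prodMk_left (x := u))
  exact h

lemma measurableSet_hasPWZ :
    MeasurableSet {p : L2 T × C0 T | ∃ c, HasPWZ φ (p.1 : ℝ → ℝ) p.2 c} :=
  measurableSet_exists_tendsto (measurable_pwzApprox hT hφ)

variable {m : Measure (C0 T)} (hm : IsWienerMeasure T m)
include hm

lemma isStdGaussSeq_rsIntegral : IsStdGaussSeq m fun j x => rsIntegral (φ j) x where
  aemeasurable j := (measurable_rsIntegral hT (hφ.boundedVariation j)).aemeasurable
  charFun n c := by
    have h := hm.integral_cexp_rsIntegral hT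
      (boundedVariationOn_sum (s := Finset.range n) c hφ.boundedVariation)
    simp only [rsIntegral_sum hT _ c hφ.boundedVariation] at h
    rw [h]
    congr 4
    have hi : ∀ i j, Integrable (fun t => c i * c j * (φ i t * φ j t)) (leb T) := fun i j =>
      ((hφ.memLp hT i).integrable_mul (hφ.memLp hT j)).const_mul _
    have e : ∀ t, (∑ j ∈ Finset.range n, c j * φ j t) ^ 2 =
        ∑ i ∈ Finset.range n, ∑ j ∈ Finset.range n, c i * c j * (φ i t * φ j t) := by
      intro t
      rw [sq, Finset.sum_mul_sum]
      exact Finset.sum_congr rfl fun i _ => Finset.sum_congr rfl fun j _ => by ring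
    simp only [e]
    rw [integral_finsetSum _ fun i _ => integrable_finsetSum _ fun j _ => hi i j]
    refine Finset.sum_congr rfl fun i hi' => ?_
    rw [integral_finsetSum _ fun j _ => hi i j]
    simp only [integral_const_mul, hφ.orthonormal, mul_ite, mul_one, mul_zero,
      Finset.sum_ite_eq, if_pos hi']
    ring

/-- The coefficients of u are square summable and the integrals ∫ φ_j dx are independent standard
Gaussians. -/
lemma ae_hasPWZ (u : L2 T) : ∀ᵐ x ∂m, HasPWZ φ u x (pwz φ u x) := by
  have := hm.isProbabilityMeasure
  filter_upwards [(isStdGaussSeq_rsIntegral hT hφ hm).ae_exists_tendsto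
    (hasSum_inner_sq hT hφ u).summable] with x ⟨c, hc⟩
  have : HasPWZ φ u x c := hc.congr fun n => (pwzApprox_eq hT hφ u x n).symm
  exact this.hasPWZ_pwz

/-- The approximations are Gaussian, and their variances are the partial sums of Parseval's series
for ‖u‖²; bounded convergence passes to the limit. -/
lemma integral_cexp_pwz (u : L2 T) :
    ∫ x, Complex.exp (Complex.I * (pwz φ u x : ℂ)) ∂m =
      Complex.exp ((-(‖u‖ ^ 2) / 2 : ℝ) : ℂ) := by
  have := hm.isProbabilityMeasure
  have h1 : Tendsto (fun n => ∫ x, Complex.exp (Complex.I * (pwzApprox φ u x n : ℂ)) ∂m) atTop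
      (𝓝 (∫ x, Complex.exp (Complex.I * (pwz φ u x : ℂ)) ∂m)) := by
    refine tendsto_integral_of_dominated_convergence (fun _ => (1 : ℝ)) (fun n => ?_)
      (integrable_const _) (fun n => Eventually.of_forall fun x => (norm_cexp_I_mul _).le) ?_
    · have : Measurable fun x : C0 T => pwzApprox φ u x n :=
        (measurable_pwzApprox hT hφ n).comp measurable_prodMk_left
      exact (by fun_prop : Measurable _).aestronglyMeasurable
    · filter_upwards [ae_hasPWZ hT hφ hm u] with x hx
      have hc : Continuous fun r : ℝ => Complex.exp (Complex.I * (r : ℂ)) := by fun_prop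
      exact (hc.tendsto _).comp hx
  refine tendsto_nhds_unique h1 ?_
  have hc : Continuous fun r : ℝ => Complex.exp ((-r / 2 : ℝ) : ℂ) := by fun_prop
  refine ((hc.tendsto _).comp (hasSum_inner_sq hT hφ u).tendsto_sum_nat).congr fun n => ?_
  have := (isStdGaussSeq_rsIntegral hT hφ hm).charFun n fun j => inner ℝ (basisVec hT hφ j) u
  simp only [pwzApprox_eq hT hφ, Function.comp_apply]
  rw [this]

lemma integral_cexp_mul_pwz (θ : ℝ) (u : L2 T) :
    ∫ x, Complex.exp (Complex.I * ((θ * pwz φ u x : ℝ) : ℂ)) ∂m =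
      Complex.exp ((-(θ ^ 2 * ‖u‖ ^ 2) / 2 : ℝ) : ℂ) := by
  have h := integral_cexp_pwz hT hφ hm (θ • u)
  rw [norm_smul, mul_pow, Real.norm_eq_abs, sq_abs] at h
  rw [← h]
  refine integral_congr_ae ?_
  filter_upwards [ae_hasPWZ hT hφ hm u] with x hx
  rw [(HasPWZ.smul hT hφ θ hx).pwz_eq]

end PWZ

/-! ### Multiplication by essentially bounded functions -/

/-- Multiplication by `h ∈ L∞[0,T]` as an operator on `L₂[0,T]`. -/
def mulL2 {h : ℝ → ℝ} (hh : MemLp h ⊤ (leb T)) : L2 T →L[ℝ] L2 T :=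
  (ContinuousLinearMap.mul ℝ ℝ).holderL (leb T) ⊤ 2 2 (hh.toLp h)

lemma coeFn_mulL2 {h : ℝ → ℝ} (hh : MemLp h ⊤ (leb T)) (u : L2 T) :
    mulL2 hh u =ᵐ[leb T] fun t => h t * u t := by
  have h1 := (ContinuousLinearMap.mul ℝ ℝ).coeFn_holder (r := 2) (hh.toLp h) u
  filter_upwards [h1, hh.coeFn_toLp] with t h1 h2
  have : mulL2 hh u = (ContinuousLinearMap.mul ℝ ℝ).holder 2 (hh.toLp h) u := rfl
  rw [this, h1, h2]
  simp

lemma norm_sq_mulL2 {h : ℝ → ℝ} (hh : MemLp h ⊤ (leb T)) (u : L2 T) :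
    ‖mulL2 hh u‖ ^ 2 = ∫ t, h t ^ 2 * u t ^ 2 ∂(leb T) := by
  rw [norm_sq_L2_eq]
  refine integral_congr_ae ?_
  filter_upwards [coeFn_mulL2 hh u] with t ht
  rw [ht, mul_pow]

attribute [irreducible] mulL2

end FresnelGFFT
end


noncomputable section

namespace FresnelGFFT

variable {T : ℝ}

/-! ### Existence of the paths of the Gaussian process -/

lemma exists_bound_of_memLp_top {h : ℝ → ℝ} {μ : Measure ℝ} (hh : MemLp h ⊤ μ) :
    ∃ c : ℝ, 0 < c ∧ ∀ᵐ t ∂μ, |h t| ≤ c := by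
  have h1 : eLpNormEssSup h μ ≠ ⊤ := by
    have := hh.2.ne
    rwa [eLpNorm_exponent_top] at this
  refine ⟨(eLpNormEssSup h μ).toReal + 1, by positivity, ?_⟩
  filter_upwards [ae_le_eLpNormEssSup (f := h) (μ := μ)] with t ht
  have := ENNReal.toReal_mono h1 ht
  rw [toReal_enorm, Real.norm_eq_abs] at this
  linarith

/-- The function `1_{[0,t]} h` as an element of `L₂[0,T]`. -/
def cutVec {h : ℝ → ℝ} (hh : MemLp h ⊤ (leb T)) (t : ℝ) : L2 T :=
  ((hh.mono_exponent le_top).indicator (measurableSet_Icc (a := 0) (b := t))).toLp _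

lemma coeFn_cutVec {h : ℝ → ℝ} (hh : MemLp h ⊤ (leb T)) (t : ℝ) :
    cutVec hh t =ᵐ[leb T] (Icc 0 t).indicator h := MemLp.coeFn_toLp _

/-- The variance `∫₀ᵗ h²` of the Gaussian process. -/
def varFn (T : ℝ) (h : ℝ → ℝ) (t : ℝ) : ℝ := ∫ s in Icc 0 t, h s ^ 2 ∂(leb T)

section VarFn

variable {h : ℝ → ℝ} (hh : MemLp h ⊤ (leb T))
include hh

lemma integrable_sq_of_memLp_top : Integrable (fun s => h s ^ 2) (leb T) :=
  (hh.mono_exponent le_top : MemLp h 2 (leb T)).integrable_sq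

/-- These are the covariances of Brownian motion run with the clock `varFn`. -/
lemma inner_cutVec (s t : ℝ) : inner ℝ (cutVec hh s) (cutVec hh t) = varFn T h (min s t) := by
  rw [inner_L2_eq, varFn, ← integral_indicator measurableSet_Icc]
  refine integral_congr_ae ?_
  filter_upwards [coeFn_cutVec hh s, coeFn_cutVec hh t] with r h1 h2
  rw [h1, h2]
  by_cases hs : r ∈ Icc 0 s <;> by_cases ht : r ∈ Icc 0 t
  · have hm : r ∈ Icc 0 (min s t) := ⟨hs.1, le_min hs.2 ht.2⟩
    rw [indicator_of_mem hs, indicator_of_mem ht, indicator_of_mem hm, sq]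
  · have hm : r ∉ Icc 0 (min s t) := fun hr => ht ⟨hr.1, hr.2.trans (min_le_right _ _)⟩
    rw [indicator_of_notMem ht, indicator_of_notMem hm, zero_mul]
  all_goals
    have hm : r ∉ Icc 0 (min s t) := fun hr => hs ⟨hr.1, hr.2.trans (min_le_left _ _)⟩
    rw [indicator_of_notMem hs, indicator_of_notMem hm, mul_zero]

lemma varFn_mono : Monotone (varFn T h) := fun _ _ hst =>
  setIntegral_mono_set (integrable_sq_of_memLp_top hh).integrableOn
    (Eventually.of_forall fun _ => sq_nonneg _)
    (LE.le.eventuallyLE (Icc_subset_Icc_right hst))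

/-- With |h| ≤ c the clock is c²-Lipschitz. Divided by c² it becomes a 1-Lipschitz time change of
[0,T] into itself. -/
lemma varFn_sub_le {c : ℝ} (hc : ∀ᵐ t ∂(leb T), |h t| ≤ c) {s t : ℝ} (h0 : 0 ≤ s)
    (hst : s ≤ t) : varFn T h t - varFn T h s ≤ c ^ 2 * (t - s) := by
  have hi := integrable_sq_of_memLp_top hh
  have e : varFn T h t = varFn T h s + ∫ r in Ioc s t, h r ^ 2 ∂(leb T) := by
    rw [varFn, varFn, ← setIntegral_union _ measurableSet_Ioc hi.integrableOn hi.integrableOn,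
      Icc_union_Ioc_eq_Icc h0 hst]
    exact Set.disjoint_left.2 fun r hr hr' => absurd hr.2 (not_le.2 hr'.1)
  rw [e, add_sub_cancel_left]
  calc ∫ r in Ioc s t, h r ^ 2 ∂(leb T) ≤ ∫ _ in Ioc s t, c ^ 2 ∂(leb T) := by
        refine setIntegral_mono_ae hi.integrableOn (integrable_const _).integrableOn ?_
        filter_upwards [hc] with r hr
        exact sq_le_sq' (abs_le.1 hr).1 (abs_le.1 hr).2
    _ = (leb T).real (Ioc s t) * c ^ 2 := by rw [setIntegral_const, smul_eq_mul]
    _ ≤ (t - s) * c ^ 2 := by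
        refine mul_le_mul_of_nonneg_right ?_ (sq_nonneg _)
        rw [leb, measureReal_restrict_apply measurableSet_Ioc,
          ← Real.volume_real_Ioc_of_le hst]
        exact measureReal_mono inter_subset_left (by simp)
    _ = _ := mul_comm _ _

omit hh in
lemma varFn_zero : varFn T h 0 = 0 := by
  rw [varFn, Icc_self, leb, Measure.restrict_restrict (measurableSet_singleton 0)]
  refine setIntegral_measure_zero _ (measure_mono_null inter_subset_left ?_)
  simp

omit hh in
lemma varFn_nonneg (t : ℝ) : 0 ≤ varFn T h t := integral_nonneg fun _ => sq_nonneg _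

lemma varFn_div_mem {c : ℝ} (hc0 : 0 < c) (hc : ∀ᵐ t ∂(leb T), |h t| ≤ c) {t : ℝ}
    (ht : t ∈ Icc (0 : ℝ) T) : varFn T h t / c ^ 2 ∈ Icc (0 : ℝ) T := by
  have h1 := varFn_sub_le hh hc le_rfl ht.1
  rw [varFn_zero, sub_zero, sub_zero] at h1
  refine ⟨div_nonneg (varFn_nonneg t) (sq_nonneg _), ?_⟩
  rw [div_le_iff₀ (by positivity)]
  nlinarith [ht.2, sq_nonneg c]

end VarFn

/-- The rational numbers in `[0,1]`. -/
abbrev UnitRat : Type := {r : ℚ // 0 ≤ r ∧ r ≤ 1}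

lemma UnitRat.mul_mem (hT : 0 < T) (r : UnitRat) : ((r : ℚ) : ℝ) * T ∈ Icc (0 : ℝ) T := by
  have h0 : (0 : ℝ) ≤ ((r : ℚ) : ℝ) := by exact_mod_cast r.2.1
  have h1 : ((r : ℚ) : ℝ) ≤ 1 := by exact_mod_cast r.2.2
  exact ⟨by positivity, mul_le_of_le_one_left hT.le h1⟩

/-- The families on the rational unit interval that are uniformly continuous. -/
def unifContFamilies : Set (UnitRat → ℝ) :=
  {v | ∀ k : ℕ, ∃ N : ℕ, ∀ r s : UnitRat, |((r : ℚ) : ℝ) - ((s : ℚ) : ℝ)| < 1 / (N + 1) →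
    |v r - v s| < 1 / (k + 1)}

/-- Only countably many conditions on countably many coordinates are involved, so whether a process
lies almost surely in this set depends on its law alone. -/
lemma measurableSet_unifContFamilies : MeasurableSet unifContFamilies := by
  simp only [unifContFamilies, ofPred_forall, ofPred_exists]
  refine MeasurableSet.iInter fun k => MeasurableSet.iUnion fun N => MeasurableSet.iInter fun r =>
    MeasurableSet.iInter fun s => MeasurableSet.iInter fun _ => ?_
  exact measurableSet_lt (by fun_prop) measurable_const

/-- The rational multiples of T form a dense uniform copy of the rational unit interval in [0,T], so
a uniformly continuous family extends to a continuous path. -/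
lemma exists_path_of_mem_unifContFamilies (hT : 0 < T) {v : UnitRat → ℝ}
    (hv : v ∈ unifContFamilies) (h0 : v ⟨0, le_rfl, zero_le_one⟩ = 0) :
    ∃ z : C0 T, ∀ r : UnitRat, pathEval z ((r : ℚ) * T) = v r := by
  set e : UnitRat → Icc (0 : ℝ) T := fun r => ⟨(r : ℚ) * T, r.mul_mem hT⟩ with he
  have hdist : ∀ r s : UnitRat, dist (e r) (e s) = T * dist r s := by
    intro r s
    rw [Subtype.dist_eq, Subtype.dist_eq, Rat.dist_eq, Real.dist_eq]
    simp only [he]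
    rw [← sub_mul, abs_mul, abs_of_pos hT, mul_comm]
  have hlip : UniformContinuous e :=
    (LipschitzWith.of_dist_le_mul (K := ⟨T, hT.le⟩) fun r s => (hdist r s).le).uniformContinuous
  have hanti : AntilipschitzWith ⟨T⁻¹, (inv_pos.2 hT).le⟩ e :=
    AntilipschitzWith.of_le_mul_dist fun r s => by
      rw [hdist]
      exact (inv_mul_cancel_left₀ hT.ne' _).ge
  have hind : IsUniformInducing e := hanti.isUniformInducing hlip
  have hdense : DenseRange e := by
    rw [Metric.denseRange_iff]
    rintro ⟨t, ht⟩ ε hε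
    have hs0 : 0 ≤ t / T := div_nonneg ht.1 hT.le
    have hs1 : t / T ≤ 1 := (div_le_one hT).2 ht.2
    have hε' : 0 < ε / T := by positivity
    obtain ⟨r, hr1, hr2⟩ := exists_rat_btwn
      (show max 0 (t / T - ε / T) < min 1 (t / T + ε / T) from
        max_lt (lt_min one_pos (by linarith)) (lt_min (by linarith) (by linarith)))
    rw [max_lt_iff] at hr1
    rw [lt_min_iff] at hr2
    refine ⟨⟨r, by exact_mod_cast hr1.1.le, by exact_mod_cast hr2.1.le⟩, ?_⟩
    rw [Subtype.dist_eq, Real.dist_eq]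
    simp only [he]
    have e1 : t - r * T = T * (t / T - r) := by field_simp
    rw [e1, abs_mul, abs_of_pos hT]
    have : |t / T - r| < ε / T := abs_lt.2 ⟨by linarith [hr2.2], by linarith [hr1.2]⟩
    calc T * |t / T - r| < T * (ε / T) := by gcongr
      _ = ε := by field_simp
  have hunif : UniformContinuous v := by
    rw [Metric.uniformContinuous_iff]
    intro ε hε
    obtain ⟨k, hk⟩ := exists_nat_one_div_lt hε
    obtain ⟨N, hN⟩ := hv k
    refine ⟨1 / (N + 1), by positivity, fun {r s} hrs => ?_⟩
    rw [Subtype.dist_eq, Rat.dist_eq] at hrs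
    exact (hN r s hrs).trans hk
  set f := (hind.isDenseInducing hdense).extend v with hf
  have hfc : UniformContinuous f := uniformContinuous_uniformly_extend hind hdense hunif
  have hfe : ∀ r, f (e r) = v r := fun r => uniformly_extend_of_ind hind hdense hunif r
  refine ⟨⟨⟨f, hfc.continuous⟩, fun t ht => ?_⟩, fun r => ?_⟩
  · have : t = e ⟨0, le_rfl, zero_le_one⟩ := Subtype.ext (by simp [he, ht])
    rw [this]
    exact (hfe _).trans h0
  · rw [pathEval_of_mem _ (r.mul_mem hT)]
    exact hfe r

/-! ### The process 𝒵_h and Wiener integrals along its paths -/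

section GaussPath

variable {φ : ℕ → ℝ → ℝ} (hT : 0 < T) (hφ : IsPWZBasis T φ)
  {m : Measure (C0 T)} (hm : IsWienerMeasure T m)
  {h : ℝ → ℝ} (hh : MemLp h ⊤ (leb T))
include hT hφ hm

lemma ae_pwz_sum {ι : Type*} (s : Finset ι) (c : ι → ℝ) (u : ι → L2 T) :
    ∀ᵐ x ∂m, pwz φ (∑ i ∈ s, c i • u i : L2 T) x = ∑ i ∈ s, c i * pwz φ (u i) x := by
  have : ∀ᵐ x ∂m, ∀ i ∈ s, HasPWZ φ (u i) x (pwz φ (u i) x) :=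
    (Finset.eventually_all s).2 fun i _ => ae_hasPWZ hT hφ hm (u i)
  filter_upwards [this] with x hx
  exact (HasPWZ.sum hT hφ s c hx).pwz_eq

lemma integral_cexp_mul_sum_pwz {ι : Type*} (θ : ℝ) (s : Finset ι) (c : ι → ℝ)
    (u : ι → L2 T) :
    ∫ x, Complex.exp (Complex.I * ((θ * ∑ i ∈ s, c i * pwz φ (u i) x : ℝ) : ℂ)) ∂m =
      Complex.exp ((-(θ ^ 2 * ‖∑ i ∈ s, c i • u i‖ ^ 2) / 2 : ℝ) : ℂ) := by
  rw [← integral_cexp_mul_pwz hT hφ hm]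
  refine integral_congr_ae ?_
  filter_upwards [ae_pwz_sum hT hφ hm s c u] with x hx
  rw [hx]

/-- If `u n → u` in `L₂[0,T]` and `⟨u n, x⟩ → Y x` a.e., then `Y x = ⟨u, x⟩` a.e. -/
lemma ae_eq_pwz_of_tendsto {u : ℕ → L2 T} {v : L2 T} (huv : Tendsto u atTop (𝓝 v))
    {Y : C0 T → ℝ} (hY : ∀ᵐ x ∂m, Tendsto (fun n => pwz φ (u n) x) atTop (𝓝 (Y x))) :
    ∀ᵐ x ∂m, Y x = pwz φ v x := by
  have := hm.isProbabilityMeasure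
  have hz := ae_eq_zero_of_tendsto (P := m) (X := fun n x => pwz φ (u n - v : L2 T) x)
    (Y := fun x => Y x - pwz φ v x)
    (fun n => (measurable_pwz_right hT hφ _).aemeasurable) ?_ ?_
  · filter_upwards [hz] with x hx
    exact sub_eq_zero.1 hx
  · have h1 : ∀ᵐ x ∂m, ∀ n, HasPWZ φ (u n) x (pwz φ (u n) x) :=
      ae_all_iff.2 fun n => ae_hasPWZ hT hφ hm (u n)
    filter_upwards [hY, h1, ae_hasPWZ hT hφ hm v] with x hx h1 h2
    exact (hx.sub_const _).congr fun n => (HasPWZ.sub hT hφ (h1 n) h2).pwz_eq.symm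
  · intro θ
    simp only [integral_cexp_mul_pwz hT hφ hm]
    have hc : Continuous fun w : L2 T => Complex.exp ((-(θ ^ 2 * ‖w - v‖ ^ 2) / 2 : ℝ) : ℂ) := by
      fun_prop
    simpa [Function.comp_def] using (hc.tendsto v).comp huv

include hh in
-- On rational times, t ↦ ⟨1_{[0,t]}h, x⟩ has the law of c · x(`varFn` T h t / c²), a process with
-- continuous paths. Uniform continuity on the rationals is a property of the law, so it transfers,
-- and the continuous extension is the required path.
lemma ae_isGaussPath : ∀ᵐ x ∂m, IsGaussPath φ h x (gaussProc φ h x) := by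
  have := hm.isProbabilityMeasure
  obtain ⟨c, hc0, hc⟩ := exists_bound_of_memLp_top hh
  set X : UnitRat → C0 T → ℝ := fun r x => pwz φ (cutVec hh ((r : ℚ) * T)) x with hX
  set V : UnitRat → C0 T → ℝ := fun r x =>
    c * pathEval x (varFn T h ((r : ℚ) * T) / c ^ 2) with hV
  have hXm : ∀ r, AEMeasurable (X r) m := fun r => (measurable_pwz_right hT hφ _).aemeasurable
  have hVm : ∀ r, AEMeasurable (V r) m := fun r =>
    ((measurable_pathEval _).const_mul c).aemeasurable
  have hlaw : m.map (fun x r => X r x) = m.map (fun x r => V r x) := by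
    refine map_eq_of_integral_cexp_eq hXm hVm fun s θ => ?_
    have h1 := integral_cexp_mul_sum_pwz hT hφ hm 1 s θ fun r => cutVec hh ((r : ℚ) * T)
    have h2 := hm.integral_cexp_sum s (fun r => θ r * c)
      (fun r : UnitRat => varFn T h ((r : ℚ) * T) / c ^ 2)
      fun r => varFn_div_mem hh hc0 hc (r.mul_mem hT)
    simp only [one_mul] at h1
    simp only [hX, hV, ← mul_assoc]
    rw [h1, h2]
    congr 4
    rw [one_pow, one_mul, ← real_inner_self_eq_norm_sq, sum_inner]
    refine Finset.sum_congr rfl fun i _ => ?_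
    rw [inner_sum]
    refine Finset.sum_congr rfl fun j _ => ?_
    rw [inner_smul_left, inner_smul_right, inner_cutVec, (varFn_mono hh).map_min,
      min_div_div_right (sq_nonneg c)]
    simp only [conj_trivial]
    field_simp
  -- The time change is 1-Lipschitz, so the modulus of continuity of x itself serves.
  have hVE : ∀ x : C0 T, (fun r => V r x) ∈ unifContFamilies := by
    intro x k
    obtain ⟨δ, hδ, H⟩ := exists_modulus x (ε := 1 / (k + 1) / c) (by positivity)
    obtain ⟨N, hN⟩ := exists_nat_one_div_lt (show 0 < δ / T by positivity)
    refine ⟨N, fun r s hrs => ?_⟩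
    have key : ∀ a b : ℝ, 0 ≤ a → 0 ≤ b →
        |varFn T h a / c ^ 2 - varFn T h b / c ^ 2| ≤ |a - b| := by
      intro a b ha hb
      wlog hab : b ≤ a generalizing a b
      · rw [abs_sub_comm, abs_sub_comm a]
        exact this b a hb ha (le_of_not_ge hab)
      rw [abs_of_nonneg (sub_nonneg.2 hab), ← sub_div, abs_of_nonneg
        (div_nonneg (sub_nonneg.2 (varFn_mono hh hab)) (sq_nonneg _)),
        div_le_iff₀ (by positivity), mul_comm]
      exact varFn_sub_le hh hc hb hab
    have h1 : |varFn T h ((r : ℚ) * T) / c ^ 2 - varFn T h ((s : ℚ) * T) / c ^ 2| < δ := by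
      refine (key _ _ (r.mul_mem hT).1 (s.mul_mem hT).1).trans_lt ?_
      rw [← sub_mul, abs_mul, abs_of_pos hT, ← lt_div_iff₀ hT]
      exact hrs.trans hN
    have h2 := H _ (varFn_div_mem hh hc0 hc (r.mul_mem hT)) _
      (varFn_div_mem hh hc0 hc (s.mul_mem hT)) h1
    simp only [hV]
    rw [← mul_sub, abs_mul, abs_of_pos hc0]
    rwa [lt_div_iff₀' hc0] at h2
  have hE : ∀ᵐ x ∂m, (fun r => X r x) ∈ unifContFamilies := by
    have h1 : ∀ᵐ v ∂(m.map fun x r => V r x), v ∈ unifContFamilies :=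
      (ae_map_iff (aemeasurable_pi_iff.2 hVm) measurableSet_unifContFamilies).2
        (Eventually.of_forall hVE)
    rw [← hlaw] at h1
    exact ae_of_ae_map (aemeasurable_pi_iff.2 hXm) h1
  have hP : ∀ᵐ x ∂m, ∀ r : UnitRat, HasPWZ φ (cutVec hh ((r : ℚ) * T)) x (X r x) :=
    ae_all_iff.2 fun r => ae_hasPWZ hT hφ hm _
  filter_upwards [hE, hP] with x hx hxP
  have hzero : X ⟨0, le_rfl, zero_le_one⟩ x = 0 := by
    have : cutVec hh ((0 : ℚ) * T) = 0 := by
      rw [← norm_eq_zero, ← sq_eq_zero_iff, ← real_inner_self_eq_norm_sq, inner_cutVec]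
      simp [varFn_zero]
    simp only [hX, this]
    exact (hasPWZ_zero hT hφ x).pwz_eq
  have H : ∃ z : C0 T, IsGaussPath φ h x z := by
    obtain ⟨z, hz⟩ := exists_path_of_mem_unifContFamilies hT hx hzero
    refine ⟨z, fun r hr0 hr1 => ?_⟩
    rw [hz ⟨r, hr0, hr1⟩]
    exact (hasPWZ_congr φ (coeFn_cutVec hh _) x _).1 (hxP ⟨r, hr0, hr1⟩)
  rw [gaussProc, dif_pos H]
  exact H.choose_spec

/-- The step function `stepFn g n` times `h`, as an element of `L₂[0,T]`. -/
def stepVec (g : ℝ → ℝ) (n : ℕ) {h : ℝ → ℝ} (hh : MemLp h ⊤ (leb T)) : L2 T :=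
  ∑ k ∈ Finset.range n, g (k * T / n) •
    (cutVec hh ((k + 1 : ℕ) * T / n) - cutVec hh (k * T / n))

omit hφ hm in
lemma coeFn_stepVec (g : ℝ → ℝ) (n : ℕ) :
    stepVec g n hh =ᵐ[leb T] fun t => stepFn T g n t * h t := by
  have h1 : ∀ k : ℕ, ((g (k * T / n) •
      (cutVec hh ((k + 1 : ℕ) * T / n) - cutVec hh (k * T / n)) : L2 T) : ℝ → ℝ) =ᵐ[leb T]
      fun t => g (k * T / n) *
        (Ioc ((k : ℝ) * T / n) ((k + 1 : ℕ) * T / n)).indicator 1 t * h t := by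
    intro k
    filter_upwards [Lp.coeFn_smul (g (k * T / n))
        (cutVec hh ((k + 1 : ℕ) * T / n) - cutVec hh (k * T / n)),
      Lp.coeFn_sub (cutVec hh ((k + 1 : ℕ) * T / n)) (cutVec hh (k * T / n)),
      coeFn_cutVec hh ((k + 1 : ℕ) * T / n), coeFn_cutVec hh (k * T / n)] with t e1 e2 e3 e4
    rw [e1, Pi.smul_apply, e2, Pi.sub_apply, e3, e4, smul_eq_mul, mul_assoc]
    congr 1
    have hk0 : (0 : ℝ) ≤ k * T / n := by positivity
    have hk1 : (k : ℝ) * T / n ≤ (k + 1 : ℕ) * T / n := by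
      push_cast; gcongr; linarith
    by_cases a : t ∈ Icc 0 ((k : ℝ) * T / n)
    · have b : t ∈ Icc 0 (((k + 1 : ℕ) : ℝ) * T / n) := ⟨a.1, a.2.trans hk1⟩
      have d : t ∉ Ioc ((k : ℝ) * T / n) ((k + 1 : ℕ) * T / n) :=
        fun hd => absurd hd.1 (not_lt.2 a.2)
      rw [indicator_of_mem a, indicator_of_mem b, indicator_of_notMem d]; simp
    · by_cases b : t ∈ Icc 0 (((k + 1 : ℕ) : ℝ) * T / n)
      · have d : t ∈ Ioc ((k : ℝ) * T / n) ((k + 1 : ℕ) * T / n) :=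
          ⟨not_le.1 fun hd => a ⟨b.1, hd⟩, b.2⟩
        rw [indicator_of_notMem a, indicator_of_mem b, indicator_of_mem d]; simp
      · have d : t ∉ Ioc ((k : ℝ) * T / n) ((k + 1 : ℕ) * T / n) :=
          fun hd => b ⟨hk0.trans hd.1.le, hd.2⟩
        rw [indicator_of_notMem a, indicator_of_notMem b, indicator_of_notMem d]; simp
  have h2 := Lp.coeFn_finsetSum (Finset.range n) fun k : ℕ => (g (k * T / n) •
      (cutVec hh ((k + 1 : ℕ) * T / n) - cutVec hh (k * T / n)) : L2 T)
  filter_upwards [h2, ae_all_iff.2 h1] with t e1 e2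
  rw [stepVec, e1, stepFn, Finset.sum_apply, Finset.sum_mul]
  exact Finset.sum_congr rfl fun k _ => e2 k

omit hφ hm in
lemma tendsto_stepVec {g : ℝ → ℝ} (hg : BoundedVariationOn g (Icc 0 T)) :
    Tendsto (fun n => stepVec g n hh) atTop (𝓝 (mulL2 hh ((bv_memLp_two hT hg).toLp g))) := by
  rw [tendsto_iff_norm_sub_tendsto_zero]
  have h1 := tendsto_integral_stepFn_sub_sq hT hg
    (hh.mono_exponent le_top : MemLp h 2 (leb T))
  have e : ∀ n, ‖stepVec g n hh - mulL2 hh ((bv_memLp_two hT hg).toLp g)‖ ^ 2 =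
      ∫ t, ((stepFn T g n t - g t) * h t) ^ 2 ∂(leb T) := by
    intro n
    rw [norm_sq_L2_eq]
    refine integral_congr_ae ?_
    filter_upwards [Lp.coeFn_sub (stepVec g n hh) (mulL2 hh ((bv_memLp_two hT hg).toLp g)),
      coeFn_stepVec hT hh g n, coeFn_mulL2 hh ((bv_memLp_two hT hg).toLp g),
      (bv_memLp_two hT hg).coeFn_toLp] with t e1 e2 e3 e4
    rw [e1, Pi.sub_apply, e2, e3, e4]
    ring
  simp only [← e] at h1
  have h2 := (Real.continuous_sqrt.tendsto 0).comp h1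
  simpa [Function.comp_def, Real.sqrt_sq (norm_nonneg _)] using h2

/-- Partition points are rational multiples of T, so the Riemann sums along 𝒵_h(x) are exactly
⟨`stepVec` g n, x⟩, and `stepVec` g n tends to hg in L₂. -/
lemma ae_rsIntegral_gaussProc {g : ℝ → ℝ} (hg : BoundedVariationOn g (Icc 0 T)) :
    ∀ᵐ x ∂m, rsIntegral g (gaussProc φ h x) =
      pwz φ (mulL2 hh ((bv_memLp_two hT hg).toLp g)) x := by
  refine ae_eq_pwz_of_tendsto hT hφ hm (tendsto_stepVec hT hh hg) ?_
  filter_upwards [ae_isGaussPath hT hφ hm hh] with x hx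
  refine (tendsto_rsSum hT hg (gaussProc φ h x)).congr' ?_
  filter_upwards [eventually_gt_atTop 0] with n hn
  have hn' : (0 : ℚ) < n := by exact_mod_cast hn
  have hcut : ∀ k : ℕ, k ≤ n → HasPWZ φ (cutVec hh (k * T / n)) x
      (pathEval (gaussProc φ h x) (k * T / n)) := by
    intro k hk
    have hk' : (k : ℚ) ≤ n := by exact_mod_cast hk
    have := hx ((k : ℚ) / n) (by positivity) ((div_le_one hn').2 hk')
    rw [show (((k : ℚ) / n : ℚ) : ℝ) * T = k * T / n by push_cast; ring] at this
    exact (hasPWZ_congr φ (coeFn_cutVec hh _) x _).2 this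
  have := HasPWZ.sum hT hφ (Finset.range n) (fun k : ℕ => g (k * T / n))
    (u := fun k : ℕ => cutVec hh ((k + 1 : ℕ) * T / n) - cutVec hh (k * T / n)) (x := x)
    fun k hk => HasPWZ.sub hT hφ (hcut (k + 1) (Finset.mem_range.1 hk))
      (hcut k (Finset.mem_range.1 hk).le)
  exact this.pwz_eq.symm

omit hm in
lemma norm_sq_sum_basisVec (n : ℕ) (d : ℕ → ℝ) :
    ‖∑ j ∈ Finset.range n, d j • basisVec hT hφ j‖ ^ 2 = ∑ j ∈ Finset.range n, d j ^ 2 := by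
  rw [← real_inner_self_eq_norm_sq, (orthonormal_basisVec hT hφ).inner_sum]
  simp [sq]

/-- Two independent copies `⟨h φ_j, x⟩` and `⟨h' φ_j, x'⟩` with `h² + h'² = c²` combine, after
division by `c`, to a sequence of independent standard Gaussian variables. -/
lemma isStdGaussSeq_combine {h' : ℝ → ℝ} (hh' : MemLp h' ⊤ (leb T)) {c : ℝ} (hc0 : 0 < c)
    (hsq : ∀ᵐ t ∂(leb T), h t ^ 2 + h' t ^ 2 = c ^ 2) {ε : ℝ} (hε : ε ^ 2 = 1) :
    IsStdGaussSeq (m.prod m) fun j p => c⁻¹ * pwz φ (mulL2 hh (basisVec hT hφ j)) p.1 +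
      ε * c⁻¹ * pwz φ (mulL2 hh' (basisVec hT hφ j)) p.2 where
  aemeasurable j := by
    have h1 := measurable_pwz_right hT hφ (mulL2 hh (basisVec hT hφ j))
    have h2 := measurable_pwz_right hT hφ (mulL2 hh' (basisVec hT hφ j))
    exact (((h1.comp measurable_fst).const_mul _).add
      ((h2.comp measurable_snd).const_mul _)).aemeasurable
  charFun n d := by
    have := hm.isProbabilityMeasure
    have h1 := integral_cexp_mul_sum_pwz hT hφ hm c⁻¹ (Finset.range n) d
      fun j => mulL2 hh (basisVec hT hφ j)
    have h2 := integral_cexp_mul_sum_pwz hT hφ hm (ε * c⁻¹) (Finset.range n) d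
      fun j => mulL2 hh' (basisVec hT hφ j)
    have e : ∀ p : C0 T × C0 T, Complex.exp (Complex.I * ((∑ j ∈ Finset.range n, d j *
        (c⁻¹ * pwz φ (mulL2 hh (basisVec hT hφ j)) p.1 +
          ε * c⁻¹ * pwz φ (mulL2 hh' (basisVec hT hφ j)) p.2) : ℝ) : ℂ)) =
        Complex.exp (Complex.I * ((c⁻¹ * ∑ j ∈ Finset.range n, d j *
          pwz φ (mulL2 hh (basisVec hT hφ j)) p.1 : ℝ) : ℂ)) *
        Complex.exp (Complex.I * ((ε * c⁻¹ * ∑ j ∈ Finset.range n, d j *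
          pwz φ (mulL2 hh' (basisVec hT hφ j)) p.2 : ℝ) : ℂ)) := by
      intro p
      rw [← Complex.exp_add, ← mul_add, ← Complex.ofReal_add, Finset.mul_sum, Finset.mul_sum,
        ← Finset.sum_add_distrib]
      congr 3
      exact Finset.sum_congr rfl fun j _ => by ring
    simp only [e]
    refine (integral_prod_mul (μ := m) (ν := m)
      (fun x => Complex.exp (Complex.I * ((c⁻¹ * ∑ j ∈ Finset.range n, d j *
          pwz φ (mulL2 hh (basisVec hT hφ j)) x : ℝ) : ℂ)))
      (fun x => Complex.exp (Complex.I * ((ε * c⁻¹ * ∑ j ∈ Finset.range n, d j *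
          pwz φ (mulL2 hh' (basisVec hT hφ j)) x : ℝ) : ℂ)))).trans ?_
    rw [h1, h2, ← Complex.exp_add, ← Complex.ofReal_add]
    congr 2
    set u : L2 T := ∑ j ∈ Finset.range n, d j • basisVec hT hφ j with hu
    have hs : ∀ {k : ℝ → ℝ} (hk : MemLp k ⊤ (leb T)),
        ∑ j ∈ Finset.range n, d j • mulL2 hk (basisVec hT hφ j) = mulL2 hk u := by
      intro k hk; simp [hu, map_sum]
    have hi : ∀ {k : ℝ → ℝ} (hk : MemLp k ⊤ (leb T)),
        Integrable (fun t => k t ^ 2 * u t ^ 2) (leb T) := by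
      intro k hk
      refine (Lp.memLp (mulL2 hk u)).integrable_sq.congr ?_
      filter_upwards [coeFn_mulL2 hk u] with t ht
      rw [ht, mul_pow]
    -- The relation h² + h'² = c² enters here: the two variances add up to that of an orthonormal
    -- combination.
    have hsum : ‖mulL2 hh u‖ ^ 2 + ‖mulL2 hh' u‖ ^ 2 = c ^ 2 * ‖u‖ ^ 2 := by
      rw [norm_sq_mulL2, norm_sq_mulL2, norm_sq_L2_eq u, ← integral_add (hi hh) (hi hh'),
        ← integral_const_mul]
      refine integral_congr_ae ?_
      filter_upwards [hsq] with t ht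
      rw [← ht]; ring
    rw [hs, hs, ← norm_sq_sum_basisVec hT hφ n d, ← hu, mul_pow, hε, one_mul, inv_pow]
    have hc2 : c ^ 2 ≠ 0 := by positivity
    field_simp
    linear_combination -hsum

/-- The variables ⟨hφ_j, x⟩ may be correlated, so the theorem on independent sums does not apply to
them. With |h| ≤ c, h' = √(c² - h²) and an independent path x', each of the two sequences c⁻¹(⟨hφ_j,
x⟩ ± ⟨h'φ_j, x'⟩) is independent standard Gaussian. Both series converge, and adding them cancels
the auxiliary terms. -/
lemma ae_exists_tendsto_sum_mul_pwz (u : L2 T) :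
    ∀ᵐ x ∂m, ∃ l, Tendsto (fun n => ∑ j ∈ Finset.range n, inner ℝ (basisVec hT hφ j) u *
      pwz φ (mulL2 hh (basisVec hT hφ j)) x) atTop (𝓝 l) := by
  have := hm.isProbabilityMeasure
  obtain ⟨c, hc0, hc⟩ := exists_bound_of_memLp_top hh
  set h' : ℝ → ℝ := fun t => Real.sqrt (c ^ 2 - h t ^ 2) with hh'_def
  have hh' : MemLp h' ⊤ (leb T) := by
    refine memLp_top_of_bound ?_ c (Eventually.of_forall fun t => ?_)
    · exact Real.continuous_sqrt.comp_aestronglyMeasurable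
        (aestronglyMeasurable_const.sub (hh.1.pow 2))
    · rw [Real.norm_eq_abs, abs_of_nonneg (Real.sqrt_nonneg _)]
      refine Real.sqrt_le_iff.2 ⟨hc0.le, ?_⟩
      linarith [sq_nonneg (h t)]
  have hsq : ∀ᵐ t ∂(leb T), h t ^ 2 + h' t ^ 2 = c ^ 2 := by
    filter_upwards [hc] with t ht
    rw [hh'_def, Real.sq_sqrt (sub_nonneg.2 (sq_le_sq' (abs_le.1 ht).1 (abs_le.1 ht).2))]
    ring
  have hsum := (hasSum_inner_sq hT hφ u).summable
  have h1 := (isStdGaussSeq_combine hT hφ hm hh hh' hc0 hsq (ε := 1) (by norm_num)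
    ).ae_exists_tendsto hsum
  have h2 := (isStdGaussSeq_combine hT hφ hm hh hh' hc0 hsq (ε := -1) (by norm_num)
    ).ae_exists_tendsto hsum
  have h3 : ∀ᵐ p ∂(m.prod m), ∃ l, Tendsto (fun n => ∑ j ∈ Finset.range n,
      inner ℝ (basisVec hT hφ j) u * pwz φ (mulL2 hh (basisVec hT hφ j)) p.1) atTop (𝓝 l) := by
    filter_upwards [h1, h2] with p ⟨l1, h1⟩ ⟨l2, h2⟩
    refine ⟨c / 2 * (l1 + l2), ((h1.add h2).const_mul (c / 2)).congr fun n => ?_⟩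
    rw [← Finset.sum_add_distrib, Finset.mul_sum]
    refine Finset.sum_congr rfl fun j _ => ?_
    field_simp
    ring
  -- The event no longer involves the auxiliary path, so Fubini discards it.
  filter_upwards [Measure.ae_ae_of_ae_prod h3] with x hx
  exact hx.exists.choose_spec

/-- `⟨u, 𝒵_h(x,·)⟩ = ⟨uh, x⟩` for almost every `x`. -/
theorem ae_hasPWZ_gaussProc (u : L2 T) :
    ∀ᵐ x ∂m, HasPWZ φ u (gaussProc φ h x) (pwz φ (mulL2 hh u) x) := by
  set S : ℕ → L2 T := fun n =>
    ∑ j ∈ Finset.range n, inner ℝ (basisVec hT hφ j) u • mulL2 hh (basisVec hT hφ j)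
  have hS : Tendsto S atTop (𝓝 (mulL2 hh u)) := by
    refine (((mulL2 hh).continuous.tendsto u).comp (tendsto_partialSum hT hφ u)).congr fun n => ?_
    simp [S, map_sum]
  -- The partial sums along 𝒵_h(x) are ⟨S n, x⟩. They converge almost surely, and the convergence S
  -- n → hu in L₂ identifies the limit.
  have hex := ae_exists_tendsto_sum_mul_pwz hT hφ hm hh u
  have hSn : ∀ᵐ x ∂m, ∀ n, pwz φ (S n) x = ∑ j ∈ Finset.range n,
      inner ℝ (basisVec hT hφ j) u * pwz φ (mulL2 hh (basisVec hT hφ j)) x :=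
    ae_all_iff.2 fun n => ae_pwz_sum hT hφ hm _ _ _
  have hlim : ∀ᵐ x ∂m, Tendsto (fun n => pwz φ (S n) x) atTop
      (𝓝 (limUnder atTop fun n => pwz φ (S n) x)) := by
    filter_upwards [hex, hSn] with x ⟨l, hl⟩ hx
    exact tendsto_nhds_limUnder ⟨l, hl.congr fun n => (hx n).symm⟩
  have hrs : ∀ᵐ x ∂m, ∀ j, rsIntegral (φ j) (gaussProc φ h x) =
      pwz φ (mulL2 hh (basisVec hT hφ j)) x :=
    ae_all_iff.2 fun j => ae_rsIntegral_gaussProc hT hφ hm hh (hφ.boundedVariation j)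
  filter_upwards [hlim, ae_eq_pwz_of_tendsto hT hφ hm hS hlim, hSn, hrs] with x h1 h2 h3 h4
  rw [h2] at h1
  refine h1.congr fun n => ?_
  rw [h3, pwzApprox_eq hT hφ]
  exact Finset.sum_congr rfl fun j _ => by rw [h4]

end GaussPath

end FresnelGFFT
end


noncomputable section

namespace FresnelGFFT

variable {T : ℝ}

/-! ### Almost sure existence for a random integrand -/


lemma measurable_mulL2 {h : ℝ → ℝ} (hh : MemLp h ⊤ (leb T)) :
    Measurable fun u : L2 T => mulL2 hh u :=
  (mulL2 hh).continuous.measurable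

section Fubini

variable {φ : ℕ → ℝ → ℝ} {m : Measure (C0 T)} (hT : 0 < T) (hφ : IsPWZBasis T φ)
  (hm : IsWienerMeasure T m)
include hT hφ hm

/-- The null set of bad x depends on u; Fubini replaces these null sets by a single one. -/
lemma ae_ae_hasPWZ (ν : Measure (L2 T)) [SFinite ν] :
    ∀ᵐ x ∂m, ∀ᵐ (u : L2 T) ∂ν, HasPWZ φ (u : ℝ → ℝ) x (pwz φ (u : ℝ → ℝ) x) := by
  have := hm.isProbabilityMeasure
  have h1 : ∀ᵐ (u : L2 T) ∂ν, ∀ᵐ x ∂m, ∃ c, HasPWZ φ (u : ℝ → ℝ) x c :=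
    Eventually.of_forall fun u => (ae_hasPWZ hT hφ hm u).mono fun x hx => ⟨_, hx⟩
  have h2 := (Measure.ae_ae_comm (μ := ν) (ν := m)
    (p := fun u x => ∃ c, HasPWZ φ (u : ℝ → ℝ) x c) (measurableSet_hasPWZ hT hφ)).1 h1
  filter_upwards [h2] with x hx
  filter_upwards [hx] with u hu using hu.choose_spec.hasPWZ_pwz

/-- The set of x at which ⟨u,x⟩ exists is stable under scaling, so nothing is lost at other scales.
-/
lemma sae_ae_hasPWZ (ν : Measure (L2 T)) [SFinite ν] :
    SAE m fun x => ∀ᵐ (u : L2 T) ∂ν, HasPWZ φ (u : ℝ → ℝ) x (pwz φ (u : ℝ → ℝ) x) := by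
  intro ρ _
  filter_upwards [ae_ae_hasPWZ hT hφ hm ν] with x hx
  filter_upwards [hx] with u hu using (hu.smul_path hT hφ ρ).hasPWZ_pwz

lemma ae_ae_hasPWZ_gaussProc {h : ℝ → ℝ} (hh : MemLp h ⊤ (leb T)) (ν : Measure (L2 T))
    [SFinite ν] :
    ∀ᵐ x ∂m, ∀ᵐ (u : L2 T) ∂ν,
      HasPWZ φ (u : ℝ → ℝ) (gaussProc φ h x) (pwz φ (mulL2 hh u : ℝ → ℝ) x) := by
  have := hm.isProbabilityMeasure
  obtain ⟨A, hA⟩ : ∃ A : ℕ → L2 T × C0 T → ℝ, ∀ n p, A n p = ∑ j ∈ Finset.range n,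
      inner ℝ (basisVec hT hφ j) p.1 * pwz φ (mulL2 hh (basisVec hT hφ j)) p.2 :=
    ⟨_, fun _ _ => rfl⟩
  obtain ⟨B, hB⟩ : ∃ B : L2 T × C0 T → ℝ, ∀ p, B p = pwz φ (mulL2 hh p.1 : ℝ → ℝ) p.2 :=
    ⟨_, fun _ => rfl⟩
  have hin : ∀ j, Measurable fun u : L2 T => inner ℝ (basisVec hT hφ j) u := fun j =>
    ((innerSL ℝ) (basisVec hT hφ j)).continuous.measurable
  have hpw : ∀ j, Measurable fun x : C0 T => pwz φ (mulL2 hh (basisVec hT hφ j)) x := fun j =>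
    measurable_pwz_right hT hφ (mulL2 hh (basisVec hT hφ j))
  have hAm : ∀ n, Measurable (A n) := fun n => by
    rw [funext (hA n)]
    refine Finset.measurable_sum _ fun j _ => Measurable.mul ?_ ?_
    · exact (hin j).comp measurable_fst
    · exact (hpw j).comp measurable_snd
  have hBm : Measurable B := by
    rw [funext hB]
    have h1 : Measurable fun p : L2 T × C0 T => (mulL2 hh p.1, p.2) :=
      ((measurable_mulL2 hh).comp measurable_fst).prodMk measurable_snd
    have h2 := (measurable_pwz hT hφ).comp h1
    exact h2
  have hmeas : MeasurableSet {p : L2 T × C0 T | Tendsto (fun n => A n p) atTop (𝓝 (B p))} :=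
    measurableSet_tendsto_fun hAm hBm
  have hrs : ∀ᵐ x ∂m, ∀ j, rsIntegral (φ j) (gaussProc φ h x) =
      pwz φ (mulL2 hh (basisVec hT hφ j)) x :=
    ae_all_iff.2 fun j => ae_rsIntegral_gaussProc hT hφ hm hh (hφ.boundedVariation j)
  -- Fubini needs a jointly measurable event. Off one null set of x the partial sums along 𝒵_h(x)
  -- coincide with the jointly measurable A n, so measurability of x ↦ 𝒵_h(x) is never used.
  have key : ∀ x, (∀ j, rsIntegral (φ j) (gaussProc φ h x) =
      pwz φ (mulL2 hh (basisVec hT hφ j)) x) → ∀ u : L2 T,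
      (HasPWZ φ u (gaussProc φ h x) (pwz φ (mulL2 hh u : ℝ → ℝ) x) ↔
        Tendsto (fun n => A n (u, x)) atTop (𝓝 (B (u, x)))) := fun x hx u => by
    rw [hB, HasPWZ]
    refine tendsto_congr fun n => ?_
    rw [pwzApprox_eq hT hφ, hA]
    exact Finset.sum_congr rfl fun j _ => by rw [hx]
  have h1 : ∀ᵐ (u : L2 T) ∂ν, ∀ᵐ x ∂m, Tendsto (fun n => A n (u, x)) atTop (𝓝 (B (u, x))) :=
    Eventually.of_forall fun u => by
      filter_upwards [ae_hasPWZ_gaussProc hT hφ hm hh u, hrs] with x hx hr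
      exact (key x hr u).1 hx
  have h2 := (Measure.ae_ae_comm (μ := ν) (ν := m)
    (p := fun u x => Tendsto (fun n => A n (u, x)) atTop (𝓝 (B (u, x)))) hmeas).1 h1
  filter_upwards [h2, hrs] with x hx hr
  filter_upwards [hx] with u hu
  exact (key x hr u).2 hu

end Fubini

end FresnelGFFT
end


noncomputable section

namespace FresnelGFFT

variable {T : ℝ}

/-! ### Polar decomposition of complex measures -/

section ComplexMeasure

variable {X : Type*} {mX : MeasurableSpace X}

/-- The variation is dominated by the sum of the total variations of the real and imaginary parts.
-/
instance isFiniteMeasure_variation (f : ComplexMeasure X) : IsFiniteMeasure f.variation := by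
  have h : f.variation ≤
      (ComplexMeasure.re f).totalVariation + (ComplexMeasure.im f).totalVariation := by
    refine VectorMeasure.variation_le_of_forall_enorm_le fun s _ => ?_
    rw [Measure.add_apply]
    have h1 := SignedMeasure.enorm_le_totalVariation (ComplexMeasure.re f) s
    have h2 := SignedMeasure.enorm_le_totalVariation (ComplexMeasure.im f) s
    refine le_trans ?_ (add_le_add h1 h2)
    have h3 : (f s : ℂ) = ((f s).re : ℂ) + ((f s).im : ℂ) * Complex.I := (Complex.re_add_im _).symm
    calc ‖f s‖ₑ = ‖((f s).re : ℂ) + ((f s).im : ℂ) * Complex.I‖ₑ := by rw [← h3]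
      _ ≤ ‖((f s).re : ℂ)‖ₑ + ‖((f s).im : ℂ) * Complex.I‖ₑ := enorm_add_le _ _
      _ = ‖(f s).re‖ₑ + ‖(f s).im‖ₑ := by
        rw [enorm_mul]
        simp [← ofReal_norm]
  exact isFiniteMeasure_of_le _ h

lemma integrable_of_norm_eq_one {ν : Measure X} [IsFiniteMeasure ν] {w : X → ℂ}
    (hw : Measurable w) (hw1 : ∀ x, ‖w x‖ = 1) : Integrable w ν :=
  Integrable.of_bound hw.aestronglyMeasurable 1 (Eventually.of_forall fun x => (hw1 x).le)

lemma variation_withDensityᵥ_of_norm_eq_one {ν : Measure X} [IsFiniteMeasure ν] {w : X → ℂ}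
    (hw : Measurable w) (hw1 : ∀ x, ‖w x‖ = 1) : (ν.withDensityᵥ w).variation = ν := by
  rw [Measure.variation_withDensityᵥ (integrable_of_norm_eq_one hw hw1)]
  have : (fun x => ‖w x‖ₑ) = fun _ => 1 := by
    funext x
    rw [← ofReal_norm, hw1, ENNReal.ofReal_one]
  rw [this]
  exact withDensity_one

/-- A complex measure has a density of modulus one with respect to its total variation. -/
lemma exists_eq_withDensityᵥ (f : ComplexMeasure X) :
    ∃ w : X → ℂ, Measurable w ∧ (∀ x, ‖w x‖ = 1) ∧ f = f.variation.withDensityᵥ w := by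
  have hac : f ≪ᵥ f.variation.toENNRealVectorMeasure := by
    refine VectorMeasure.AbsolutelyContinuous.mk fun s hs h => ?_
    rw [Measure.toENNRealVectorMeasure_apply_measurable hs] at h
    have := VectorMeasure.enorm_measure_le_variation f s
    rw [h] at this
    simpa using this
  obtain ⟨hre, him⟩ := (ComplexMeasure.absolutelyContinuous_ennreal_iff _ _).1 hac
  have h1 : f.variation.withDensityᵥ (f.rnDeriv f.variation) = f := by
    ext s hs : 1
    rw [withDensityᵥ_apply (f.integrable_rnDeriv _) hs]
    apply Complex.ext
    · have := SignedMeasure.withDensityᵥ_rnDeriv_eq _ _ hre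
      rw [← RCLike.re_eq_complex_re, ← integral_re (f.integrable_rnDeriv _).integrableOn]
      have h2 := congrArg (fun μ : SignedMeasure X => μ s) this
      simp only [withDensityᵥ_apply (SignedMeasure.integrable_rnDeriv _ _) hs] at h2
      exact h2
    · have := SignedMeasure.withDensityᵥ_rnDeriv_eq _ _ him
      rw [← RCLike.im_eq_complex_im, ← integral_im (f.integrable_rnDeriv _).integrableOn]
      have h2 := congrArg (fun μ : SignedMeasure X => μ s) this
      simp only [withDensityᵥ_apply (SignedMeasure.integrable_rnDeriv _ _) hs] at h2
      exact h2
  have hmeas : Measurable (f.rnDeriv f.variation) := by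
    have : f.rnDeriv f.variation = fun x => (((ComplexMeasure.re f).rnDeriv f.variation x : ℝ) : ℂ) +
        (((ComplexMeasure.im f).rnDeriv f.variation x : ℝ) : ℂ) * Complex.I := by
      funext x
      apply Complex.ext <;> simp [ComplexMeasure.rnDeriv]
    rw [this]
    exact (Complex.measurable_ofReal.comp (SignedMeasure.measurable_rnDeriv _ _)).add
      ((Complex.measurable_ofReal.comp (SignedMeasure.measurable_rnDeriv _ _)).mul_const _)
  -- A measure given by a density has as variation the measure with density the modulus. Here that
  -- variation is the base measure itself, which forces modulus one.
  have h2 : ∀ᵐ x ∂f.variation, ‖f.rnDeriv f.variation x‖ = 1 := by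
    have h3 := Measure.variation_withDensityᵥ (f.integrable_rnDeriv f.variation)
    rw [h1] at h3
    have h4 : f.variation.withDensity (fun x => ‖f.rnDeriv f.variation x‖ₑ) =
        f.variation.withDensity 1 := by rw [← h3, withDensity_one]
    have h5 := (withDensity_eq_iff_of_sigmaFinite hmeas.enorm.aemeasurable
      measurable_one.aemeasurable).1 h4
    filter_upwards [h5] with x hx
    rw [← toReal_enorm, hx]
    simp
  -- The density is reset to 1 on the exceptional null set, so that it has modulus one everywhere.
  refine ⟨fun x => if ‖f.rnDeriv f.variation x‖ = 1 then f.rnDeriv f.variation x else 1,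
    Measurable.ite (measurableSet_eq_fun hmeas.norm measurable_const) hmeas measurable_const,
    fun x => ?_, ?_⟩
  · dsimp only
    split_ifs with h <;> simp [h]
  · conv_lhs => rw [← h1]
    refine WithDensityᵥEq.congr_ae ?_
    filter_upwards [h2] with x hx
    rw [if_pos hx]

/-- Supplies the closedness step in the induction of `integral_withDensityᵥ_mul`. -/
lemma continuous_integral_mul_L1 {ν : Measure X} {w : X → ℂ} (hw : Measurable w)
    (hw1 : ∀ x, ‖w x‖ = 1) : Continuous fun k : X →₁[ν] ℂ => ∫ x, w x * k x ∂ν := by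
  have hmul : ∀ k : X →₁[ν] ℂ, Integrable (fun x => w x * k x) ν := fun k =>
    (L1.integrable_coeFn k).bdd_mul hw.aestronglyMeasurable (c := 1)
      (Eventually.of_forall fun x => (hw1 x).le)
  refine LipschitzWith.continuous (K := 1) (LipschitzWith.of_dist_le_mul fun k l => ?_)
  rw [dist_eq_norm, dist_eq_norm, ← integral_sub (hmul k) (hmul l), L1.norm_eq_integral_norm,
    NNReal.coe_one, one_mul]
  refine (norm_integral_le_integral_norm _).trans_eq (integral_congr_ae ?_)
  filter_upwards [Lp.coeFn_sub k l] with x hx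
  rw [← mul_sub, norm_mul, hw1, one_mul, hx, Pi.sub_apply]

/-- Turns the vector-measure integral that defines the class into a Lebesgue integral. Both sides
are additive and L¹-continuous in g, so multiples of indicators suffice. -/
lemma integral_withDensityᵥ_mul {ν : Measure X} [IsFiniteMeasure ν] {w : X → ℂ}
    (hw : Measurable w) (hw1 : ∀ x, ‖w x‖ = 1) {g : X → ℂ} (hg : Integrable g ν) :
    VectorMeasure.integral (ν.withDensityᵥ w) g (ContinuousLinearMap.mul ℝ ℂ) =
      ∫ x, w x * g x ∂ν := by
  have hv := variation_withDensityᵥ_of_norm_eq_one (ν := ν) hw hw1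
  have hwi := integrable_of_norm_eq_one (ν := ν) hw hw1
  have hmul : ∀ g : X → ℂ, Integrable g ν → Integrable (fun x => w x * g x) ν := fun g hg =>
    hg.bdd_mul hw.aestronglyMeasurable (c := 1) (Eventually.of_forall fun x => (hw1 x).le)
  have hg' : Integrable g (ν.withDensityᵥ w).variation := by rwa [hv]
  refine hg'.induction (P := fun g => VectorMeasure.integral (ν.withDensityᵥ w) g
    (ContinuousLinearMap.mul ℝ ℂ) = ∫ x, w x * g x ∂ν) ?_ ?_ ?_ ?_
  · intro c s hs hc
    have : IsFiniteMeasure ((ν.withDensityᵥ w).variation.restrict s) := ⟨by simp⟩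
    rw [VectorMeasure.integral_indicator_const _ hs, withDensityᵥ_apply hwi hs]
    have : (fun x => w x * s.indicator (fun _ => c) x) = s.indicator fun x => w x * c := by
      funext x
      by_cases hx : x ∈ s <;> simp [hx]
    rw [this, integral_indicator hs, integral_mul_const]
    simp [mul_comm]
  · intro f g _ hf hg h1 h2
    rw [VectorMeasure.integral_add hf hg, h1, h2]
    rw [hv] at hf hg
    rw [← integral_add (hmul f hf) (hmul g hg)]
    simp [mul_add]
  · refine isClosed_eq VectorMeasure.continuous_integral ?_
    have hc : ∀ ν' : Measure X, ν' = ν → Continuous fun k : X →₁[ν'] ℂ => ∫ x, w x * k x ∂ν := by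
      rintro _ rfl
      exact continuous_integral_mul_L1 hw hw1
    exact hc _ hv
  · intro f g hfg _ hf
    rw [← VectorMeasure.integral_congr_ae hfg, hf]
    rw [hv] at hfg
    exact integral_congr_ae (hfg.mono fun x hx => by simp only [hx])

end ComplexMeasure

end FresnelGFFT
end


noncomputable section

namespace FresnelGFFT

variable {T : ℝ}

/-! ### Uniqueness of the representing measure -/

section Hilbert

variable {H : Type*} [NormedAddCommGroup H] [InnerProductSpace ℝ H] [CompleteSpace H]
  [SecondCountableTopology H] [MeasurableSpace H] [BorelSpace H]

/-- Two finite measures on a Hilbert space with the same finite Laplace transform agree. -/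
lemma ext_of_integral_exp_inner {μ ν : Measure H} [IsFiniteMeasure μ] [IsFiniteMeasure ν]
    (hμ : ∀ v, Integrable (fun u : H => Real.exp (inner ℝ u v)) μ)
    (h : ∀ v, ∫ u, Real.exp (inner ℝ u v) ∂μ = ∫ u, Real.exp (inner ℝ u v) ∂ν) : μ = ν := by
  refine Measure.ext_of_charFun (funext fun v => ?_)
  have hmgf : mgf (fun u : H => inner ℝ u v) μ = mgf (fun u : H => inner ℝ u v) ν := by
    funext t
    have := h (t • v)
    simpa only [mgf, inner_smul_right] using this
  have h0 : μ = 0 ↔ ν = 0 := by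
    have h1 := h 0
    simp only [inner_zero_right, Real.exp_zero, integral_const, smul_eq_mul, mul_one] at h1
    rw [← Measure.measure_univ_eq_zero, ← Measure.measure_univ_eq_zero,
      ← measureReal_eq_zero_iff, h1, measureReal_eq_zero_iff]
  -- The Laplace transform is finite everywhere, so the complex moment generating function is
  -- determined on the whole plane, in particular at i, where it is the characteristic function.
  have huniv : integrableExpSet (fun u : H => inner ℝ u v) μ = Set.univ := by
    refine Set.eq_univ_of_forall fun t => ?_
    have := hμ (t • v)
    simpa only [integrableExpSet, Set.mem_ofPred_eq, inner_smul_right] using this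
  have h2 := eqOn_complexMGF_of_mgf' hmgf h0
  have h3 : Complex.I ∈ {z : ℂ | z.re ∈ interior (integrableExpSet (fun u : H => inner ℝ u v) μ)} := by
    rw [huniv]
    simp
  have h4 := h2 h3
  simp only [complexMGF] at h4
  rw [charFun_apply, charFun_apply]
  simpa only [mul_comm Complex.I] using h4

omit [CompleteSpace H] [SecondCountableTopology H] in
-- The Gaussian weight absorbs every exponential, because ⟨u,v⟩ - ‖u‖²/2 ≤ ‖v‖²/2.
lemma integrable_bdd_mul_exp_inner {ν : Measure H} [IsFiniteMeasure ν] {a : H → ℝ}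
    (ha : Measurable a) {C : ℝ} (hC : ∀ u, |a u| ≤ C) (v : H) :
    Integrable (fun u => a u * Real.exp (-‖u‖ ^ 2 / 2) * Real.exp (inner ℝ u v)) ν := by
  have hm1 : Measurable fun u : H => Real.exp (-‖u‖ ^ 2 / 2) :=
    (by fun_prop : Continuous fun u : H => Real.exp (-‖u‖ ^ 2 / 2)).measurable
  have hm2 : Measurable fun u : H => Real.exp (inner ℝ u v) :=
    (by fun_prop : Continuous fun u : H => Real.exp (inner ℝ u v)).measurable
  refine Integrable.of_bound ((ha.mul hm1).mul hm2).aestronglyMeasurable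
    (C * Real.exp (‖v‖ ^ 2 / 2)) (Eventually.of_forall fun u => ?_)
  rw [mul_assoc, ← Real.exp_add, norm_mul, Real.norm_eq_abs, Real.norm_eq_abs, Real.abs_exp]
  have h0 : 0 ≤ C := (abs_nonneg _).trans (hC u)
  refine mul_le_mul (hC u) (Real.exp_le_exp.2 ?_) (Real.exp_pos _).le h0
  have := real_inner_le_norm u v
  nlinarith [sq_nonneg (‖u‖ - ‖v‖)]

/-- A bounded density is determined by the Gaussian convolution of the measure. -/
lemma ae_eq_zero_of_integral_mul_exp_sub {ν : Measure H} [IsFiniteMeasure ν] {a : H → ℝ}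
    (ha : Measurable a) {C : ℝ} (hC : ∀ u, |a u| ≤ C)
    (h : ∀ v, ∫ u, a u * Real.exp (-‖u - v‖ ^ 2 / 2) ∂ν = 0) : a =ᵐ[ν] 0 := by
  set g : H → ℝ := fun u => Real.exp (-‖u‖ ^ 2 / 2) with hg
  have hgm : Measurable g :=
    (by fun_prop : Continuous fun u : H => Real.exp (-‖u‖ ^ 2 / 2)).measurable
  have hgpos : ∀ u, 0 < g u := fun u => Real.exp_pos _
  have h1 : ∀ v, ∫ u, a u * g u * Real.exp (inner ℝ u v) ∂ν = 0 := fun v => by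
    -- Expanding ‖u - v‖² turns the Gaussian kernel into a fixed weight times the Laplace kernel.
    have h2 : ∀ u : H, a u * g u * Real.exp (inner ℝ u v) =
        Real.exp (‖v‖ ^ 2 / 2) * (a u * Real.exp (-‖u - v‖ ^ 2 / 2)) := fun u => by
      rw [hg, mul_assoc, ← Real.exp_add, mul_left_comm, ← Real.exp_add, norm_sub_sq_real]
      ring_nf
    simp_rw [h2]
    rw [integral_const_mul, h v, mul_zero]
  have hCp : ∀ u, |max (a u) 0| ≤ C := fun u => by
    rw [abs_of_nonneg (le_max_right _ _)]
    exact max_le ((le_abs_self _).trans (hC u)) ((abs_nonneg _).trans (hC u))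
  have hCn : ∀ u, |max (-a u) 0| ≤ C := fun u => by
    rw [abs_of_nonneg (le_max_right _ _)]
    exact max_le ((neg_le_abs _).trans (hC u)) ((abs_nonneg _).trans (hC u))
  have hpm : Measurable fun u => max (a u) 0 := ha.max measurable_const
  have hnm : Measurable fun u => max (-a u) 0 := ha.neg.max measurable_const
  -- The positive and negative parts of a give two finite positive measures, and `h1` says that
  -- their Laplace transforms agree.
  set μ₁ : Measure H := ν.withDensity fun u => ENNReal.ofReal (max (a u) 0 * g u) with hμ₁
  set μ₂ : Measure H := ν.withDensity fun u => ENNReal.ofReal (max (-a u) 0 * g u) with hμ₂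
  have hdm : ∀ b : H → ℝ, Measurable b → Measurable fun u => ENNReal.ofReal (b u * g u) :=
    fun b hb => (hb.mul hgm).ennreal_ofReal
  have hint : ∀ b : H → ℝ, Measurable b → (∀ u, |b u| ≤ C) → Integrable (fun u => b u * g u) ν :=
    fun b hb hbC => by simpa using integrable_bdd_mul_exp_inner (ν := ν) hb hbC 0
  have hfin : ∀ b : H → ℝ, Measurable b → (∀ u, |b u| ≤ C) →
      IsFiniteMeasure (ν.withDensity fun u => ENNReal.ofReal (b u * g u)) := fun b hb hbC =>
    isFiniteMeasure_withDensity_ofReal (hint b hb hbC).2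
  have := hfin _ hpm hCp
  have := hfin _ hnm hCn
  have hwd : ∀ b : H → ℝ, Measurable b → (∀ u, 0 ≤ b u) → ∀ v,
      ∫ u, Real.exp (inner ℝ u v) ∂(ν.withDensity fun u => ENNReal.ofReal (b u * g u)) =
      ∫ u, b u * g u * Real.exp (inner ℝ u v) ∂ν := fun b hb hb0 v => by
    rw [integral_withDensity_eq_integral_toReal_smul (hdm b hb)
      (Eventually.of_forall fun _ => ENNReal.ofReal_lt_top)]
    refine integral_congr_ae (Eventually.of_forall fun u => ?_)
    simp only [smul_eq_mul]
    rw [ENNReal.toReal_ofReal (mul_nonneg (hb0 u) (hgpos u).le)]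
  have heq : μ₁ = μ₂ := by
    refine ext_of_integral_exp_inner (fun v => ?_) fun v => ?_
    · rw [hμ₁, integrable_withDensity_iff_integrable_smul' (hdm _ hpm)
        (Eventually.of_forall fun _ => ENNReal.ofReal_lt_top)]
      refine (integrable_bdd_mul_exp_inner (ν := ν) hpm hCp v).congr
        (Eventually.of_forall fun u => ?_)
      simp only [smul_eq_mul]
      rw [ENNReal.toReal_ofReal (mul_nonneg (le_max_right _ _) (hgpos u).le)]
    · rw [hμ₁, hμ₂, hwd _ hpm (fun _ => le_max_right _ _), hwd _ hnm (fun _ => le_max_right _ _),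
        ← sub_eq_zero, ← integral_sub (integrable_bdd_mul_exp_inner hpm hCp v)
          (integrable_bdd_mul_exp_inner hnm hCn v)]
      refine Eq.trans ?_ (h1 v)
      refine integral_congr_ae (Eventually.of_forall fun u => ?_)
      have : max (a u) 0 - max (-a u) 0 = a u := by
        rcases le_total (a u) 0 with h' | h'
        · rw [max_eq_right h', max_eq_left (by linarith)]; ring
        · rw [max_eq_left h', max_eq_right (by linarith)]; ring
      simp only
      rw [← sub_mul, ← sub_mul, this]
  rw [hμ₁, hμ₂, withDensity_eq_iff_of_sigmaFinite (hdm _ hpm).aemeasurable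
    (hdm _ hnm).aemeasurable] at heq
  filter_upwards [heq] with u hu
  rw [ENNReal.ofReal_eq_ofReal_iff (mul_nonneg (le_max_right _ _) (hgpos u).le)
    (mul_nonneg (le_max_right _ _) (hgpos u).le)] at hu
  have := mul_right_cancel₀ (hgpos u).ne' hu
  rcases le_total (a u) 0 with h' | h'
  · rw [max_eq_right h', max_eq_left (by linarith)] at this
    simpa using this.symm
  · rw [max_eq_left h', max_eq_right (by linarith)] at this
    simpa using this

lemma ae_eq_zero_of_integral_mul_exp_sub_complex {ν : Measure H} [IsFiniteMeasure ν] {w : H → ℂ}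
    (hw : Measurable w) {C : ℝ} (hC : ∀ u, ‖w u‖ ≤ C)
    (h : ∀ v, ∫ u, w u * ((Real.exp (-‖u - v‖ ^ 2 / 2) : ℝ) : ℂ) ∂ν = 0) : w =ᵐ[ν] 0 := by
  have hint : ∀ v, Integrable (fun u => w u * ((Real.exp (-‖u - v‖ ^ 2 / 2) : ℝ) : ℂ)) ν :=
    fun v => by
    have h1 : Measurable fun u : H => Real.exp (-‖u - v‖ ^ 2 / 2) :=
      (by fun_prop : Continuous fun u : H => Real.exp (-‖u - v‖ ^ 2 / 2)).measurable
    refine Integrable.of_bound (hw.mul (Complex.measurable_ofReal.comp h1)).aestronglyMeasurable C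
      (Eventually.of_forall fun u => ?_)
    rw [norm_mul, Complex.norm_real, Real.norm_eq_abs, Real.abs_exp]
    refine (mul_le_of_le_one_right (norm_nonneg _) (Real.exp_le_one_iff.2 ?_)).trans (hC u)
    have := sq_nonneg ‖u - v‖
    linarith
  have hre : (fun u => (w u).re) =ᵐ[ν] 0 := by
    refine ae_eq_zero_of_integral_mul_exp_sub (Complex.measurable_re.comp hw)
      (fun u => (Complex.abs_re_le_norm _).trans (hC u)) fun v => ?_
    have h1 := integral_re (hint v)
    rw [h v] at h1
    simpa only [RCLike.re_eq_complex_re, Complex.mul_re, Complex.ofReal_re, Complex.ofReal_im,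
      mul_zero, sub_zero, Complex.zero_re] using h1
  have him : (fun u => (w u).im) =ᵐ[ν] 0 := by
    refine ae_eq_zero_of_integral_mul_exp_sub (Complex.measurable_im.comp hw)
      (fun u => (Complex.abs_im_le_norm _).trans (hC u)) fun v => ?_
    have h1 := integral_im (hint v)
    rw [h v] at h1
    simpa only [RCLike.im_eq_complex_im, Complex.mul_im, Complex.ofReal_re, Complex.ofReal_im,
      mul_zero, zero_add, Complex.zero_im] using h1
  filter_upwards [hre, him] with u h1 h2
  exact Complex.ext h1 h2

end Hilbert

/-! ### Injectivity of the Fresnel representation -/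

section Fresnel

variable {φ : ℕ → ℝ → ℝ} {m : Measure (C0 T)}

lemma measurable_cexp_pwz_left (hT : 0 < T) (hφ : IsPWZBasis T φ) (x : C0 T) :
    Measurable fun u : L2 T => Complex.exp (Complex.I * ((pwz φ (u : ℝ → ℝ) x : ℝ) : ℂ)) :=
  Complex.measurable_exp.comp
    ((Complex.measurable_ofReal.comp (measurable_pwz_left hT hφ x)).const_mul _)

lemma integrable_cexp_pwz_left (hT : 0 < T) (hφ : IsPWZBasis T φ) (x : C0 T)
    (ν : Measure (L2 T)) [IsFiniteMeasure ν] :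
    Integrable (fun u : L2 T => Complex.exp (Complex.I * ((pwz φ (u : ℝ → ℝ) x : ℝ) : ℂ))) ν :=
  Integrable.of_bound (measurable_cexp_pwz_left hT hφ x).aestronglyMeasurable 1
    (Eventually.of_forall fun _ => (norm_cexp_I_mul _).le)

lemma fresnelIntegral_withDensityᵥ (hT : 0 < T) (hφ : IsPWZBasis T φ) {ν : Measure (L2 T)}
    [IsFiniteMeasure ν] {w : L2 T → ℂ} (hw : Measurable w) (hw1 : ∀ u, ‖w u‖ = 1) (x : C0 T) :
    fresnelIntegral φ (ν.withDensityᵥ w) x =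
      ∫ u : L2 T, w u * Complex.exp (Complex.I * ((pwz φ (u : ℝ → ℝ) x : ℝ) : ℂ)) ∂ν :=
  integral_withDensityᵥ_mul hw hw1 (integrable_cexp_pwz_left hT hφ x ν)

/-- A Fourier transform on Wiener space that vanishes almost everywhere comes from the zero
measure. -/
lemma ae_eq_zero_of_ae_integral_cexp_pwz_eq_zero (hT : 0 < T) (hφ : IsPWZBasis T φ)
    (hm : IsWienerMeasure T m) {ν : Measure (L2 T)} [IsFiniteMeasure ν] {w : L2 T → ℂ}
    (hw : Measurable w) {C : ℝ} (hC : ∀ u, ‖w u‖ ≤ C)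
    (h : ∀ᵐ y ∂m, ∫ u : L2 T,
      w u * Complex.exp (Complex.I * ((pwz φ (u : ℝ → ℝ) y : ℝ) : ℂ)) ∂ν = 0) : w =ᵐ[ν] 0 := by
  have := hm.isProbabilityMeasure
  have : Fact ((2 : ENNReal) ≠ ⊤) := ⟨by simp⟩
  have : SecondCountableTopology (L2 T) := inferInstance
  refine ae_eq_zero_of_integral_mul_exp_sub_complex hw hC fun v => ?_
  -- Multiplying the hypothesis by e^{-i⟨v,y⟩} and averaging over y replaces e^{i⟨u,y⟩} by the mean
  -- of e^{i⟨u-v,y⟩}, which is e^{-‖u-v‖²/2}.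
  obtain ⟨e, he⟩ : ∃ e : L2 T × C0 T → ℂ, ∀ p, e p =
      Complex.exp (Complex.I * ((pwz φ ((p.1 - v : L2 T) : ℝ → ℝ) p.2 : ℝ) : ℂ)) :=
    ⟨_, fun _ => rfl⟩
  have hem : Measurable e := by
    rw [funext he]
    have h1 : Measurable fun p : L2 T × C0 T => (p.1 - v, p.2) :=
      ((continuous_id.sub continuous_const).measurable.comp measurable_fst).prodMk measurable_snd
    have h2 := (measurable_pwz hT hφ).comp h1
    have h3 : Measurable fun p : L2 T × C0 T => pwz φ ((p.1 - v : L2 T) : ℝ → ℝ) p.2 := h2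
    exact Complex.measurable_exp.comp ((Complex.measurable_ofReal.comp h3).const_mul _)
  have hint : Integrable (fun p : L2 T × C0 T => w p.1 * e p) (ν.prod m) := by
    refine Integrable.of_bound ((hw.comp measurable_fst).mul hem).aestronglyMeasurable C
      (Eventually.of_forall fun p => ?_)
    rw [norm_mul, he, norm_cexp_I_mul, mul_one]
    exact hC _
  have h1 : ∀ᵐ y ∂m, ∫ u : L2 T, w u * e (u, y) ∂ν = 0 := by
    filter_upwards [h, ae_ae_hasPWZ hT hφ hm ν, ae_hasPWZ hT hφ hm v] with y hy hu hv
    have h2 : ∀ᵐ (u : L2 T) ∂ν, w u * e (u, y) =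
        Complex.exp (-(Complex.I * ((pwz φ (v : ℝ → ℝ) y : ℝ) : ℂ))) *
          (w u * Complex.exp (Complex.I * ((pwz φ (u : ℝ → ℝ) y : ℝ) : ℂ))) := by
      filter_upwards [hu] with u hu
      rw [he, (HasPWZ.sub hT hφ hu hv).pwz_eq, mul_left_comm, ← Complex.exp_add]
      congr 2
      push_cast
      ring
    rw [integral_congr_ae h2, integral_const_mul, hy, mul_zero]
  have h2 : ∫ u : L2 T, ∫ y, w u * e (u, y) ∂m ∂ν = 0 := by
    have h3 := integral_integral_swap (μ := ν) (ν := m) (f := fun u y => w u * e (u, y)) hint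
    rw [h3]
    exact integral_eq_zero_of_ae h1
  rw [← h2]
  refine integral_congr_ae (Eventually.of_forall fun u => ?_)
  simp only [he]
  rw [integral_const_mul, integral_cexp_pwz hT hφ hm, Complex.ofReal_exp]

/-- The polar density of f - g is unimodular and yet vanishes almost everywhere, so f - g has
variation zero. -/
lemma eq_of_ae_fresnelIntegral_eq (hT : 0 < T) (hφ : IsPWZBasis T φ) (hm : IsWienerMeasure T m)
    {f g : ComplexMeasure (L2 T)}
    (h : ∀ᵐ y ∂m, fresnelIntegral φ f y = fresnelIntegral φ g y) : f = g := by
  obtain ⟨w, hw, hw1, hd⟩ := exists_eq_withDensityᵥ (f - g)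
  have h1 : w =ᵐ[(f - g).variation] 0 := by
    refine ae_eq_zero_of_ae_integral_cexp_pwz_eq_zero hT hφ hm hw (fun u => (hw1 u).le) ?_
    filter_upwards [h] with y hy
    rw [← fresnelIntegral_withDensityᵥ hT hφ hw hw1, ← hd, fresnelIntegral,
      VectorMeasure.integral_sub_vectorMeasure (integrable_cexp_pwz_left hT hφ y _)
        (integrable_cexp_pwz_left hT hφ y _)]
    exact sub_eq_zero.2 hy
  have h2 : ∀ᵐ (_ : L2 T) ∂(f - g).variation, False := by
    filter_upwards [h1] with u hu
    have := hw1 u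
    rw [hu] at this
    simp at this
  have h3 : (f - g).variation = 0 := by
    rwa [← ae_eq_bot, ← eventually_false_iff_eq_bot]
  exact sub_eq_zero.1 (VectorMeasure.variation_eq_zero.1 h3)

lemma MemS.exists_eq_integral (hT : 0 < T) (hφ : IsPWZBasis T φ) {F : C0 T → ℂ}
    (hF : MemS φ F) :
    ∃ (ν : Measure (L2 T)) (w : L2 T → ℂ), IsFiniteMeasure ν ∧ Measurable w ∧ (∀ u, ‖w u‖ = 1) ∧
      ∀ x : C0 T, (∀ᵐ (u : L2 T) ∂ν, HasPWZ φ (u : ℝ → ℝ) x (pwz φ (u : ℝ → ℝ) x)) →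
        F x = ∫ u : L2 T, w u * Complex.exp (Complex.I * ((pwz φ (u : ℝ → ℝ) x : ℝ) : ℂ)) ∂ν := by
  obtain ⟨f, hf⟩ := hF
  obtain ⟨w, hw, hw1, hd⟩ := exists_eq_withDensityᵥ f
  refine ⟨f.variation, w, inferInstance, hw, hw1, fun x hx => ?_⟩
  rw [hf x (hx.mono fun u hu => ⟨_, hu⟩), ← fresnelIntegral_withDensityᵥ hT hφ hw hw1, ← hd]

lemma memS_integral (hT : 0 < T) (hφ : IsPWZBasis T φ) {ν : Measure (L2 T)}
    [IsFiniteMeasure ν] {w : L2 T → ℂ} (hw : Measurable w) (hw1 : ∀ u, ‖w u‖ = 1) :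
    MemS φ fun x : C0 T => ∫ u : L2 T,
      w u * Complex.exp (Complex.I * ((pwz φ (u : ℝ → ℝ) x : ℝ) : ℂ)) ∂ν :=
  ⟨ν.withDensityᵥ w, fun x _ => (fresnelIntegral_withDensityᵥ hT hφ hw hw1 x).symm⟩

/-- The representing measure of a functional of `𝒮(L₂[0,T])` is determined by its values almost
everywhere. -/
lemma MemS.eq_integral_of_ae_eq (hT : 0 < T) (hφ : IsPWZBasis T φ) (hm : IsWienerMeasure T m)
    {H : C0 T → ℂ} (hH : MemS φ H) {ν : Measure (L2 T)} [IsFiniteMeasure ν] {w : L2 T → ℂ}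
    (hw : Measurable w) (hw1 : ∀ u, ‖w u‖ = 1)
    (h : ∀ᵐ y ∂m, H y = ∫ u : L2 T,
      w u * Complex.exp (Complex.I * ((pwz φ (u : ℝ → ℝ) y : ℝ) : ℂ)) ∂ν)
    {x : C0 T} (hx : ∀ᵐ (u : L2 T) ∂ν, HasPWZ φ (u : ℝ → ℝ) x (pwz φ (u : ℝ → ℝ) x)) :
    H x = ∫ u : L2 T, w u * Complex.exp (Complex.I * ((pwz φ (u : ℝ → ℝ) x : ℝ) : ℂ)) ∂ν := by
  obtain ⟨f, hf⟩ := hH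
  have hfg : f = ν.withDensityᵥ w := by
    refine eq_of_ae_fresnelIntegral_eq hT hφ hm ?_
    filter_upwards [h, ae_ae_hasPWZ hT hφ hm f.variation] with y hy hd
    rw [← hf y (hd.mono fun u hu => ⟨_, hu⟩), hy, fresnelIntegral_withDensityᵥ hT hφ hw hw1]
  rw [hf x, hfg, fresnelIntegral_withDensityᵥ hT hφ hw hw1]
  rw [FresnelDefinedAt, hfg, variation_withDensityᵥ_of_norm_eq_one hw hw1]
  exact hx.mono fun u hu => ⟨_, hu⟩

end Fresnel

end FresnelGFFT
end


noncomputable section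

namespace FresnelGFFT

variable {T : ℝ}

/-! ### Analytic continuation -/

lemma isOpen_rightHalfPlane : IsOpen rightHalfPlane :=
  isOpen_lt continuous_const Complex.continuous_re

lemma ofReal_mem_rightHalfPlane {l : ℝ} (hl : 0 < l) : (l : ℂ) ∈ rightHalfPlane := by
  simpa [rightHalfPlane] using hl

instance neBot_feynmanFilter (q : ℝ) : (feynmanFilter q).NeBot := by
  rw [feynmanFilter, ← mem_closure_iff_nhdsWithin_neBot, rightHalfPlane, Complex.closure_setOfPred_lt_re]
  simp

instance isCountablyGenerated_feynmanFilter (q : ℝ) : (feynmanFilter q).IsCountablyGenerated := by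
  rw [feynmanFilter]
  infer_instance

lemma eventually_mem_rightHalfPlane (q : ℝ) : ∀ᶠ l in feynmanFilter q, l ∈ rightHalfPlane :=
  self_mem_nhdsWithin

section Laplace

variable {E : Type*} {mE : MeasurableSpace E}

lemma norm_cexp_neg_mul_le_one {b : ℝ} (hb : 0 ≤ b) {z : ℂ} (hz : 0 ≤ z.re) :
    ‖Complex.exp (-(b : ℂ) * z)‖ ≤ 1 := by
  rw [Complex.norm_exp, Real.exp_le_one_iff]
  simp only [neg_mul, Complex.neg_re, Complex.re_ofReal_mul]
  have := mul_nonneg hb hz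
  linarith

lemma re_inv_two_mul_nonneg {l : ℂ} (hl : 0 ≤ l.re) : 0 ≤ ((2 * l)⁻¹).re := by
  rw [Complex.inv_re]
  refine div_nonneg ?_ (Complex.normSq_nonneg _)
  simpa using hl

lemma re_inv_two_mul_pos {l : ℂ} (hl : l ∈ rightHalfPlane) : 0 < ((2 * l)⁻¹).re := by
  have hl' : 0 < l.re := hl
  rw [Complex.inv_re]
  refine div_pos ?_ (Complex.normSq_pos.2 ?_)
  · simpa using hl'
  · intro h
    have : l = 0 := by simpa using h
    rw [this] at hl'
    simp at hl'

variable {μ : Measure E} [IsFiniteMeasure μ] {w : E → ℂ} {b : E → ℝ}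

/-- No moment of b is needed: where Re z' > r = Re z / 2 > 0, the derivative of the integrand is
bounded by b e^{-br} ≤ 1/r. -/
lemma hasDerivAt_integral_mul_cexp_neg_mul (hw : Measurable w) (hw1 : ∀ e, ‖w e‖ ≤ 1)
    (hb : Measurable b) (hb0 : ∀ e, 0 ≤ b e) {z : ℂ} (hz : 0 < z.re) :
    HasDerivAt (fun z => ∫ e, w e * Complex.exp (-(b e : ℂ) * z) ∂μ)
      (∫ e, w e * (Complex.exp (-(b e : ℂ) * z) * (-(b e : ℂ))) ∂μ) z := by
  have hbm : Measurable fun e => -(b e : ℂ) := (Complex.measurable_ofReal.comp hb).neg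
  have hexp : ∀ z : ℂ, Measurable fun e => Complex.exp (-(b e : ℂ) * z) := fun z =>
    Complex.measurable_exp.comp (hbm.mul_const z)
  have hs : {z' : ℂ | z.re / 2 < z'.re} ∈ 𝓝 z :=
    (isOpen_lt continuous_const Complex.continuous_re).mem_nhds (by simpa using hz)
  refine (hasDerivAt_integral_of_dominated_loc_of_deriv_le 
    (F := fun z e => w e * Complex.exp (-(b e : ℂ) * z))
    (F' := fun z e => w e * (Complex.exp (-(b e : ℂ) * z) * (-(b e : ℂ))))
    (bound := fun _ => (z.re / 2)⁻¹) hs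
    (Eventually.of_forall fun z => (hw.mul (hexp z)).aestronglyMeasurable) ?_
    (hw.mul ((hexp z).mul hbm)).aestronglyMeasurable
    (Eventually.of_forall fun e z' hz' => ?_) (integrable_const _)
    (Eventually.of_forall fun e z' _ => ?_)).2
  · refine Integrable.of_bound (hw.mul (hexp z)).aestronglyMeasurable 1
      (Eventually.of_forall fun e => ?_)
    rw [norm_mul]
    exact mul_le_one₀ (hw1 e) (norm_nonneg _) (norm_cexp_neg_mul_le_one (hb0 e) hz.le)
  · have hz'' : z.re / 2 < z'.re := hz'
    have h0 : 0 < z.re / 2 := by linarith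
    rw [norm_mul, norm_mul, norm_neg, Complex.norm_real, Real.norm_eq_abs, abs_of_nonneg (hb0 e),
      Complex.norm_exp, neg_mul, Complex.neg_re, Complex.re_ofReal_mul]
    have h1 : Real.exp (-(b e * z'.re)) ≤ Real.exp (-(b e * (z.re / 2))) :=
      Real.exp_le_exp.2 (neg_le_neg (mul_le_mul_of_nonneg_left hz''.le (hb0 e)))
    have h2 : Real.exp (-(b e * (z.re / 2))) * (b e * (z.re / 2)) ≤ 1 := by
      rw [Real.exp_neg, inv_mul_le_iff₀ (Real.exp_pos _), mul_one]
      have := Real.add_one_le_exp (b e * (z.re / 2))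
      linarith
    calc ‖w e‖ * (Real.exp (-(b e * z'.re)) * b e)
        ≤ 1 * (Real.exp (-(b e * (z.re / 2))) * b e) :=
          mul_le_mul (hw1 e) (mul_le_mul_of_nonneg_right h1 (hb0 e))
            (mul_nonneg (Real.exp_pos _).le (hb0 e)) zero_le_one
      _ ≤ (z.re / 2)⁻¹ := by
        rw [one_mul, ← one_div, le_div_iff₀ h0, mul_assoc]
        exact h2
  · have h1 : HasDerivAt (fun z : ℂ => -(b e : ℂ) * z) (-(b e : ℂ)) z' := by
      simpa using (hasDerivAt_id z').const_mul (-(b e : ℂ))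
    exact (h1.cexp).const_mul (w e)

lemma differentiableOn_integral_mul_cexp (hw : Measurable w) (hw1 : ∀ e, ‖w e‖ ≤ 1)
    (hb : Measurable b) (hb0 : ∀ e, 0 ≤ b e) :
    DifferentiableOn ℂ (fun l => ∫ e, w e * Complex.exp (-(b e : ℂ) * (2 * l)⁻¹) ∂μ)
      rightHalfPlane := by
  intro l hl
  have h1 := (hasDerivAt_integral_mul_cexp_neg_mul (μ := μ) hw hw1 hb hb0
    (re_inv_two_mul_pos hl)).differentiableAt
  have hl0 : (2 : ℂ) * l ≠ 0 := fun h => by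
    have := re_inv_two_mul_pos hl
    simp [h] at this
  have h2 : DifferentiableAt ℂ (fun l : ℂ => (2 * l)⁻¹) l :=
    (differentiableAt_id.const_mul (2 : ℂ)).inv hl0
  exact (h1.comp l h2).differentiableWithinAt

lemma norm_integral_mul_cexp_le (hw1 : ∀ e, ‖w e‖ ≤ 1) (hb0 : ∀ e, 0 ≤ b e) {l : ℂ}
    (hl : 0 ≤ l.re) :
    ‖∫ e, w e * Complex.exp (-(b e : ℂ) * (2 * l)⁻¹) ∂μ‖ ≤ μ.real univ := by
  have := norm_integral_le_of_norm_le_const (μ := μ) (C := 1)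
    (f := fun e => w e * Complex.exp (-(b e : ℂ) * (2 * l)⁻¹)) (Eventually.of_forall fun e => by
      rw [norm_mul]
      exact mul_le_one₀ (hw1 e) (norm_nonneg _)
        (norm_cexp_neg_mul_le_one (hb0 e) (re_inv_two_mul_nonneg hl)))
  simpa using this

lemma tendsto_integral_mul_cexp (hw : Measurable w) (hw1 : ∀ e, ‖w e‖ ≤ 1)
    (hb : Measurable b) (hb0 : ∀ e, 0 ≤ b e) {q : ℝ} (hq : q ≠ 0) :
    Tendsto (fun l => ∫ e, w e * Complex.exp (-(b e : ℂ) * (2 * l)⁻¹) ∂μ) (feynmanFilter q)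
      (𝓝 (∫ e, w e * Complex.exp (-(b e : ℂ) * (2 * (-Complex.I * q))⁻¹) ∂μ)) := by
  have hbm : Measurable fun e => -(b e : ℂ) := (Complex.measurable_ofReal.comp hb).neg
  refine tendsto_integral_filter_of_dominated_convergence (fun _ => 1)
    (Eventually.of_forall fun l => (hw.mul
      (Complex.measurable_exp.comp (hbm.mul_const _))).aestronglyMeasurable) ?_
    (integrable_const _) (Eventually.of_forall fun e => ?_)
  · filter_upwards [eventually_mem_rightHalfPlane q] with l hl
    refine Eventually.of_forall fun e => ?_
    rw [norm_mul]
    exact mul_le_one₀ (hw1 e) (norm_nonneg _)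
      (norm_cexp_neg_mul_le_one (hb0 e) (re_inv_two_mul_pos hl).le)
  · have h0 : (2 : ℂ) * (-Complex.I * q) ≠ 0 := by simp [hq]
    have h1 : ContinuousAt (fun l : ℂ => w e * Complex.exp (-(b e : ℂ) * (2 * l)⁻¹))
        (-Complex.I * q) :=
      continuousAt_const.mul ((continuousAt_const.mul
        ((continuousAt_const.mul continuousAt_id).inv₀ h0)).cexp)
    exact h1.tendsto.mono_left nhdsWithin_le_nhds

end Laplace

/-- Both functions are prescribed on the positive reals, which accumulate at 1, and the half-plane
is connected. -/
lemma IsAnalyticWienerIntegral.eqOn {m : Measure (C0 T)} {V : Type*} [AddCommGroup V] [Module ℝ V]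
    {Ψ : V → ℂ} {Z : C0 T → V} {J J' : ℂ → ℂ} (hJ : IsAnalyticWienerIntegral m Ψ Z J)
    (hJ' : IsAnalyticWienerIntegral m Ψ Z J') : EqOn J J' rightHalfPlane := by
  have hpre : IsPreconnected rightHalfPlane := (convex_halfSpace_re_gt 0).isPreconnected
  refine AnalyticOnNhd.eqOn_of_preconnected_of_frequently_eq
    (hJ.2.analyticOnNhd isOpen_rightHalfPlane) (hJ'.2.analyticOnNhd isOpen_rightHalfPlane) hpre
    (z₀ := ((1 : ℝ) : ℂ)) (ofReal_mem_rightHalfPlane one_pos) ?_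
  have ht : Tendsto (fun r : ℝ => (r : ℂ)) (𝓝[≠] 1) (𝓝[≠] ((1 : ℝ) : ℂ)) := by
    refine tendsto_nhdsWithin_iff.2 ⟨(Complex.continuous_ofReal.tendsto 1).mono_left
      nhdsWithin_le_nhds, ?_⟩
    filter_upwards [self_mem_nhdsWithin] with r hr
    simpa using hr
  refine ht.frequently (Eventually.frequently ?_)
  filter_upwards [nhdsWithin_le_nhds (lt_mem_nhds (zero_lt_one' ℝ))] with l hl
  rw [← (hJ.1 l hl).2, ← (hJ'.1 l hl).2]

/-! ### Analytic integrals and transforms of superpositions of exponentials -/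

section Wiener

variable {φ : ℕ → ℝ → ℝ} {m : Measure (C0 T)} (hT : 0 < T) (hφ : IsPWZBasis T φ)
  (hm : IsWienerMeasure T m) {E : Type*} {mE : MeasurableSpace E} {μ : Measure E}
  [IsFiniteMeasure μ]
include hT hφ hm

/-- The analytic Wiener integral of a functional that is a superposition of exponentials of
Paley–Wiener–Zygmund integrals. -/
lemma isAnalyticWienerIntegral_of_ae_eq {w : E → ℂ} (hw : Measurable w) (hw1 : ∀ e, ‖w e‖ ≤ 1)
    {B : E → L2 T} (hB : Measurable B) {V : Type*} [AddCommGroup V] [Module ℝ V] {Ψ : V → ℂ}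
    {Z : C0 T → V}
    (hΨ : ∀ c : ℝ, 0 < c → ∀ᵐ x ∂m, Ψ (c • Z x) =
      ∫ e, w e * Complex.exp (Complex.I * ((c * pwz φ (B e : ℝ → ℝ) x : ℝ) : ℂ)) ∂μ) :
    IsAnalyticWienerIntegral m Ψ Z fun l =>
      ∫ e, w e * Complex.exp (-((‖B e‖ ^ 2 : ℝ) : ℂ) * (2 * l)⁻¹) ∂μ := by
  have := hm.isProbabilityMeasure
  refine ⟨fun l hl => ?_, differentiableOn_integral_mul_cexp hw hw1
    (hB.norm.pow_const 2) (fun e => sq_nonneg _)⟩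
  have hc : 0 < (Real.sqrt l)⁻¹ := inv_pos.2 (Real.sqrt_pos.2 hl)
  obtain ⟨g, hg⟩ : ∃ g : E × C0 T → ℂ, ∀ p, g p = w p.1 *
      Complex.exp (Complex.I * (((Real.sqrt l)⁻¹ * pwz φ (B p.1 : ℝ → ℝ) p.2 : ℝ) : ℂ)) :=
    ⟨_, fun _ => rfl⟩
  have hgm : Measurable g := by
    rw [funext hg]
    have h1 : Measurable fun p : E × C0 T => (B p.1, p.2) :=
      (hB.comp measurable_fst).prodMk measurable_snd
    have h2 := (measurable_pwz hT hφ).comp h1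
    have h3 : Measurable fun p : E × C0 T => pwz φ (B p.1 : ℝ → ℝ) p.2 := h2
    exact (hw.comp measurable_fst).mul (Complex.measurable_exp.comp
      ((Complex.measurable_ofReal.comp (h3.const_mul _)).const_mul _))
  have hgi : Integrable g (μ.prod m) := by
    refine Integrable.of_bound hgm.aestronglyMeasurable 1 (Eventually.of_forall fun p => ?_)
    rw [hg, norm_mul, norm_cexp_I_mul, mul_one]
    exact hw1 _
  have h1 : (fun x => Ψ ((Real.sqrt l)⁻¹ • Z x)) =ᵐ[m] fun x => ∫ e, g (e, x) ∂μ := by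
    filter_upwards [hΨ _ hc] with x hx
    rw [hx]
    simp only [hg]
  have h0 : Integrable (fun x => ∫ e, g (e, x) ∂μ) m := hgi.integral_prod_right
  refine ⟨h0.congr h1.symm, ?_⟩
  have h2 := integral_integral_swap (μ := μ) (ν := m) (f := fun e x => g (e, x)) hgi
  rw [integral_congr_ae h1, ← h2]
  refine integral_congr_ae (Eventually.of_forall fun e => ?_)
  simp only [hg]
  rw [integral_const_mul, integral_cexp_mul_pwz hT hφ hm]
  congr 2
  rw [inv_pow, Real.sq_sqrt hl.le]
  push_cast
  field_simp

/-- One formula serves every p. For Re λ ≥ 0 the candidate is bounded by the mass of μ, so its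
pointwise limit settles p = 1 and, by dominated convergence, also gives convergence in the mean of
order p' at each scale. -/
lemma isGFFT_of_sae_eq {w : E → ℂ} (hw : Measurable w) (hw1 : ∀ e, ‖w e‖ ≤ 1)
    {α : C0 T × E → ℝ} (hα : Measurable α) {B : E → L2 T} (hB : Measurable B)
    {F : C0 T → ℂ} {h : ℝ → ℝ} {p q : ℝ} (hq : q ≠ 0)
    (hF0 : SAE m fun y => F y = ∫ e, w e * Complex.exp (Complex.I * (α (y, e) : ℂ)) ∂μ)
    (hF : SAE m fun y => ∀ c : ℝ, 0 < c → ∀ᵐ x ∂m, F (y + c • gaussProc φ h x) =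
      ∫ e, (w e * Complex.exp (Complex.I * (α (y, e) : ℂ))) *
        Complex.exp (Complex.I * ((c * pwz φ (B e : ℝ → ℝ) x : ℝ) : ℂ)) ∂μ) :
    IsGFFT m φ p q h F fun y => ∫ e, (w e * Complex.exp (Complex.I * (α (y, e) : ℂ))) *
      Complex.exp (-((‖B e‖ ^ 2 : ℝ) : ℂ) * (2 * (-Complex.I * q))⁻¹) ∂μ := by
  have := hm.isProbabilityMeasure
  have hαm : Measurable fun z : C0 T × E => w z.2 * Complex.exp (Complex.I * (α z : ℂ)) :=
    (hw.comp measurable_snd).mul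
      (Complex.measurable_exp.comp ((Complex.measurable_ofReal.comp hα).const_mul _))
  have hwy : ∀ y, Measurable fun e => w e * Complex.exp (Complex.I * (α (y, e) : ℂ)) := fun y =>
    hαm.comp measurable_prodMk_left
  have hwy1 : ∀ y e, ‖w e * Complex.exp (Complex.I * (α (y, e) : ℂ))‖ ≤ 1 := fun y e => by
    rw [norm_mul, norm_cexp_I_mul, mul_one]
    exact hw1 e
  have hBm : Measurable fun e => ‖B e‖ ^ 2 := hB.norm.pow_const 2
  have hB0 : ∀ e, 0 ≤ ‖B e‖ ^ 2 := fun e => sq_nonneg _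
  obtain ⟨J, hJ⟩ : ∃ J : C0 T → ℂ → ℂ, ∀ y l, J y l =
      ∫ e, (w e * Complex.exp (Complex.I * (α (y, e) : ℂ))) *
        Complex.exp (-((‖B e‖ ^ 2 : ℝ) : ℂ) * (2 * l)⁻¹) ∂μ := ⟨_, fun _ _ => rfl⟩
  have hsm : ∀ ρ : ℝ, Measurable fun y : C0 T => ρ • y := fun ρ =>
    (continuous_const_smul ρ).measurable
  have hJm : ∀ l, Measurable fun y => J y l := fun l => by
    simp only [hJ]
    have h1 : Measurable fun z : C0 T × E =>
        (w z.2 * Complex.exp (Complex.I * (α z : ℂ))) *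
          Complex.exp (-((‖B z.2‖ ^ 2 : ℝ) : ℂ) * (2 * l)⁻¹) :=
      hαm.mul (Complex.measurable_exp.comp
        (((Complex.measurable_ofReal.comp hBm).neg.mul_const _).comp measurable_snd))
    exact (h1.stronglyMeasurable.integral_prod_right (ν := μ)).measurable
  have hJs : ∀ l, ScaleInvMeasurable m fun y => J y l := fun l ρ _ =>
    ((hJm l).comp (hsm ρ)).aemeasurable
  have hJt : ∀ y, Tendsto (J y) (feynmanFilter q) (𝓝 (J y (-Complex.I * q))) := fun y => by
    rw [funext (hJ y)]
    exact tendsto_integral_mul_cexp (hwy y) (hwy1 y) hBm hB0 hq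
  have hJb : ∀ y {l : ℂ}, 0 ≤ l.re → ‖J y l‖ ≤ μ.real univ := fun y l hl => by
    rw [hJ]
    exact norm_integral_mul_cexp_le (hwy1 y) hB0 hl
  have hre : 0 ≤ (-Complex.I * (q : ℂ)).re := by simp
  simp only [← hJ]
  refine ⟨fun ρ hρ => ?_, J, fun ρ hρ => ?_, fun _ ρ _ => Eventually.of_forall fun y => hJt _,
    fun hp => ⟨hJs _, fun l _ => hJs l, fun ρ hρ => ?_⟩⟩
  · have h1 : Measurable fun y => ∫ e, w e * Complex.exp (Complex.I * (α (y, e) : ℂ)) ∂μ :=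
      (hαm.stronglyMeasurable.integral_prod_right (ν := μ)).measurable
    exact (h1.comp (hsm ρ)).aemeasurable.congr ((hF0 ρ hρ).mono fun y hy => hy.symm)
  · filter_upwards [hF ρ hρ] with y hy
    rw [funext (hJ (ρ • y))]
    exact isAnalyticWienerIntegral_of_ae_eq hT hφ hm (hwy _) (hwy1 _) hB hy
  · have hr : 0 < p / (p - 1) := div_pos (by linarith) (by linarith)
    have h0 : (0 : ENNReal) = ∫⁻ _ : C0 T, 0 ∂m := by simp
    rw [h0]
    refine tendsto_lintegral_filter_of_dominated_convergence
      (fun _ => ENNReal.ofReal (2 * μ.real univ) ^ (p / (p - 1))) ?_ ?_ ?_ ?_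
    · exact Eventually.of_forall fun l => ((((hJm l).comp (hsm ρ)).sub
        ((hJm _).comp (hsm ρ))).enorm.pow_const _)
    · filter_upwards [eventually_mem_rightHalfPlane q] with l hl
      refine Eventually.of_forall fun y => ENNReal.rpow_le_rpow ?_ hr.le
      rw [← ofReal_norm]
      refine ENNReal.ofReal_le_ofReal ((norm_sub_le _ _).trans ?_)
      have h1 := hJb (ρ • y) (le_of_lt (show 0 < l.re from hl))
      have h2 := hJb (ρ • y) hre
      linarith
    · rw [lintegral_const]
      exact ENNReal.mul_ne_top (ENNReal.rpow_ne_top_of_nonneg hr.le ENNReal.ofReal_ne_top)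
        (measure_ne_top _ _)
    · refine Eventually.of_forall fun y => ?_
      have h1 : Tendsto (fun l => ‖J (ρ • y) l - J (ρ • y) (-Complex.I * q)‖ₑ)
          (feynmanFilter q) (𝓝 0) := by
        have := ((hJt (ρ • y)).sub_const (J (ρ • y) (-Complex.I * q))).enorm
        simpa using this
      have h2 := h1.ennrpow_const (p / (p - 1))
      rwa [ENNReal.zero_rpow_of_pos hr] at h2

end Wiener

/-- The transform is unique up to scale-invariant almost everywhere equality. -/
lemma IsGFFT.sae_eq {m : Measure (C0 T)} {φ : ℕ → ℝ → ℝ} {p q : ℝ} (hp : 1 ≤ p) {h : ℝ → ℝ}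
    {F H H' : C0 T → ℂ} (hH : IsGFFT m φ p q h F H) (hH' : IsGFFT m φ p q h F H') :
    SAE m fun y => H y = H' y := by
  obtain ⟨_, J, hJ, hJ1, hJp⟩ := hH
  obtain ⟨_, J', hJ', hJ1', hJp'⟩ := hH'
  intro ρ hρ
  have heq : ∀ᵐ y ∂m, EqOn (J (ρ • y)) (J' (ρ • y)) rightHalfPlane := by
    filter_upwards [hJ ρ hρ, hJ' ρ hρ] with y h1 h2 using h1.eqOn h2
  rcases hp.eq_or_lt with rfl | hp
  · filter_upwards [heq, hJ1 rfl ρ hρ, hJ1' rfl ρ hρ] with y h0 h1 h2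
    refine tendsto_nhds_unique h1 (h2.congr' ?_)
    filter_upwards [eventually_mem_rightHalfPlane q] with l hl using (h0 hl).symm
  · obtain ⟨hHm, hJm, hlim⟩ := hJp hp
    obtain ⟨hHm', hJm', hlim'⟩ := hJp' hp
    have hr : 1 ≤ p / (p - 1) := by
      rw [le_div_iff₀ (by linarith)]
      linarith
    -- At a common λ the two families coincide, so H - H' is a difference of two approximation
    -- errors; convexity of the power p' separates them.
    have hle : ∀ l ∈ rightHalfPlane, ∫⁻ y, ‖H (ρ • y) - H' (ρ • y)‖ₑ ^ (p / (p - 1)) ∂m ≤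
        2 ^ (p / (p - 1) - 1) * (∫⁻ y, ‖J (ρ • y) l - H (ρ • y)‖ₑ ^ (p / (p - 1)) ∂m +
          ∫⁻ y, ‖J' (ρ • y) l - H' (ρ • y)‖ₑ ^ (p / (p - 1)) ∂m) := fun l hl => by
      have hmeas : AEMeasurable (fun y => ‖J (ρ • y) l - H (ρ • y)‖ₑ ^ (p / (p - 1))) m :=
        ((hJm l hl ρ hρ).sub (hHm ρ hρ)).enorm.pow_const _
      rw [← lintegral_add_left' hmeas,
        ← lintegral_const_mul' _ _ (ENNReal.rpow_ne_top_of_nonneg (by linarith) (by simp))]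
      refine lintegral_mono_ae ?_
      filter_upwards [heq] with y hy
      refine le_trans ?_ (ENNReal.rpow_add_le_mul_rpow_add_rpow _ _ hr)
      refine ENNReal.rpow_le_rpow ?_ (by linarith)
      have : H (ρ • y) - H' (ρ • y) =
          (J' (ρ • y) l - H' (ρ • y)) - (J (ρ • y) l - H (ρ • y)) := by
        rw [hy hl]
        ring
      rw [this, add_comm]
      exact enorm_sub_le
    have h0 : ∫⁻ y, ‖H (ρ • y) - H' (ρ • y)‖ₑ ^ (p / (p - 1)) ∂m = 0 := by
      have h1 := ENNReal.Tendsto.const_mul (a := 2 ^ (p / (p - 1) - 1))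
        ((hlim ρ hρ).add (hlim' ρ hρ))
        (Or.inr (ENNReal.rpow_ne_top_of_nonneg (by linarith) (by simp)))
      rw [add_zero, mul_zero] at h1
      refine le_antisymm (ge_of_tendsto h1 ?_) zero_le
      filter_upwards [eventually_mem_rightHalfPlane q] with l hl using hle l hl
    have hmeas : AEMeasurable (fun y => ‖H (ρ • y) - H' (ρ • y)‖ₑ ^ (p / (p - 1))) m :=
      ((hHm ρ hρ).sub (hHm' ρ hρ)).enorm.pow_const _
    rw [lintegral_eq_zero_iff' hmeas] at h0
    filter_upwards [h0] with y hy
    rw [Pi.zero_apply, ENNReal.rpow_eq_zero_iff_of_pos (by linarith), enorm_eq_zero] at hy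
    exact sub_eq_zero.1 hy

end FresnelGFFT
end


noncomputable section

namespace FresnelGFFT

variable {T : ℝ}

/-! ### Transforms and convolution products of Fresnel-type functionals -/

/-- `F(x) = ∫ w(u) exp{i⟨u,x⟩} dν(u)` wherever the integrand makes sense. -/
def IsExpIntegral (φ : ℕ → ℝ → ℝ) (ν : Measure (L2 T)) (w : L2 T → ℂ) (F : C0 T → ℂ) : Prop :=
  ∀ x : C0 T, (∀ᵐ (u : L2 T) ∂ν, HasPWZ φ (u : ℝ → ℝ) x (pwz φ (u : ℝ → ℝ) x)) →
    F x = ∫ u : L2 T, w u * Complex.exp (Complex.I * ((pwz φ (u : ℝ → ℝ) x : ℝ) : ℂ)) ∂ν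

lemma IsExpIntegral.eq_integral {φ : ℕ → ℝ → ℝ} {ν : Measure (L2 T)} {w : L2 T → ℂ}
    {F : C0 T → ℂ} (hF : IsExpIntegral φ ν w F) {x : C0 T} {β : L2 T → ℝ}
    (hx : ∀ᵐ (u : L2 T) ∂ν, HasPWZ φ (u : ℝ → ℝ) x (β u)) :
    F x = ∫ u : L2 T, w u * Complex.exp (Complex.I * (β u : ℂ)) ∂ν := by
  rw [hF x (hx.mono fun u hu => hu.hasPWZ_pwz)]
  exact integral_congr_ae (hx.mono fun u hu => by simp only [hu.pwz_eq])

/-- At λ = -iq the exponent is purely imaginary, so the transform keeps densities unimodular and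
stays in the class. -/
lemma norm_cexp_neg_mul_inv_I (b q : ℝ) :
    ‖Complex.exp (-(b : ℂ) * (2 * (-Complex.I * q))⁻¹)‖ = 1 := by
  have : -(b : ℂ) * (2 * (-Complex.I * q))⁻¹ = Complex.I * ((-(b / (2 * q)) : ℝ) : ℂ) := by
    push_cast
    rw [mul_inv, mul_inv, inv_neg, Complex.inv_I]
    ring
  rw [this, norm_cexp_I_mul]

section Wiener

variable {φ : ℕ → ℝ → ℝ} {m : Measure (C0 T)} (hT : 0 < T) (hφ : IsPWZBasis T φ)
  (hm : IsWienerMeasure T m)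
include hT hφ

lemma measurable_pwz_comp {E : Type*} [MeasurableSpace E] {B : E → L2 T} (hB : Measurable B) :
    Measurable fun z : C0 T × E => pwz φ (B z.2 : ℝ → ℝ) z.1 := by
  have h1 : Measurable fun z : C0 T × E => (B z.2, z.1) :=
    (hB.comp measurable_snd).prodMk measurable_fst
  have h2 := (measurable_pwz hT hφ).comp h1
  exact h2

include hm

lemma IsExpIntegral.isGFFT {ν : Measure (L2 T)} [IsFiniteMeasure ν] {w : L2 T → ℂ}
    (hw : Measurable w) (hw1 : ∀ u, ‖w u‖ = 1) {F : C0 T → ℂ} (hF : IsExpIntegral φ ν w F)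
    {h : ℝ → ℝ} (hh : MemLp h ⊤ (leb T)) (p : ℝ) {q : ℝ} (hq : q ≠ 0) :
    IsGFFT m φ p q h F fun y => ∫ u : L2 T,
      (w u * Complex.exp (-((‖mulL2 hh u‖ ^ 2 : ℝ) : ℂ) * (2 * (-Complex.I * q))⁻¹)) *
        Complex.exp (Complex.I * ((pwz φ (u : ℝ → ℝ) y : ℝ) : ℂ)) ∂ν := by
  have hα : Measurable fun z : C0 T × L2 T => pwz φ (z.2 : ℝ → ℝ) z.1 :=
    measurable_pwz_comp hT hφ (B := fun u : L2 T => u) measurable_id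
  have key := isGFFT_of_sae_eq hT hφ hm (μ := ν) hw (fun u => (hw1 u).le)
    (α := fun z : C0 T × L2 T => pwz φ (z.2 : ℝ → ℝ) z.1) hα (measurable_mulL2 hh)
    (F := F) (h := h) (p := p) hq ?_ ?_
  · simp only [mul_right_comm (w _)]
    exact key
  · intro ρ hρ
    filter_upwards [sae_ae_hasPWZ hT hφ hm ν ρ hρ] with y hy
    exact hF.eq_integral hy
  · intro ρ hρ
    filter_upwards [sae_ae_hasPWZ hT hφ hm ν ρ hρ] with y hy c hc
    filter_upwards [ae_ae_hasPWZ_gaussProc hT hφ hm hh ν] with x hx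
    have h1 : ∀ᵐ (u : L2 T) ∂ν, HasPWZ φ (u : ℝ → ℝ) (ρ • y + c • gaussProc φ h x)
        (pwz φ (u : ℝ → ℝ) (ρ • y) + c * pwz φ (mulL2 hh u : ℝ → ℝ) x) := by
      filter_upwards [hy, hx] with u hu hu'
      exact HasPWZ.add_path hT hφ hu (HasPWZ.smul_path hT hφ c hu')
    rw [hF.eq_integral h1]
    refine integral_congr_ae (Eventually.of_forall fun u => ?_)
    simp only
    rw [Complex.ofReal_add, mul_add, Complex.exp_add, mul_assoc]

/-! ### Products of two Fresnel-type functionals -/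

section Pair

variable {ν₁ ν₂ : Measure (L2 T)} [IsFiniteMeasure ν₁] [IsFiniteMeasure ν₂] {w₁ w₂ : L2 T → ℂ}
  {F G : C0 T → ℂ} (hF : IsExpIntegral φ ν₁ w₁ F) (hG : IsExpIntegral φ ν₂ w₂ G)
  {k₁ k₂ : ℝ → ℝ} (hk₁ : MemLp k₁ ⊤ (leb T)) (hk₂ : MemLp k₂ ⊤ (leb T))
include hF hG

omit hT hφ hm in
lemma IsExpIntegral.mul_eq_integral {x x' : C0 T} {β β' : L2 T → ℝ}
    (hx : ∀ᵐ (u : L2 T) ∂ν₁, HasPWZ φ (u : ℝ → ℝ) x (β u))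
    (hx' : ∀ᵐ (u : L2 T) ∂ν₂, HasPWZ φ (u : ℝ → ℝ) x' (β' u)) :
    F x * G x' = ∫ e, (w₁ e.1 * w₂ e.2) * Complex.exp (Complex.I * ((β e.1 + β' e.2 : ℝ) : ℂ))
      ∂(ν₁.prod ν₂) := by
  rw [hF.eq_integral hx, hG.eq_integral hx', ← integral_prod_mul]
  refine integral_congr_ae (Eventually.of_forall fun e => ?_)
  simp only
  rw [Complex.ofReal_add, mul_add, Complex.exp_add]
  ring

/-- The values of `F((y + c𝒵_{k₁})/√2) G((y + εc𝒵_{k₂})/√2)` along the Gaussian processes. -/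
lemma IsExpIntegral.ae_mul_eq_integral (ε : ℝ) {y : C0 T}
    (hy : ∀ᵐ (u : L2 T) ∂ν₁, HasPWZ φ (u : ℝ → ℝ) y (pwz φ (u : ℝ → ℝ) y))
    (hy' : ∀ᵐ (u : L2 T) ∂ν₂, HasPWZ φ (u : ℝ → ℝ) y (pwz φ (u : ℝ → ℝ) y)) (c : ℝ) :
    ∀ᵐ x ∂m, F ((Real.sqrt 2)⁻¹ • (y + c • gaussProc φ k₁ x)) *
        G ((Real.sqrt 2)⁻¹ • (y + ε • c • gaussProc φ k₂ x)) =
      ∫ e : L2 T × L2 T, ((w₁ e.1 * w₂ e.2) * Complex.exp (Complex.I * (((Real.sqrt 2)⁻¹ *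
          (pwz φ (e.1 : ℝ → ℝ) y + pwz φ (e.2 : ℝ → ℝ) y) : ℝ) : ℂ))) *
        Complex.exp (Complex.I * ((c * pwz φ (((Real.sqrt 2)⁻¹ •
          (mulL2 hk₁ e.1 + ε • mulL2 hk₂ e.2) : L2 T) : ℝ → ℝ) x : ℝ) : ℂ)) ∂(ν₁.prod ν₂) := by
  -- Existence of ⟨k₁u, x⟩ for ν₁-almost every u comes from the push-forward of ν₁. It is needed
  -- because ⟨·, x⟩ is additive only where its terms exist.
  have hmap₁ : ∀ᵐ x ∂m, ∀ᵐ (u : L2 T) ∂ν₁, HasPWZ φ (mulL2 hk₁ u : ℝ → ℝ) x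
      (pwz φ (mulL2 hk₁ u : ℝ → ℝ) x) := by
    filter_upwards [ae_ae_hasPWZ hT hφ hm (ν₁.map (mulL2 hk₁))] with x hx
    exact ae_of_ae_map (measurable_mulL2 hk₁).aemeasurable hx
  have hmap₂ : ∀ᵐ x ∂m, ∀ᵐ (u : L2 T) ∂ν₂, HasPWZ φ (mulL2 hk₂ u : ℝ → ℝ) x
      (pwz φ (mulL2 hk₂ u : ℝ → ℝ) x) := by
    filter_upwards [ae_ae_hasPWZ hT hφ hm (ν₂.map (mulL2 hk₂))] with x hx
    exact ae_of_ae_map (measurable_mulL2 hk₂).aemeasurable hx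
  filter_upwards [ae_ae_hasPWZ_gaussProc hT hφ hm hk₁ ν₁, ae_ae_hasPWZ_gaussProc hT hφ hm hk₂ ν₂,
    hmap₁, hmap₂] with x hx₁ hx₂ hz₁ hz₂
  have h1 : ∀ᵐ (u : L2 T) ∂ν₁, HasPWZ φ (u : ℝ → ℝ)
      ((Real.sqrt 2)⁻¹ • (y + c • gaussProc φ k₁ x))
      ((Real.sqrt 2)⁻¹ * (pwz φ (u : ℝ → ℝ) y + c * pwz φ (mulL2 hk₁ u : ℝ → ℝ) x)) := by
    filter_upwards [hy, hx₁] with u hu hu'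
    exact HasPWZ.smul_path hT hφ _ (HasPWZ.add_path hT hφ hu (HasPWZ.smul_path hT hφ c hu'))
  have h2 : ∀ᵐ (u : L2 T) ∂ν₂, HasPWZ φ (u : ℝ → ℝ)
      ((Real.sqrt 2)⁻¹ • (y + ε • c • gaussProc φ k₂ x))
      ((Real.sqrt 2)⁻¹ * (pwz φ (u : ℝ → ℝ) y + ε * (c * pwz φ (mulL2 hk₂ u : ℝ → ℝ) x))) := by
    filter_upwards [hy', hx₂] with u hu hu'
    exact HasPWZ.smul_path hT hφ _ (HasPWZ.add_path hT hφ hu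
      (HasPWZ.smul_path hT hφ ε (HasPWZ.smul_path hT hφ c hu')))
  rw [hF.mul_eq_integral hG h1 h2]
  refine integral_congr_ae ?_
  have h3 : ∀ᵐ e ∂(ν₁.prod ν₂), HasPWZ φ (mulL2 hk₁ e.1 : ℝ → ℝ) x
      (pwz φ (mulL2 hk₁ e.1 : ℝ → ℝ) x) := Measure.quasiMeasurePreserving_fst.ae hz₁
  have h4 : ∀ᵐ e ∂(ν₁.prod ν₂), HasPWZ φ (mulL2 hk₂ e.2 : ℝ → ℝ) x
      (pwz φ (mulL2 hk₂ e.2 : ℝ → ℝ) x) := Measure.quasiMeasurePreserving_snd.ae hz₂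
  filter_upwards [h3, h4] with e he₁ he₂
  rw [(HasPWZ.smul hT hφ (Real.sqrt 2)⁻¹
    (HasPWZ.add hT hφ he₁ (HasPWZ.smul hT hφ ε he₂))).pwz_eq, mul_assoc (w₁ e.1 * w₂ e.2), ← Complex.exp_add]
  congr 2
  push_cast
  ring

omit hT hφ hm hF hG in
lemma measurable_smul_mulL2_add (ε : ℝ) : Measurable fun e : L2 T × L2 T =>
    (Real.sqrt 2)⁻¹ • (mulL2 hk₁ e.1 + ε • mulL2 hk₂ e.2) := by
  have : Fact ((2 : ENNReal) ≠ ⊤) := ⟨by simp⟩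
  have h : Continuous fun e : L2 T × L2 T =>
      (Real.sqrt 2)⁻¹ • (mulL2 hk₁ e.1 + ε • mulL2 hk₂ e.2) := by fun_prop
  exact h.measurable

variable (hw₁ : Measurable w₁) (hw₂ : Measurable w₂) (hw₁1 : ∀ u, ‖w₁ u‖ = 1)
  (hw₂1 : ∀ u, ‖w₂ u‖ = 1)
include hw₁ hw₂ hw₁1 hw₂1

/-- The case ε = 1 with both kernels equal to h. -/
lemma IsExpIntegral.isGFFT_mul {h : ℝ → ℝ} (hh : MemLp h ⊤ (leb T)) (p : ℝ) {q : ℝ} (hq : q ≠ 0) :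
    IsGFFT m φ p q h (fun y => F ((Real.sqrt 2)⁻¹ • y) * G ((Real.sqrt 2)⁻¹ • y)) fun y =>
      ∫ e : L2 T × L2 T, ((w₁ e.1 * w₂ e.2) * Complex.exp (Complex.I * (((Real.sqrt 2)⁻¹ *
          (pwz φ (e.1 : ℝ → ℝ) y + pwz φ (e.2 : ℝ → ℝ) y) : ℝ) : ℂ))) *
        Complex.exp (-((‖(Real.sqrt 2)⁻¹ • (mulL2 hh e.1 + (1 : ℝ) • mulL2 hh e.2)‖ ^ 2 : ℝ) : ℂ) *
          (2 * (-Complex.I * q))⁻¹) ∂(ν₁.prod ν₂) := by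
  have hα : Measurable fun z : C0 T × (L2 T × L2 T) => (Real.sqrt 2)⁻¹ *
      (pwz φ (z.2.1 : ℝ → ℝ) z.1 + pwz φ (z.2.2 : ℝ → ℝ) z.1) :=
    ((measurable_pwz_comp hT hφ measurable_fst).add
      (measurable_pwz_comp hT hφ measurable_snd)).const_mul _
  refine isGFFT_of_sae_eq hT hφ hm (μ := ν₁.prod ν₂) (w := fun e => w₁ e.1 * w₂ e.2)
    ((hw₁.comp measurable_fst).mul (hw₂.comp measurable_snd))
    (fun e => by rw [norm_mul, hw₁1, hw₂1, one_mul]) hα (measurable_smul_mulL2_add hh hh 1) hq ?_ ?_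
  · intro ρ hρ
    filter_upwards [sae_ae_hasPWZ hT hφ hm ν₁ ρ hρ, sae_ae_hasPWZ hT hφ hm ν₂ ρ hρ] with y hy hy'
    rw [hF.mul_eq_integral hG
      (hy.mono fun u hu => HasPWZ.smul_path hT hφ (Real.sqrt 2)⁻¹ hu)
      (hy'.mono fun u hu => HasPWZ.smul_path hT hφ (Real.sqrt 2)⁻¹ hu)]
    simp only [mul_add]
  · intro ρ hρ
    filter_upwards [sae_ae_hasPWZ hT hφ hm ν₁ ρ hρ, sae_ae_hasPWZ hT hφ hm ν₂ ρ hρ]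
      with y hy hy' c hc
    filter_upwards [hF.ae_mul_eq_integral hT hφ hm hG hh hh 1 hy hy' c] with x hx
    rw [← hx, one_smul]

/-- The case ε = -1, at any single y where both representations make sense. In the theorem F and G
are replaced here by the two transforms. -/
lemma IsExpIntegral.hasGCP {q : ℝ} (hq : q ≠ 0) {y : C0 T}
    (hy : ∀ᵐ (u : L2 T) ∂ν₁, HasPWZ φ (u : ℝ → ℝ) y (pwz φ (u : ℝ → ℝ) y))
    (hy' : ∀ᵐ (u : L2 T) ∂ν₂, HasPWZ φ (u : ℝ → ℝ) y (pwz φ (u : ℝ → ℝ) y)) :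
    HasGCP m φ q k₁ k₂ F G y
      (∫ e : L2 T × L2 T, ((w₁ e.1 * w₂ e.2) * Complex.exp (Complex.I * (((Real.sqrt 2)⁻¹ *
          (pwz φ (e.1 : ℝ → ℝ) y + pwz φ (e.2 : ℝ → ℝ) y) : ℝ) : ℂ))) *
        Complex.exp (-((‖(Real.sqrt 2)⁻¹ • (mulL2 hk₁ e.1 + (-1 : ℝ) • mulL2 hk₂ e.2)‖ ^ 2 : ℝ) :
          ℂ) * (2 * (-Complex.I * q))⁻¹) ∂(ν₁.prod ν₂)) := by
  have hα : Measurable fun z : C0 T × (L2 T × L2 T) => (Real.sqrt 2)⁻¹ *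
      (pwz φ (z.2.1 : ℝ → ℝ) z.1 + pwz φ (z.2.2 : ℝ → ℝ) z.1) :=
    ((measurable_pwz_comp hT hφ measurable_fst).add
      (measurable_pwz_comp hT hφ measurable_snd)).const_mul _
  have hw : Measurable fun e : L2 T × L2 T => (w₁ e.1 * w₂ e.2) *
      Complex.exp (Complex.I * (((Real.sqrt 2)⁻¹ *
        (pwz φ (e.1 : ℝ → ℝ) y + pwz φ (e.2 : ℝ → ℝ) y) : ℝ) : ℂ)) :=
    ((hw₁.comp measurable_fst).mul (hw₂.comp measurable_snd)).mul
      (Complex.measurable_exp.comp ((Complex.measurable_ofReal.comp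
        (hα.comp measurable_prodMk_left)).const_mul _))
  have hw1 : ∀ e : L2 T × L2 T, ‖(w₁ e.1 * w₂ e.2) *
      Complex.exp (Complex.I * (((Real.sqrt 2)⁻¹ *
        (pwz φ (e.1 : ℝ → ℝ) y + pwz φ (e.2 : ℝ → ℝ) y) : ℝ) : ℂ))‖ ≤ 1 := fun e => by
    rw [norm_mul, norm_mul, hw₁1, hw₂1, norm_cexp_I_mul, one_mul, one_mul]
  have hB := measurable_smul_mulL2_add hk₁ hk₂ (-1)
  refine ⟨_, isAnalyticWienerIntegral_of_ae_eq hT hφ hm (μ := ν₁.prod ν₂) hw hw1 hB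
    fun c _ => ?_, tendsto_integral_mul_cexp hw hw1 (hB.norm.pow_const 2)
      (fun e => sq_nonneg _) hq⟩
  filter_upwards [hF.ae_mul_eq_integral hT hφ hm hG hk₁ hk₂ (-1) hy hy' c] with x hx
  have h1 : y + (-1 : ℝ) • c • gaussProc φ k₂ x = y - c • gaussProc φ k₂ x := by
    have h2 := neg_one_smul ℝ (c • gaussProc φ k₂ x)
    exact (congrArg (y + ·) h2).trans (sub_eq_add_neg _ _).symm
  rw [h1] at hx
  exact hx

end Pair

end Wiener

end FresnelGFFT
end


noncomputable section

namespace FresnelGFFT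

variable {T : ℝ}

/-! ### Comparison of the variances -/

/-- The relation s² = h² + k² makes s essentially bounded, so that multiplication by s/√2 is an
operator on L₂. -/
lemma memLp_top_div_sqrt_two {μ : Measure ℝ} {h k s : ℝ → ℝ} (hh : MemLp h ⊤ μ)
    (hk : MemLp k ⊤ μ) (hs : AEStronglyMeasurable s μ)
    (hsq : ∀ᵐ t ∂μ, s t ^ 2 = h t ^ 2 + k t ^ 2) :
    MemLp (fun t => s t / Real.sqrt 2) ⊤ μ := by
  obtain ⟨a, ha0, ha⟩ := exists_bound_of_memLp_top hh
  obtain ⟨b, hb0, hb⟩ := exists_bound_of_memLp_top hk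
  have h1 : MemLp s ⊤ μ := by
    refine memLp_top_of_bound hs (a + b) ?_
    filter_upwards [ha, hb, hsq] with t h1 h2 h3
    rw [Real.norm_eq_abs]
    refine abs_le_of_sq_le_sq ?_ (by positivity)
    have h4 := sq_le_sq' (abs_le.1 h1).1 (abs_le.1 h1).2
    have h5 := sq_le_sq' (abs_le.1 h2).1 (abs_le.1 h2).2
    nlinarith [mul_pos ha0 hb0]
  simpa only [div_eq_mul_inv] using h1.mul_const (Real.sqrt 2)⁻¹

lemma integrable_mul_sq {h : ℝ → ℝ} (hh : MemLp h ⊤ (leb T)) (u : L2 T) :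
    Integrable (fun t => h t ^ 2 * u t ^ 2) (leb T) := by
  refine ((Lp.memLp (mulL2 hh u)).integrable_sq).congr ?_
  filter_upwards [coeFn_mulL2 hh u] with t ht
  rw [ht, mul_pow]

lemma norm_sq_mulL2_div_sqrt_two {h k s : ℝ → ℝ} (hh : MemLp h ⊤ (leb T))
    (hk : MemLp k ⊤ (leb T)) (hs : MemLp (fun t => s t / Real.sqrt 2) ⊤ (leb T))
    (hsq : ∀ᵐ t ∂(leb T), s t ^ 2 = h t ^ 2 + k t ^ 2) (u : L2 T) :
    ‖mulL2 hs u‖ ^ 2 = (‖mulL2 hh u‖ ^ 2 + ‖mulL2 hk u‖ ^ 2) / 2 := by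
  rw [norm_sq_mulL2, norm_sq_mulL2, norm_sq_mulL2,
    ← integral_add (integrable_mul_sq hh u) (integrable_mul_sq hk u), ← integral_div]
  refine integral_congr_ae ?_
  filter_upwards [hsq] with t ht
  rw [div_pow, Real.sq_sqrt (by norm_num), ht]
  ring

/-- This is where h² = k₁k₂ enters: it matches the cross terms of ‖k₁u - k₂v‖² and ‖hu + hv‖². -/
lemma inner_mulL2_eq {h k₁ k₂ : ℝ → ℝ} (hh : MemLp h ⊤ (leb T)) (hk₁ : MemLp k₁ ⊤ (leb T))
    (hk₂ : MemLp k₂ ⊤ (leb T)) (hhk : ∀ᵐ t ∂(leb T), h t ^ 2 = k₁ t * k₂ t) (u v : L2 T) :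
    inner ℝ (mulL2 hk₁ u) (mulL2 hk₂ v) = inner ℝ (mulL2 hh u) (mulL2 hh v) := by
  rw [inner_L2_eq, inner_L2_eq]
  refine integral_congr_ae ?_
  filter_upwards [hhk, coeFn_mulL2 hk₁ u, coeFn_mulL2 hk₂ v, coeFn_mulL2 hh u, coeFn_mulL2 hh v]
    with t h0 h1 h2 h3 h4
  rw [h1, h2, h3, h4]
  linear_combination -(u t * v t) * h0

/-- The identity of variances behind the convolution theorem. -/
lemma norm_sq_add_norm_sq_sub {h k₁ k₂ s₁ s₂ : ℝ → ℝ} (hh : MemLp h ⊤ (leb T))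
    (hk₁ : MemLp k₁ ⊤ (leb T)) (hk₂ : MemLp k₂ ⊤ (leb T))
    (hs₁ : MemLp (fun t => s₁ t / Real.sqrt 2) ⊤ (leb T))
    (hs₂ : MemLp (fun t => s₂ t / Real.sqrt 2) ⊤ (leb T))
    (hhk : ∀ᵐ t ∂(leb T), h t ^ 2 = k₁ t * k₂ t)
    (hs₁h : ∀ᵐ t ∂(leb T), s₁ t ^ 2 = h t ^ 2 + k₁ t ^ 2)
    (hs₂h : ∀ᵐ t ∂(leb T), s₂ t ^ 2 = h t ^ 2 + k₂ t ^ 2) (u v : L2 T) :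
    ‖mulL2 hs₁ u‖ ^ 2 + ‖mulL2 hs₂ v‖ ^ 2 -
        ‖(Real.sqrt 2)⁻¹ • (mulL2 hk₁ u + (-1 : ℝ) • mulL2 hk₂ v)‖ ^ 2 =
      ‖(Real.sqrt 2)⁻¹ • (mulL2 hh u + (1 : ℝ) • mulL2 hh v)‖ ^ 2 := by
  rw [norm_sq_mulL2_div_sqrt_two hh hk₁ hs₁ hs₁h, norm_sq_mulL2_div_sqrt_two hh hk₂ hs₂ hs₂h,
    norm_smul, norm_smul, mul_pow, mul_pow, norm_add_sq_real, norm_add_sq_real, norm_smul,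
    norm_smul, inner_smul_right, inner_smul_right, inner_mulL2_eq hh hk₁ hk₂ hhk, norm_inv,
    Real.norm_of_nonneg (Real.sqrt_nonneg _), inv_pow, Real.sq_sqrt (by norm_num), norm_neg,
    norm_one]
  ring

/-! ### The transform of a functional of Fresnel type -/

section Transform

variable {φ : ℕ → ℝ → ℝ} {m : Measure (C0 T)} (hT : 0 < T) (hφ : IsPWZBasis T φ)
  (hm : IsWienerMeasure T m)

/-- The density of the representing measure of the transform. -/
def transformDensity (w : L2 T → ℂ) {h : ℝ → ℝ} (hh : MemLp h ⊤ (leb T)) (q : ℝ) (u : L2 T) : ℂ :=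
  w u * Complex.exp (-((‖mulL2 hh u‖ ^ 2 : ℝ) : ℂ) * (2 * (-Complex.I * q))⁻¹)

lemma measurable_transformDensity {w : L2 T → ℂ} (hw : Measurable w) {h : ℝ → ℝ}
    (hh : MemLp h ⊤ (leb T)) (q : ℝ) : Measurable (transformDensity w hh q) :=
  hw.mul (Complex.measurable_exp.comp ((Complex.measurable_ofReal.comp
    ((measurable_mulL2 hh).norm.pow_const 2)).neg.mul_const _))

lemma norm_transformDensity {w : L2 T → ℂ} (hw1 : ∀ u, ‖w u‖ = 1) {h : ℝ → ℝ}
    (hh : MemLp h ⊤ (leb T)) (q : ℝ) (u : L2 T) : ‖transformDensity w hh q u‖ = 1 := by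
  rw [transformDensity, norm_mul, hw1, norm_cexp_neg_mul_inv_I, one_mul]

include hT hφ hm

lemma IsExpIntegral.exists_memS_isGFFT {ν : Measure (L2 T)} [IsFiniteMeasure ν] {w : L2 T → ℂ}
    (hw : Measurable w) (hw1 : ∀ u, ‖w u‖ = 1) {F : C0 T → ℂ} (hF : IsExpIntegral φ ν w F)
    {h : ℝ → ℝ} (hh : MemLp h ⊤ (leb T)) (p : ℝ) {q : ℝ} (hq : q ≠ 0) :
    ∃ H : C0 T → ℂ, MemS φ H ∧ IsGFFT m φ p q h F H :=
  ⟨_, memS_integral hT hφ (measurable_transformDensity hw hh q) (norm_transformDensity hw1 hh q),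
    hF.isGFFT hT hφ hm hw hw1 hh p hq⟩

/-- A version of the transform is known only s-a.e., which says nothing along the shifted paths of
the convolution. Membership in the class upgrades agreement at scale 1 to agreement wherever ⟨u,x⟩
exists for ν-almost every u. -/
lemma IsExpIntegral.isExpIntegral_transform {ν : Measure (L2 T)} [IsFiniteMeasure ν]
    {w : L2 T → ℂ} (hw : Measurable w) (hw1 : ∀ u, ‖w u‖ = 1) {F H : C0 T → ℂ}
    (hF : IsExpIntegral φ ν w F) {h : ℝ → ℝ} (hh : MemLp h ⊤ (leb T)) {p : ℝ} (hp : 1 ≤ p) {q : ℝ}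
    (hq : q ≠ 0) (hH : MemS φ H) (hFH : IsGFFT m φ p q h F H) :
    IsExpIntegral φ ν (transformDensity w hh q) H := by
  have h1 := hFH.sae_eq hp (hF.isGFFT hT hφ hm hw hw1 hh p hq) 1 one_pos
  simp only [one_smul] at h1
  intro x hx
  exact hH.eq_integral_of_ae_eq hT hφ hm (measurable_transformDensity hw hh q)
    (norm_transformDensity hw1 hh q) h1 hx

end Transform

end FresnelGFFT
end

/-! ### The convolution theorem -/

open FresnelGFFT in
theorem theorem3p6 (T : ℝ) (hT : 0 < T)
    (m : Measure (C0 T)) (hm : IsWienerMeasure T m)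
    (φ : ℕ → ℝ → ℝ) (hφ : IsPWZBasis T φ)
    (h k₁ k₂ s₁ s₂ : ℝ → ℝ)
    (hh : MemLp h ⊤ (leb T)) (hk₁ : MemLp k₁ ⊤ (leb T)) (hk₂ : MemLp k₂ ⊤ (leb T))
    (hh0 : ¬ h =ᵐ[leb T] 0) (hk₁0 : ¬ k₁ =ᵐ[leb T] 0) (hk₂0 : ¬ k₂ =ᵐ[leb T] 0)
    (hhk : ∀ᵐ t ∂(leb T), h t ^ 2 = k₁ t * k₂ t)
    (hs₁ : MemLp s₁ 2 (leb T)) (hs₂ : MemLp s₂ 2 (leb T))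
    (hs₁h : ∀ᵐ t ∂(leb T), s₁ t ^ 2 = h t ^ 2 + k₁ t ^ 2)
    (hs₂h : ∀ᵐ t ∂(leb T), s₂ t ^ 2 = h t ^ 2 + k₂ t ^ 2)
    (F G : C0 T → ℂ) (hF : MemS φ F) (hG : MemS φ G)
    (p : ℝ) (hp : p ∈ Icc (1 : ℝ) 2) (q : ℝ) (hq : q ≠ 0) :
    (∃ H₁ : C0 T → ℂ, MemS φ H₁ ∧ IsGFFT m φ p q (fun t => s₁ t / Real.sqrt 2) F H₁) ∧
    (∃ H₂ : C0 T → ℂ, MemS φ H₂ ∧ IsGFFT m φ p q (fun t => s₂ t / Real.sqrt 2) G H₂) ∧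
    (∃ K : C0 T → ℂ, IsGFFT m φ p q h
      (fun y => F ((Real.sqrt 2)⁻¹ • y) * G ((Real.sqrt 2)⁻¹ • y)) K) ∧
    ∀ H₁ H₂ K : C0 T → ℂ,
      MemS φ H₁ → IsGFFT m φ p q (fun t => s₁ t / Real.sqrt 2) F H₁ →
      MemS φ H₂ → IsGFFT m φ p q (fun t => s₂ t / Real.sqrt 2) G H₂ →
      IsGFFT m φ p q h (fun y => F ((Real.sqrt 2)⁻¹ • y) * G ((Real.sqrt 2)⁻¹ • y)) K →
      SAE m fun y => HasGCP m φ (-q) k₁ k₂ H₁ H₂ y (K y) := by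
  have hs₁' := memLp_top_div_sqrt_two hh hk₁ hs₁.1 hs₁h
  have hs₂' := memLp_top_div_sqrt_two hh hk₂ hs₂.1 hs₂h
  obtain ⟨ν₁, w₁, hν₁, hw₁, hw₁1, hF'⟩ := hF.exists_eq_integral hT hφ
  obtain ⟨ν₂, w₂, hν₂, hw₂, hw₂1, hG'⟩ := hG.exists_eq_integral hT hφ
  have hFw : IsExpIntegral φ ν₁ w₁ F := hF'
  have hGw : IsExpIntegral φ ν₂ w₂ G := hG'
  have hK₀ := hFw.isGFFT_mul hT hφ hm hGw hw₁ hw₂ hw₁1 hw₂1 hh p hq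
  refine ⟨hFw.exists_memS_isGFFT hT hφ hm hw₁ hw₁1 hs₁' p hq,
    hGw.exists_memS_isGFFT hT hφ hm hw₂ hw₂1 hs₂' p hq, ⟨_, hK₀⟩,
    fun H₁ H₂ K hH₁ hFH₁ hH₂ hGH₂ hK ρ hρ => ?_⟩
  have hE₁ := hFw.isExpIntegral_transform hT hφ hm hw₁ hw₁1 hs₁' hp.1 hq hH₁ hFH₁
  have hE₂ := hGw.isExpIntegral_transform hT hφ hm hw₂ hw₂1 hs₂' hp.1 hq hH₂ hGH₂
  filter_upwards [sae_ae_hasPWZ hT hφ hm ν₁ ρ hρ, sae_ae_hasPWZ hT hφ hm ν₂ ρ hρ,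
    hK.sae_eq hp.1 hK₀ ρ hρ] with y hy hy' hKy
  have hgcp := hE₁.hasGCP hT hφ hm hE₂ hk₁ hk₂ (measurable_transformDensity hw₁ hs₁' q)
    (measurable_transformDensity hw₂ hs₂' q) (norm_transformDensity hw₁1 hs₁' q)
    (norm_transformDensity hw₂1 hs₂' q) (neg_ne_zero.2 hq) hy hy'
  rw [hKy]
  convert! hgcp using 1
  refine MeasureTheory.integral_congr_ae (Filter.Eventually.of_forall fun e => ?_)
  have hvar := congrArg (fun r : ℝ => (r : ℂ))
    (norm_sq_add_norm_sq_sub hh hk₁ hk₂ hs₁' hs₂' hhk hs₁h hs₂h e.1 e.2)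
  simp only [transformDensity]
  rw [← hvar]
  -- Passing from q to -q flips the sign of the exponent, which is why ‖k₁u - k₂v‖² is subtracted in
  -- the identity of variances.
  have hneg : (2 * (-Complex.I * ((-q : ℝ) : ℂ)))⁻¹ = -(2 * (-Complex.I * (q : ℂ)))⁻¹ := by
    rw [Complex.ofReal_neg, mul_neg, mul_neg, inv_neg]
  rw [hneg]
  generalize (2 * (-Complex.I * (q : ℂ)))⁻¹ = c
  generalize Complex.exp (Complex.I * _) = z
  generalize ‖mulL2 hs₁' e.1‖ ^ 2 = a₁
  generalize ‖mulL2 hs₂' e.2‖ ^ 2 = a₂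
  generalize ‖(Real.sqrt 2)⁻¹ • (mulL2 hk₁ e.1 + (-1 : ℝ) • mulL2 hk₂ e.2)‖ ^ 2 = a₃
  have hexp : Complex.exp (-((a₁ + a₂ - a₃ : ℝ) : ℂ) * c) =
      Complex.exp (-(a₁ : ℂ) * c) * Complex.exp (-(a₂ : ℂ) * c) * Complex.exp (-(a₃ : ℂ) * -c) := by
    rw [← Complex.exp_add, ← Complex.exp_add]
    congr 1
    push_cast
    ring
  rw [hexp]
  ring
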